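/- Let $\mathbb S^2$ be the unit sphere, $\mathbb H^2$ the hyperbolic plane of Gaussian curvature $-1$, and let $\mathbb S^2\times\mathbb H^2$ carry the product metric $\langle\cdot,\cdot\rangle$ and the complex structures $J_1=(J_{\mathbb S^2},J_{\mathbb H^2})$ and $J_2=(J_{\mathbb S^2},-J_{\mathbb H^2})$, where $J_{\mathbb S^2}$ and $J_{\mathbb H^2}$ are the standard complex structures of the factors. Let $\Phi\colon\Sigma\to\mathbb S^2\times\mathbb H^2$ be a smooth immersion of a surface, with the induced metric, second fundamental form $h$, mean curvature vector $H=\tfrac12\operatorname{tr}h$ and normal connection $\nabla^\perp$. Call $\Phi$ PMC if $H$ vanishes nowhere and $\nabla^\perp H=0$, and Lagrangian with respect to $J_j$ if $\Phi^*\omega_j=0$, where $\omega_j(X,Y)=\langle J_jX,Y\rangle$. Then the following hold. (i) $\Phi$ is PMC and Lagrangian with respect to at least one of $J_1$, $J_2$ if and only if $\Phi$ is locally congruent to a product of curves with constant curvatures that are not both zero. The latter means that around every point of $\Sigma$ there is a smooth chart $(t,s)$ onto a product $I\times I'$ of open intervals in which $\Phi(t,s)=F(\alpha(t),\beta(s))$,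 where $F$ is an isometry of $\mathbb S^2\times\mathbb H^2$, and $\alpha\colon I\to\mathbb S^2$ and $\beta\colon I'\to\mathbb H^2$ are smooth regular curves with constant geodesic curvatures $k_\alpha,k_\beta$, $(k_\alpha,k_\beta)\neq(0,0)$. (ii) If $\Phi$ is PMC, then it is Lagrangian with respect to $J_1$ if and only if it is Lagrangian with respect to $J_2$. -/

import Mathlib

open scoped Manifold ContDiff Matrix

noncomputable section

namespace SphereHyp

/-! ## The ambient space `S² × H²` inside `ℝ³ × ℝ³₁`

Only the topology of `ℝ³ × ℝ³` and its linear structure are used from Mathlib; every metric notion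
below refers to the explicit bilinear forms `⬝ᵥ`, `lorentz` and `form`. -/

/-- The coordinate plane `ℝ²`, the model space of surfaces. -/
abbrev E2 : Type := EuclideanSpace ℝ (Fin 2)

/-- The coordinate space `ℝ³`. -/
abbrev R3 : Type := Fin 3 → ℝ

/-- The vector space `ℝ³ × ℝ³` that contains `S² × H²`. -/
abbrev Ambient : Type := R3 × R3

/-- The Lorentzian inner product of `ℝ³₁`. -/
def lorentz (a b : R3) : ℝ := a 0 * b 0 + a 1 * b 1 - a 2 * b 2

/-- The inner product of `ℝ³ × ℝ³₁`; it restricts to the Riemannian product metric of `S² × H²`. -/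
def form (v w : Ambient) : ℝ := v.1 ⬝ᵥ w.1 + lorentz v.2 w.2

/-- The unit sphere, of Gaussian curvature `1`. -/
def S2 : Set R3 := {x | x ⬝ᵥ x = 1}

/-- The hyperbolic plane of Gaussian curvature `-1`, as the upper sheet of the hyperboloid. -/
def H2 : Set R3 := {y | lorentz y y = -1 ∧ 0 < y 2}

/-- The set of points of `S² × H²`. -/
def S2H2 : Set Ambient := S2 ×ˢ H2

/-- The tangent space of `S² × H²` at the point `p`, as a set of vectors of `ℝ³ × ℝ³`. -/
def ambientTangent (p : Ambient) : Set Ambient :=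
  {v | p.1 ⬝ᵥ v.1 = 0 ∧ lorentz p.2 v.2 = 0}

/-- Orthogonal projection of `ℝ³` onto the tangent plane of the sphere at `x`. -/
def projS (x v : R3) : R3 := v - (x ⬝ᵥ v) • x

/-- Lorentz-orthogonal projection of `ℝ³₁` onto the tangent plane of `H²` at `y`. -/
def projH (y v : R3) : R3 := v + lorentz y v • y

/-- Orthogonal projection of `ℝ³ × ℝ³₁` onto the tangent space of `S² × H²` at `p`. The Levi-Civita
connection of `S² × H²` is the projection by this map of the flat derivative. -/
def projAmbient (p v : Ambient) : Ambient := (projS p.1 v.1, projH p.2 v.2)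

/-- The complex structure of the sphere: rotation by a right angle in the tangent plane at `x`. -/
def JS (x v : R3) : R3 := x ⨯₃ v

/-- The complex structure of `H²` at `y`: the Lorentzian cross product with `y`. -/
def JH (y v : R3) : R3 := ![(y ⨯₃ v) 0, (y ⨯₃ v) 1, -(y ⨯₃ v) 2]

/-- The complex structure `J₁ = (J_{S²}, J_{H²})` at the point `p`. -/
def J₁ (p v : Ambient) : Ambient := (JS p.1 v.1, JH p.2 v.2)

/-- The complex structure `J₂ = (J_{S²}, -J_{H²})` at the point `p`. -/
def J₂ (p v : Ambient) : Ambient := (JS p.1 v.1, -JH p.2 v.2)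

/-- Isometries of the Riemannian manifold `S² × H²`: smooth bijections of `S² × H²` whose
differential preserves the metric. Smooth maps on `S² × H²` are the restrictions of smooth maps
defined on an open neighbourhood. -/
structure IsAmbientIsometry (F : Ambient → Ambient) : Prop where
  bijOn : Set.BijOn F S2H2 S2H2
  smooth : ∃ U : Set Ambient, IsOpen U ∧ S2H2 ⊆ U ∧ ContDiffOn ℝ ∞ F U
  metric : ∀ p ∈ S2H2, ∀ v ∈ ambientTangent p, ∀ w ∈ ambientTangent p,
    form (fderiv ℝ F p v) (fderiv ℝ F p w) = form v w

/-! ## Surfaces -/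

section Linear

/-- The Gram matrix of the images of the two standard basis vectors under a linear map. -/
def gram (A : E2 →L[ℝ] Ambient) : Matrix (Fin 2) (Fin 2) ℝ :=
  Matrix.of fun i j =>
    form (A (EuclideanSpace.single i 1)) (A (EuclideanSpace.single j 1))

/-- The component of `v` normal to the surface, within the tangent space of `S² × H²` at `p`. Here
`A` is the differential of the surface, whose range is the tangent plane: `v` is projected onto the
tangent space of `S² × H²`, and then its orthogonal projection onto the range of `A` is removed. -/
def normalPart (p : Ambient) (A : E2 →L[ℝ] Ambient) (v : Ambient) : Ambient :=
  projAmbient p v - ∑ i, ∑ j,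
    ((gram A)⁻¹ i j * form (projAmbient p v) (A (EuclideanSpace.single i 1))) •
      A (EuclideanSpace.single j 1)

end Linear

section Surface

variable {S : Type*} [TopologicalSpace S] [ChartedSpace E2 S]

/-- The differential of `Φ` at `p`. Mathlib identifies the tangent space of `S` at `p` with `ℝ²`
by means of the preferred chart at `p`. -/
def differential (Φ : S → Ambient) (p : S) : E2 →L[ℝ] Ambient :=
  mfderiv (𝓡 2) 𝓘(ℝ, Ambient) Φ p

/-- `Φ` is a smooth immersion of the surface `S` into `S² × H²`. -/
structure IsImmersionIntoS2H2 (Φ : S → Ambient) : Prop where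
  smooth : ContMDiff (𝓡 2) 𝓘(ℝ, Ambient) ∞ Φ
  mem : ∀ p, Φ p ∈ S2H2
  injective : ∀ p, Function.Injective (differential Φ p)

/-- The second derivative of `Φ` at `p`, in the preferred chart at `p`. -/
def secondDerivative (Φ : S → Ambient) (p : S) : E2 →L[ℝ] E2 →L[ℝ] Ambient :=
  fderiv ℝ (fderiv ℝ (Φ ∘ (extChartAt (𝓡 2) p).symm)) (extChartAt (𝓡 2) p p)

/-- The second fundamental form `h(X, Y)` of `Φ` at `p`, the normal component of
`∇̃_X (dΦ Y)`. The vector `Y` is extended with constant coordinates; the extension does not matter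
for the normal component. -/
def secondFundamentalForm (Φ : S → Ambient) (p : S) (X Y : E2) : Ambient :=
  normalPart (Φ p) (differential Φ p) (secondDerivative Φ p X Y)

/-- The mean curvature vector `H = (1/2) tr h`, the trace being taken with respect to the metric
that `Φ` induces on `S`. -/
def meanCurvature (Φ : S → Ambient) (p : S) : Ambient :=
  (1 / 2 : ℝ) • ∑ i, ∑ j, (gram (differential Φ p))⁻¹ i j •
    secondFundamentalForm Φ p (EuclideanSpace.single i 1) (EuclideanSpace.single j 1)

/-- The covariant derivative `∇^⊥_X ξ` at `p` of a field `ξ` along `Φ` in the normal bundle. -/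
def normalDerivative (Φ : S → Ambient) (ξ : S → Ambient) (p : S) (X : E2) : Ambient :=
  normalPart (Φ p) (differential Φ p) (differential ξ p X)

/-- `Φ` has parallel mean curvature: `H` does not vanish and `∇^⊥ H = 0`. (For a smooth immersion,
`H` is always differentiable.) -/
structure IsPMC (Φ : S → Ambient) : Prop where
  ne_zero : ∀ p, meanCurvature Φ p ≠ 0
  differentiable : MDifferentiable (𝓡 2) 𝓘(ℝ, Ambient) (meanCurvature Φ)
  parallel : ∀ p X, normalDerivative Φ (meanCurvature Φ) p X = 0

/-- `Φ` is Lagrangian with respect to `J`: the pullback by `Φ` of the Kähler form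
`ω(v, w) = ⟨J v, w⟩` vanishes. -/
def IsLagrangian (J : Ambient → Ambient → Ambient) (Φ : S → Ambient) : Prop :=
  ∀ p X Y, form (J (Φ p) (differential Φ p X)) (differential Φ p Y) = 0

end Surface

/-! ## Curves of constant curvature and their products -/

/-- The geodesic curvature `⟨∇_{α'} α', J α'⟩ / |α'|³` of a curve in `S²`. -/
def curvatureS (α : ℝ → R3) (t : ℝ) : ℝ :=
  (projS (α t) (deriv (deriv α) t) ⬝ᵥ JS (α t) (deriv α t)) /
    √(deriv α t ⬝ᵥ deriv α t) ^ 3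

/-- The geodesic curvature `⟨∇_{β'} β', J β'⟩ / |β'|³` of a curve in `H²`. -/
def curvatureH (β : ℝ → R3) (s : ℝ) : ℝ :=
  lorentz (projH (β s) (deriv (deriv β) s)) (JH (β s) (deriv β s)) /
    √(lorentz (deriv β s) (deriv β s)) ^ 3

/-- `α` is a smooth regular curve in `S²`, defined on the open interval `I`, with constant
curvature `k`. -/
structure IsConstCurvatureCurveS (I : Set ℝ) (α : ℝ → R3) (k : ℝ) : Prop where
  isOpen : IsOpen I
  ordConnected : I.OrdConnected
  smooth : ContDiffOn ℝ ∞ α I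
  mem : ∀ t ∈ I, α t ∈ S2
  regular : ∀ t ∈ I, deriv α t ≠ 0
  curvature : ∀ t ∈ I, curvatureS α t = k

/-- `β` is a smooth regular curve in `H²`, defined on the open interval `I`, with constant
curvature `k`. -/
structure IsConstCurvatureCurveH (I : Set ℝ) (β : ℝ → R3) (k : ℝ) : Prop where
  isOpen : IsOpen I
  ordConnected : I.OrdConnected
  smooth : ContDiffOn ℝ ∞ β I
  mem : ∀ s ∈ I, β s ∈ H2
  regular : ∀ s ∈ I, deriv β s ≠ 0
  curvature : ∀ s ∈ I, curvatureH β s = k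

/-- `Φ` is locally congruent to a product of curves with constant curvatures that are not both zero:
around every point there is a smooth chart `e` onto a product `I × I'` of open intervals in which
`Φ` is `(t, s) ↦ F (α t, β s)`, for an isometry `F` of `S² × H²` and curves `α` in `S²` and `β` in
`H²` of constant curvature. -/
def IsLocallyProductOfCurves {S : Type*} [TopologicalSpace S] [ChartedSpace E2 S]
    (Φ : S → Ambient) : Prop :=
  ∀ p : S, ∃ e ∈ IsManifold.maximalAtlas (𝓡 2) ∞ S, p ∈ e.source ∧
    ∃ (I I' : Set ℝ) (α β : ℝ → R3) (kα kβ : ℝ) (F : Ambient → Ambient),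
      IsConstCurvatureCurveS I α kα ∧ IsConstCurvatureCurveH I' β kβ ∧
      (kα ≠ 0 ∨ kβ ≠ 0) ∧ IsAmbientIsometry F ∧
      e.target = {u : E2 | u 0 ∈ I ∧ u 1 ∈ I'} ∧
      ∀ u ∈ e.target, Φ (e.symm u) = F (α (u 0), β (u 1))

end SphereHyp

end

open scoped Manifold ContDiff Matrix

noncomputable section

namespace SphereHyp

/-! ### Bilinear algebra of `ℝ³ × ℝ³₁` -/

/-! Let ω_S and ω_H be the pullbacks to the surface of the area forms of the two factors. The Kähler
forms of the two structures are ω_S + ε ω_H with ε = ±1, and both are treated at once through `Jsgn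
ε`.

The heart is part (ii). On a surface that is Lagrangian for J = `Jsgn ε`, an orthonormal tangent
frame e₁, e₂ is a unitary frame of the ambient tangent space. The curl of the connection form β(X) =
∑ ⟨∇_X eᵢ, J eᵢ⟩ of the canonical bundle is the Ricci form up to sign. The factors have curvatures 1
and -1, so the Ricci form of J is ω_S - ε ω_H, the Kähler form of the other structure
(`frame_curvature`, `connectionForm_curl`). On the other hand, total symmetry of ⟨h(X, Y), J Z⟩
gives β(X) = 2⟨H, J X⟩, and this form is closed when ∇^⊥ H = 0 (`fderiv_form_patchH`). Hence the
other Kähler form vanishes too (`kaehler_neg_eq_zero`).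

If both Kähler forms vanish, so do ω_S and ω_H. Then each component of dΦ has rank one, and a
coordinate function of each component together give a chart in which the S²-part depends on the
first variable only and the H²-part on the second (`exists_component_chart`, `exists_eq_prodCurve`).
So Φ is a product of curves, with H = (k_α N_α, k_β N_β) / 2 for the unit normals N_α, N_β
(`patchH_prodCurve`). Parallelism of H means constancy of both curvatures, and H ≠ 0 means that they
are not both zero.

In the converse the only difficulty is the arbitrary isometry F. By Koszul's formula F preserves
geodesics. Those in an S²-slice close up, while a geodesic that moves in H² never returns, so dF
respects the splitting of the tangent spaces. As geodesics from one point reach every other, F is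
the restriction of a product of linear isometries (`exists_isLinearIsometry`), and these visibly
preserve all data. -/

theorem form_apply (v w : Ambient) :
    form v w = v.1 0 * w.1 0 + v.1 1 * w.1 1 + v.1 2 * w.1 2 +
      (v.2 0 * w.2 0 + v.2 1 * w.2 1 - v.2 2 * w.2 2) := by
  simp [form, lorentz, dotProduct, Fin.sum_univ_three]

theorem dot_apply (v w : R3) : v ⬝ᵥ w = v 0 * w 0 + v 1 * w 1 + v 2 * w 2 := by
  simp [dotProduct, Fin.sum_univ_three]

/-- The complex structure `(J_{S²}, ε J_{H²})`. -/
def Jsgn (ε : ℝ) (p v : Ambient) : Ambient := (JS p.1 v.1, ε • JH p.2 v.2)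

theorem J₁_eq : J₁ = Jsgn 1 := by
  funext p v; simp [J₁, Jsgn]

theorem J₂_eq : J₂ = Jsgn (-1) := by
  funext p v; simp [J₂, Jsgn]

theorem JS_zero (x v : R3) : JS x v 0 = x 1 * v 2 - x 2 * v 1 := by
  simp [JS, cross_apply]
theorem JS_one (x v : R3) : JS x v 1 = x 2 * v 0 - x 0 * v 2 := by
  simp [JS, cross_apply]
theorem JS_two (x v : R3) : JS x v 2 = x 0 * v 1 - x 1 * v 0 := by
  simp [JS, cross_apply]
theorem JH_zero (x v : R3) : JH x v 0 = x 1 * v 2 - x 2 * v 1 := by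
  simp [JH, cross_apply]
theorem JH_one (x v : R3) : JH x v 1 = x 2 * v 0 - x 0 * v 2 := by
  simp [JH, cross_apply]
theorem JH_two (x v : R3) : JH x v 2 = -(x 0 * v 1 - x 1 * v 0) := by
  simp [JH, cross_apply]

/-- `form` as a continuous bilinear map. -/
def formB : Ambient →L[ℝ] Ambient →L[ℝ] ℝ :=
  (LinearMap.mk₂ ℝ form
    (fun a b c => by simp only [form_apply, Prod.fst_add, Prod.snd_add, Pi.add_apply]; ring)
    (fun a b c => by
      simp only [form_apply, Prod.smul_fst, Prod.smul_snd, Pi.smul_apply, smul_eq_mul]; ring)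
    (fun a b c => by simp only [form_apply, Prod.fst_add, Prod.snd_add, Pi.add_apply]; ring)
    (fun a b c => by
      simp only [form_apply, Prod.smul_fst, Prod.smul_snd, Pi.smul_apply, smul_eq_mul];
      ring)).toContinuousBilinearMap

@[simp] theorem formB_apply (v w : Ambient) : formB v w = form v w := rfl

/-- `Jsgn` as a continuous bilinear map. -/
def JB (ε : ℝ) : Ambient →L[ℝ] Ambient →L[ℝ] Ambient :=
  (LinearMap.mk₂ ℝ (Jsgn ε)
    (fun a b c => by
      ext i <;> fin_cases i <;> simp [Jsgn, JS_zero, JS_one, JS_two, JH_zero, JH_one, JH_two] <;>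
        ring)
    (fun a b c => by
      ext i <;> fin_cases i <;> simp [Jsgn, JS_zero, JS_one, JS_two, JH_zero, JH_one, JH_two] <;>
        ring)
    (fun a b c => by
      ext i <;> fin_cases i <;> simp [Jsgn, JS_zero, JS_one, JS_two, JH_zero, JH_one, JH_two] <;>
        ring)
    (fun a b c => by
      ext i <;> fin_cases i <;> simp [Jsgn, JS_zero, JS_one, JS_two, JH_zero, JH_one, JH_two] <;>
        ring)).toContinuousBilinearMap

@[simp] theorem JB_apply (ε : ℝ) (p v : Ambient) : JB ε p v = Jsgn ε p v := rfl

theorem form_comm (v w : Ambient) : form v w = form w v := by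
  simp only [form_apply]; ring

@[simp] theorem form_zero_left (v : Ambient) : form 0 v = 0 := by simp [form_apply]

theorem form_add_left (a b v : Ambient) : form (a + b) v = form a v + form b v := by
  simp [← formB_apply]
theorem form_add_right (v a b : Ambient) : form v (a + b) = form v a + form v b := by
  simp [← formB_apply]
theorem form_sub_left (a b v : Ambient) : form (a - b) v = form a v - form b v := by
  simp [← formB_apply]
theorem form_sub_right (v a b : Ambient) : form v (a - b) = form v a - form v b := by
  simp [← formB_apply]
theorem form_smul_left (c : ℝ) (a v : Ambient) : form (c • a) v = c * form a v := by
  simp [← formB_apply]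
theorem form_smul_right (c : ℝ) (v a : Ambient) : form v (c • a) = c * form v a := by
  simp [← formB_apply]
theorem form_sum_left {ι : Type*} (s : Finset ι) (a : ι → Ambient) (v : Ambient) :
    form (∑ i ∈ s, a i) v = ∑ i ∈ s, form (a i) v := by
  simp [← formB_apply]
theorem form_sum_right {ι : Type*} (s : Finset ι) (a : ι → Ambient) (v : Ambient) :
    form v (∑ i ∈ s, a i) = ∑ i ∈ s, form v (a i) := by
  simp [← formB_apply]

theorem Jsgn_add (ε : ℝ) (p a b : Ambient) : Jsgn ε p (a + b) = Jsgn ε p a + Jsgn ε p b := by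
  simp [← JB_apply]
theorem Jsgn_smul (ε c : ℝ) (p a : Ambient) : Jsgn ε p (c • a) = c • Jsgn ε p a := by
  simp [← JB_apply]

theorem form_Jsgn_comm (ε : ℝ) (p v w : Ambient) :
    form (Jsgn ε p v) w = -form v (Jsgn ε p w) := by
  simp only [form_apply, Jsgn, JS_zero, JS_one, JS_two, JH_zero, JH_one, JH_two, Pi.smul_apply,
    smul_eq_mul]
  ring

theorem form_Jsgn_self (ε : ℝ) (p v : Ambient) : form (Jsgn ε p v) v = 0 := by
  have h := form_Jsgn_comm ε p v v
  rw [form_comm v] at h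
  linarith

/-! ### Tangent spaces of `S² × H²` -/

/-- The tangent space as a submodule. -/
def tangentSub (p : Ambient) : Submodule ℝ Ambient where
  carrier := ambientTangent p
  add_mem' := by
    rintro a b ⟨h1, h2⟩ ⟨h3, h4⟩
    simp only [dot_apply, lorentz] at *
    constructor <;> simp only [dot_apply, lorentz, Prod.fst_add, Prod.snd_add, Pi.add_apply] <;>
      linarith
  zero_mem' := by simp [ambientTangent, lorentz]
  smul_mem' := by
    rintro c a ⟨h1, h2⟩
    simp only [dot_apply, lorentz] at *
    constructor <;> simp only [dot_apply, lorentz, Prod.smul_fst, Prod.smul_snd, Pi.smul_apply,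
      smul_eq_mul]
    · linear_combination c * h1
    · linear_combination c * h2

theorem form_fst {p v : Ambient} : form (p.1, 0) v = p.1 ⬝ᵥ v.1 := by
  simp [form, lorentz]

theorem form_snd {p v : Ambient} : form (0, p.2) v = lorentz p.2 v.2 := by
  simp [form]

theorem mem_tangentSub_iff_form {p v : Ambient} :
    v ∈ tangentSub p ↔ form (p.1, 0) v = 0 ∧ form (0, p.2) v = 0 := by
  rw [form_fst, form_snd]; rfl

theorem Jsgn_mem (ε : ℝ) (p v : Ambient) : Jsgn ε p v ∈ tangentSub p := by
  constructor
  · simp only [dot_apply, Jsgn, JS_zero, JS_one, JS_two]; ring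
  · simp only [lorentz, Jsgn, Pi.smul_apply, smul_eq_mul, JH_zero, JH_one, JH_two]; ring

theorem dot_JS_JS {x : R3} (hx : x ⬝ᵥ x = 1) {v : R3} (hv : x ⬝ᵥ v = 0) (w : R3) :
    JS x v ⬝ᵥ JS x w = v ⬝ᵥ w := by
  simp only [dot_apply, JS_zero, JS_one, JS_two] at *
  linear_combination (v 0 * w 0 + v 1 * w 1 + v 2 * w 2) * hx -
    (x 0 * w 0 + x 1 * w 1 + x 2 * w 2) * hv

theorem lorentz_JH_JH {y : R3} (hy : lorentz y y = -1) {v : R3} (hv : lorentz y v = 0) (w : R3) :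
    lorentz (JH y v) (JH y w) = lorentz v w := by
  simp only [lorentz, JH_zero, JH_one, JH_two] at *
  linear_combination -(v 0 * w 0 + v 1 * w 1 - v 2 * w 2) * hy +
    (y 0 * w 0 + y 1 * w 1 - y 2 * w 2) * hv

theorem form_mk (a b : R3) (v : Ambient) : form (a, b) v = a ⬝ᵥ v.1 + lorentz b v.2 := rfl

theorem lorentz_smul_smul (c d : ℝ) (a b : R3) : lorentz (c • a) (d • b) = c * d * lorentz a b := by
  simp only [lorentz, Pi.smul_apply, smul_eq_mul]; ring

theorem form_Jsgn_Jsgn {ε : ℝ} (hε : ε * ε = 1) {p v : Ambient} (hp : p ∈ S2H2)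
    (hv : v ∈ tangentSub p) (w : Ambient) : form (Jsgn ε p v) (Jsgn ε p w) = form v w := by
  simp only [form, Jsgn, lorentz_smul_smul, hε, dot_JS_JS hp.1 hv.1, lorentz_JH_JH hp.2.1 hv.2,
    one_mul]

/-- Two vectors orthogonal to `x` have a cross product proportional to `x`. This is what makes the
complex structure parallel: its derivative along the surface applied to a tangent vector is a cross
product of tangent vectors, hence normal. -/
theorem cross_tangent {x u v : R3} (hx : x ⬝ᵥ x = 1) (hu : x ⬝ᵥ u = 0) (hv : x ⬝ᵥ v = 0)
    (a : R3) : a ⬝ᵥ JS u v = -((x ⬝ᵥ a) * (u ⬝ᵥ JS x v)) := by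
  simp only [dot_apply, JS_zero, JS_one, JS_two] at *
  linear_combination
    (-(a 0 * (u 1 * v 2 - u 2 * v 1) + a 1 * (u 2 * v 0 - u 0 * v 2) +
      a 2 * (u 0 * v 1 - u 1 * v 0))) * hx +
    (a 0 * (x 1 * v 2 - x 2 * v 1) + a 1 * (x 2 * v 0 - x 0 * v 2) +
      a 2 * (x 0 * v 1 - x 1 * v 0)) * hu -
    (a 0 * (x 1 * u 2 - x 2 * u 1) + a 1 * (x 2 * u 0 - x 0 * u 2) +
      a 2 * (x 0 * u 1 - x 1 * u 0)) * hv

theorem lorentz_cross_tangent {y u v : R3} (hy : lorentz y y = -1) (hu : lorentz y u = 0)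
    (hv : lorentz y v = 0) (a : R3) :
    lorentz a (JH u v) = lorentz y a * lorentz u (JH y v) := by
  simp only [lorentz, JH_zero, JH_one, JH_two] at *
  linear_combination
    ((a 0 * (u 1 * v 2 - u 2 * v 1) + a 1 * (u 2 * v 0 - u 0 * v 2) +
      a 2 * (u 0 * v 1 - u 1 * v 0))) * hy -
    (a 0 * (y 1 * v 2 - y 2 * v 1) + a 1 * (y 2 * v 0 - y 0 * v 2) +
      a 2 * (y 0 * v 1 - y 1 * v 0)) * hu +
    (a 0 * (y 1 * u 2 - y 2 * u 1) + a 1 * (y 2 * u 0 - y 0 * u 2) +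
      a 2 * (y 0 * u 1 - y 1 * u 0)) * hv

/-- Orthonormal quadruples of tangent vectors span the tangent space. -/
theorem eq_zero_of_orthonormal {p : Ambient} (hp : p ∈ S2H2) (E : Fin 4 → Ambient)
    (hE : ∀ i, E i ∈ tangentSub p) (hort : ∀ i j, form (E i) (E j) = if i = j then 1 else 0)
    {v : Ambient} (hv : v ∈ tangentSub p) (h : ∀ i, form v (E i) = 0) : v = 0 := by
  -- Together with the radial vectors `(p.1, 0)` and `(0, p.2)` the `E i` have the diagonal Gram
  -- matrix with entries 1, 1, 1, 1, 1, -1. So the six functionals are jointly surjective, hence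
  -- injective by dimension.
  let L : Ambient →ₗ[ℝ] (Fin 4 → ℝ) × ℝ × ℝ :=
    (LinearMap.pi fun i => (formB (E i)).toLinearMap).prod
      ((formB (p.1, 0)).toLinearMap.prod (formB (0, p.2)).toLinearMap)
  have hdim : Module.finrank ℝ Ambient = Module.finrank ℝ ((Fin 4 → ℝ) × ℝ × ℝ) := by
    simp
  have e1 : form (p.1, 0) (p.1, 0) = 1 := by rw [form_fst]; exact hp.1
  have e2 : form (0, p.2) (0, p.2) = -1 := by rw [form_snd]; exact hp.2.1
  have e3 : form (0, p.2) (p.1, 0) = 0 := by simp [form, lorentz]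
  have e4 : form (p.1, 0) (0, p.2) = 0 := by simp [form, lorentz]
  have e5 : ∀ i, form (p.1, 0) (E i) = 0 := fun i => (mem_tangentSub_iff_form.1 (hE i)).1
  have e6 : ∀ i, form (0, p.2) (E i) = 0 := fun i => (mem_tangentSub_iff_form.1 (hE i)).2
  have hsurj : Function.Surjective L := by
    rintro ⟨c, a, b⟩
    refine ⟨∑ i, c i • E i + a • ((p.1, 0) : Ambient) - b • ((0, p.2) : Ambient), ?_⟩
    refine Prod.ext ?_ (Prod.ext ?_ ?_)
    · funext j
      change form (E j) _ = c j
      rw [form_sub_right, form_add_right, form_smul_right, form_smul_right, form_sum_right,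
        form_comm (E j) (p.1, 0), form_comm (E j) (0, p.2), e5, e6]
      simp [form_smul_right, hort]
    · change form (p.1, 0) _ = a
      rw [form_sub_right, form_add_right, form_smul_right, form_smul_right, form_sum_right, e1, e4]
      simp [form_smul_right, e5]
    · change form (0, p.2) _ = b
      rw [form_sub_right, form_add_right, form_smul_right, form_smul_right, form_sum_right, e2, e3]
      simp [form_smul_right, e6]
  have hinj := (LinearMap.injective_iff_surjective_of_finrank_eq_finrank hdim).2 hsurj
  apply hinj
  rw [map_zero]
  refine Prod.ext ?_ (Prod.ext ?_ ?_)
  · funext i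
    change form (E i) v = 0
    rw [form_comm, h]
  · exact (mem_tangentSub_iff_form.1 hv).1
  · exact (mem_tangentSub_iff_form.1 hv).2

/-- Two tangent vectors spanning a Lagrangian plane form a unitary basis. -/
structure IsUnitaryFrame (ε : ℝ) (p e f : Ambient) : Prop where
  mem_fst : e ∈ tangentSub p
  mem_snd : f ∈ tangentSub p
  form_fst : form e e = 1
  form_snd : form f f = 1
  form_fst_snd : form e f = 0
  form_J : form (Jsgn ε p e) f = 0

namespace IsUnitaryFrame

variable {ε : ℝ} {p e f : Ambient}

theorem orthonormal (h : IsUnitaryFrame ε p e f) (hε : ε * ε = 1) (hp : p ∈ S2H2) (i j : Fin 4) :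
    form ((![e, f, Jsgn ε p e, Jsgn ε p f] : Fin 4 → Ambient) i)
      ((![e, f, Jsgn ε p e, Jsgn ε p f] : Fin 4 → Ambient) j) = if i = j then 1 else 0 := by
  have a1 : form f e = 0 := by rw [form_comm]; exact h.form_fst_snd
  have a2 : form f (Jsgn ε p e) = 0 := by rw [form_comm]; exact h.form_J
  have a3 : form e (Jsgn ε p f) = 0 := by
    have := form_Jsgn_comm ε p e f
    rw [h.form_J] at this; linarith
  have a4 : form (Jsgn ε p f) e = 0 := by rw [form_comm]; exact a3
  have a5 : form e (Jsgn ε p e) = 0 := by rw [form_comm]; exact form_Jsgn_self ..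
  have a6 : form f (Jsgn ε p f) = 0 := by rw [form_comm]; exact form_Jsgn_self ..
  fin_cases i <;> fin_cases j <;>
    simp [h.form_fst, h.form_snd, h.form_fst_snd, h.form_J, a1, a2, a3, a4, a5, a6,
      form_Jsgn_self, form_Jsgn_Jsgn hε hp h.mem_fst, form_Jsgn_Jsgn hε hp h.mem_snd]

theorem eq_zero (h : IsUnitaryFrame ε p e f) (hε : ε * ε = 1) (hp : p ∈ S2H2) {v : Ambient}
    (hv : v ∈ tangentSub p) (h1 : form v e = 0) (h2 : form v f = 0)
    (h3 : form v (Jsgn ε p e) = 0) (h4 : form v (Jsgn ε p f) = 0) : v = 0 := by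
  refine eq_zero_of_orthonormal hp ![e, f, Jsgn ε p e, Jsgn ε p f] ?_ (h.orthonormal hε hp) hv ?_
  · intro i
    fin_cases i
    exacts [h.mem_fst, h.mem_snd, Jsgn_mem .., Jsgn_mem ..]
  · intro i
    fin_cases i
    exacts [h1, h2, h3, h4]

theorem expand (h : IsUnitaryFrame ε p e f) (hε : ε * ε = 1) (hp : p ∈ S2H2) {v : Ambient}
    (hv : v ∈ tangentSub p) :
    v = form v e • e + form v f • f + form v (Jsgn ε p e) • Jsgn ε p e +
      form v (Jsgn ε p f) • Jsgn ε p f := by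
  have a1 : form f e = 0 := by rw [form_comm]; exact h.form_fst_snd
  have a2 : form f (Jsgn ε p e) = 0 := by rw [form_comm]; exact h.form_J
  have a3 : form e (Jsgn ε p f) = 0 := by
    have := form_Jsgn_comm ε p e f
    rw [h.form_J] at this; linarith
  have a4 : form (Jsgn ε p f) e = 0 := by rw [form_comm]; exact a3
  have a5 : form e (Jsgn ε p e) = 0 := by rw [form_comm]; exact form_Jsgn_self ..
  have a6 : form f (Jsgn ε p f) = 0 := by rw [form_comm]; exact form_Jsgn_self ..
  refine sub_eq_zero.1 (h.eq_zero hε hp ?_ ?_ ?_ ?_ ?_)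
  · have := h.mem_fst
    have := h.mem_snd
    have := Jsgn_mem ε p e
    have := Jsgn_mem ε p f
    refine Submodule.sub_mem _ hv ?_
    refine Submodule.add_mem _ (Submodule.add_mem _ (Submodule.add_mem _ ?_ ?_) ?_) ?_ <;>
      exact Submodule.smul_mem _ _ ‹_›
  all_goals
    simp [form_sub_left, form_add_left, form_smul_left, h.form_fst, h.form_snd, h.form_fst_snd,
      h.form_J, a1, a2, a3, a4, a5, a6,
        form_Jsgn_self, form_Jsgn_Jsgn hε hp h.mem_fst, form_Jsgn_Jsgn hε hp h.mem_snd]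

/-- Only `v` has to be tangent: the normal components of `w` do not pair with it. This allows `w` to
be the flat derivative of a frame vector. -/
theorem parseval (h : IsUnitaryFrame ε p e f) (hε : ε * ε = 1) (hp : p ∈ S2H2) {v : Ambient}
    (hv : v ∈ tangentSub p) (w : Ambient) :
    form v w = form v e * form w e + form v f * form w f +
      form v (Jsgn ε p e) * form w (Jsgn ε p e) + form v (Jsgn ε p f) * form w (Jsgn ε p f) := by
  conv_lhs => rw [form_comm, h.expand hε hp hv]
  simp only [form_add_right, form_smul_right]

end IsUnitaryFrame

/-! ### Normal projections -/

/-- The standard basis of `ℝ²`. -/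
def bv (i : Fin 2) : E2 := EuclideanSpace.single i 1

@[simp] theorem bv_apply (i j : Fin 2) : bv i j = if j = i then 1 else 0 := by
  simp [bv]

theorem normalPart_eq (p : Ambient) (A : E2 →L[ℝ] Ambient) (v : Ambient) :
    normalPart p A v = projAmbient p v - ∑ i, ∑ j,
      ((gram A)⁻¹ i j * form (projAmbient p v) (A (bv i))) • A (bv j) := rfl

theorem eq_sum_bv (x : E2) : x = x 0 • bv 0 + x 1 • bv 1 := by
  ext i; fin_cases i <;> simp

theorem gram_apply (A : E2 →L[ℝ] Ambient) (i j : Fin 2) :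
    gram A i j = form (A (bv i)) (A (bv j)) := rfl

/-- Invariance of a metric trace under change of basis: with `M` the matrix of `T`, the Gram matrix
becomes `Mᵀ * gram A * M`, so its inverse absorbs both factors. It serves the tangential projection
as well as the trace that defines H. -/
theorem sum_gram_inv_comp {W : Type*} [AddCommGroup W] [Module ℝ W] (A : E2 →L[ℝ] Ambient)
    (T : E2 →L[ℝ] E2) (hT : Function.Injective T) (B : E2 →ₗ[ℝ] E2 →ₗ[ℝ] W) :
    ∑ i, ∑ j, (gram (A ∘L T))⁻¹ i j • B (T (bv i)) (T (bv j)) =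
      ∑ i, ∑ j, (gram A)⁻¹ i j • B (bv i) (bv j) := by
  let M : Matrix (Fin 2) (Fin 2) ℝ := Matrix.of fun k i => T (bv i) k
  have hTM : ∀ i, T (bv i) = M 0 i • bv 0 + M 1 i • bv 1 := fun i => eq_sum_bv _
  have hg : gram (A ∘L T) = Mᵀ * gram A * M := by
    ext i j
    simp only [Matrix.mul_apply, Fin.sum_univ_two, Matrix.transpose_apply, gram_apply,
      ContinuousLinearMap.comp_apply, hTM, map_add, map_smul, form_add_left, form_add_right,
      form_smul_left, form_smul_right]
    ring
  have hM : IsUnit M.det := by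
    rw [isUnit_iff_ne_zero]
    intro h0
    obtain ⟨v, hv, hv0⟩ := Matrix.exists_mulVec_eq_zero_iff.2 h0
    apply hv
    have h1 : T (v 0 • bv 0 + v 1 • bv 1) = 0 := by
      ext k
      have := congrFun hv0 k
      simp only [Matrix.mulVec, dotProduct, Fin.sum_univ_two, M, Matrix.of_apply,
        Pi.zero_apply] at this
      simp only [map_add, map_smul, PiLp.add_apply, PiLp.smul_apply, smul_eq_mul, PiLp.zero_apply]
      linarith
    have h2 := hT (h1.trans (map_zero T).symm)
    funext k
    have := congrArg (fun z : E2 => z k) h2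
    fin_cases k <;> simpa using this
  have hinv : M * (gram (A ∘L T))⁻¹ * Mᵀ = (gram A)⁻¹ := by
    rw [hg, Matrix.mul_inv_rev, Matrix.mul_inv_rev, ← Matrix.mul_assoc, Matrix.mul_nonsing_inv _ hM,
      Matrix.one_mul, Matrix.mul_assoc, Matrix.nonsing_inv_mul _ (by simpa using hM),
      Matrix.mul_one]
  rw [← hinv]
  simp only [hTM, Matrix.mul_apply, Fin.sum_univ_two, Matrix.transpose_apply, map_add, map_smul,
    LinearMap.add_apply, LinearMap.smul_apply]
  module

theorem projAmbient_eq (p v : Ambient) :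
    projAmbient p v = v - form (p.1, 0) v • (p.1, 0) + form (0, p.2) v • (0, p.2) := by
  rw [form_fst, form_snd]
  ext i <;> simp [projAmbient, projS, projH]

theorem projAmbient_of_mem {p v : Ambient} (hv : v ∈ tangentSub p) : projAmbient p v = v := by
  obtain ⟨h1, h2⟩ := mem_tangentSub_iff_form.1 hv
  rw [projAmbient_eq, h1, h2]; simp

theorem projAmbient_mem {p : Ambient} (hp : p ∈ S2H2) (v : Ambient) :
    projAmbient p v ∈ tangentSub p := by
  have e1 : form (p.1, 0) (p.1, 0) = 1 := by rw [form_fst]; exact hp.1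
  have e2 : form (0, p.2) (0, p.2) = -1 := by rw [form_snd]; exact hp.2.1
  have e3 : form (0, p.2) (p.1, 0) = 0 := by simp [form, lorentz]
  have e4 : form (p.1, 0) (0, p.2) = 0 := by simp [form, lorentz]
  rw [mem_tangentSub_iff_form, projAmbient_eq]
  constructor
  · rw [form_add_right, form_sub_right, form_smul_right, form_smul_right, e1, e4]; ring
  · rw [form_add_right, form_sub_right, form_smul_right, form_smul_right, e2, e3]; ring

theorem form_projAmbient {p w : Ambient} (hw : w ∈ tangentSub p) (v : Ambient) :
    form (projAmbient p v) w = form v w := by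
  obtain ⟨h1, h2⟩ := mem_tangentSub_iff_form.1 hw
  rw [projAmbient_eq, form_add_left, form_sub_left, form_smul_left, form_smul_left, h1, h2]
  ring

/-- The normal projection as a linear map. -/
def normalPartL (p : Ambient) (A : E2 →L[ℝ] Ambient) : Ambient →ₗ[ℝ] Ambient where
  toFun := normalPart p A
  map_add' v w := by
    simp only [normalPart_eq, projAmbient_eq, form_add_right, form_add_left, form_sub_left,
      form_smul_left, Fin.sum_univ_two]
    module
  map_smul' c v := by
    simp only [normalPart_eq, projAmbient_eq, form_smul_right, form_add_left, form_sub_left,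
      form_smul_left, Fin.sum_univ_two, RingHom.id_apply]
    module

@[simp] theorem normalPartL_apply (p : Ambient) (A : E2 →L[ℝ] Ambient) (v : Ambient) :
    normalPartL p A v = normalPart p A v := rfl

theorem normalPart_comp (p : Ambient) (A : E2 →L[ℝ] Ambient) (T : E2 →L[ℝ] E2)
    (hT : Function.Injective T) (v : Ambient) : normalPart p (A ∘L T) v = normalPart p A v := by
  let B : E2 →ₗ[ℝ] E2 →ₗ[ℝ] Ambient := LinearMap.mk₂ ℝ
    (fun x y => form (projAmbient p v) (A x) • A y)
    (fun a b c => by simp [form_add_right, add_smul])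
    (fun a b c => by simp [form_smul_right, smul_smul])
    (fun a b c => by simp)
    (fun a b c => by simp [smul_smul, mul_comm])
  have := sum_gram_inv_comp A T hT B
  simp only [B, LinearMap.mk₂_apply, smul_smul] at this
  simp only [normalPart_eq, ContinuousLinearMap.comp_apply]
  rw [this]

/-- Against ambient tangent vectors normal to the surface both projections are invisible; this
reduces statements about h, H and ∇^⊥ to flat derivatives. -/
theorem form_normalPart {p w : Ambient} {A : E2 →L[ℝ] Ambient} (hw : w ∈ tangentSub p)
    (hA : ∀ i, form (A (bv i)) w = 0) (v : Ambient) : form (normalPart p A v) w = form v w := by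
  simp [normalPart_eq, form_sub_left, form_add_left, form_smul_left, hA, form_projAmbient hw]

theorem normalPart_mem {p : Ambient} (hp : p ∈ S2H2) {A : E2 →L[ℝ] Ambient}
    (hA : ∀ x, A x ∈ tangentSub p) (v : Ambient) : normalPart p A v ∈ tangentSub p := by
  refine Submodule.sub_mem _ (projAmbient_mem hp v) ?_
  exact Submodule.sum_mem _ fun i _ => Submodule.sum_mem _ fun j _ =>
    Submodule.smul_mem _ _ (hA _)

theorem normalPart_map {p : Ambient} {A : E2 →L[ℝ] Ambient}
    (hA : ∀ x, A x ∈ tangentSub p) (hdet : (gram A).det ≠ 0) (x : E2) :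
    normalPart p A (A x) = 0 := by
  have hm : gram A * (gram A)⁻¹ = 1 := Matrix.mul_nonsing_inv _ (isUnit_iff_ne_zero.2 hdet)
  have h := fun i j => congrFun (congrFun hm i) j
  simp only [Matrix.mul_apply, Fin.sum_univ_two, Matrix.one_apply, gram_apply] at h
  rw [normalPart_eq, projAmbient_of_mem (hA x), sub_eq_zero]
  conv_lhs => rw [eq_sum_bv x]
  have hx : ∀ i, form (A x) (A (bv i)) = x 0 * form (A (bv 0)) (A (bv i)) +
      x 1 * form (A (bv 1)) (A (bv i)) := by
    intro i
    conv_lhs => rw [eq_sum_bv x]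
    simp [form_add_left, form_smul_left]
  simp only [Fin.sum_univ_two, hx, map_add, map_smul]
  have h00 := h 0 0
  have h01 := h 0 1
  have h10 := h 1 0
  have h11 := h 1 1
  simp only [if_true, Fin.isValue, zero_ne_one, one_ne_zero, if_false] at h00 h01 h10 h11
  generalize A (bv 0) = a at *
  generalize A (bv 1) = b at *
  generalize (gram A)⁻¹ = g at *
  have e0 : x 0 = (g 0 0 * (x 0 * form a a + x 1 * form b a)) +
      (g 1 0 * (x 0 * form a b + x 1 * form b b)) := by
    linear_combination -x 0 * h00 - x 1 * h10
  have e1 : x 1 = (g 0 1 * (x 0 * form a a + x 1 * form b a)) +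
      (g 1 1 * (x 0 * form a b + x 1 * form b b)) := by
    linear_combination -x 0 * h01 - x 1 * h11
  trans (g 0 0 * (x 0 * form a a + x 1 * form b a) + g 1 0 * (x 0 * form a b + x 1 * form b b)) • a +
    (g 0 1 * (x 0 * form a a + x 1 * form b a) + g 1 1 * (x 0 * form a b + x 1 * form b b)) • b
  · rw [← e0, ← e1]
  · module

theorem form_normalPart_map {p : Ambient} {A : E2 →L[ℝ] Ambient} (hdet : (gram A).det ≠ 0)
    (v : Ambient) (k : Fin 2) :
    form (normalPart p A v) (A (bv k)) = 0 := by
  have hm : (gram A)⁻¹ * gram A = 1 := Matrix.nonsing_inv_mul _ (isUnit_iff_ne_zero.2 hdet)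
  have h := fun i j => congrFun (congrFun hm i) j
  simp only [Matrix.mul_apply, Fin.sum_univ_two, Matrix.one_apply, gram_apply] at h
  rw [normalPart_eq, form_sub_left]
  simp only [form_add_left, form_smul_left, Fin.sum_univ_two]
  have h0 := h 0 k
  have h1 := h 1 k
  fin_cases k <;> simp at h0 h1 ⊢ <;>
  linear_combination -form (projAmbient p v) (A (bv 0)) * h0 -
    form (projAmbient p v) (A (bv 1)) * h1

/-! ### Positivity -/

/-- The orthogonal complement of a timelike vector is spacelike. Eliminating `w 2` by orthogonality
turns `y 2 ^ 2 * lorentz w w` into a sum of squares, by Lagrange's identity. -/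
theorem lorentz_self_pos {y w : R3} (hy : lorentz y y = -1) (hw : lorentz y w = 0) (h : w ≠ 0) :
    0 < lorentz w w := by
  have h2 : 0 < y 2 ^ 2 := by
    simp only [lorentz] at hy; nlinarith [sq_nonneg (y 0), sq_nonneg (y 1)]
  have key : y 2 ^ 2 * lorentz w w =
      (w 0 ^ 2 + w 1 ^ 2) + (y 0 * w 1 - y 1 * w 0) ^ 2 := by
    simp only [lorentz] at *
    linear_combination -(w 0 ^ 2 + w 1 ^ 2) * hy + (y 0 * w 0 + y 1 * w 1 + y 2 * w 2) * hw
  have hpos : 0 < w 0 ^ 2 + w 1 ^ 2 := by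
    by_contra hc
    have a0 : w 0 = 0 := by nlinarith [sq_nonneg (w 0), sq_nonneg (w 1)]
    have a1 : w 1 = 0 := by nlinarith [sq_nonneg (w 0), sq_nonneg (w 1)]
    have a2 : w 2 = 0 := by
      have : y 2 * w 2 = 0 := by simpa [lorentz, a0, a1] using hw
      rcases mul_eq_zero.1 this with h' | h'
      · rw [h'] at h2; simp at h2
      · exact h'
    exact h (by ext i; fin_cases i <;> assumption)
  have : 0 < y 2 ^ 2 * lorentz w w := by rw [key]; positivity
  exact (pos_iff_pos_of_mul_pos this).1 h2

theorem dot_self_pos {w : R3} (h : w ≠ 0) : 0 < w ⬝ᵥ w := by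
  refine lt_of_le_of_ne ?_ (fun h0 => h (dotProduct_self_eq_zero.1 h0.symm))
  rw [dot_apply]; nlinarith [mul_self_nonneg (w 0), mul_self_nonneg (w 1), mul_self_nonneg (w 2)]

theorem form_self_pos {p v : Ambient} (hp : p ∈ S2H2) (hv : v ∈ tangentSub p) (h : v ≠ 0) :
    0 < form v v := by
  have h1 : 0 ≤ v.1 ⬝ᵥ v.1 := by
    by_cases h0 : v.1 = 0
    · simp [h0]
    · exact (dot_self_pos h0).le
  have h2 : 0 ≤ lorentz v.2 v.2 := by
    by_cases h0 : v.2 = 0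
    · simp [h0, lorentz]
    · exact (lorentz_self_pos hp.2.1 hv.2 h0).le
  by_cases h0 : v.1 = 0
  · have : v.2 ≠ 0 := fun h3 => h (Prod.ext h0 h3)
    have := lorentz_self_pos hp.2.1 hv.2 this
    simp only [form]; linarith
  · have := dot_self_pos h0
    simp only [form]; linarith

theorem gram_pos {p : Ambient} (hp : p ∈ S2H2) {A : E2 →L[ℝ] Ambient}
    (hA : ∀ x, A x ∈ tangentSub p) (hinj : Function.Injective A) :
    0 < gram A 0 0 ∧ 0 < gram A 0 0 * gram A 1 1 - gram A 0 1 ^ 2 := by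
  have ne : ∀ x, x ≠ 0 → A x ≠ 0 := fun x hx h => hx (hinj (h.trans (map_zero A).symm))
  have h0 : 0 < gram A 0 0 := form_self_pos hp (hA _) (ne _ (by
    intro h; have := congrArg (fun z : E2 => z 0) h; simp at this))
  refine ⟨h0, ?_⟩
  -- The test vector is the unnormalized second Gram–Schmidt vector; its square length is `gram A 0
  -- 0` times the determinant.
  have h1 := form_self_pos hp (hA (gram A 0 0 • bv 1 - gram A 0 1 • bv 0)) (ne _ (by
    intro h; have := congrArg (fun z : E2 => z 1) h; simp at this; exact h0.ne' this))
  have h2 : form (A (gram A 0 0 • bv 1 - gram A 0 1 • bv 0))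
      (A (gram A 0 0 • bv 1 - gram A 0 1 • bv 0)) =
      gram A 0 0 * (gram A 0 0 * gram A 1 1 - gram A 0 1 ^ 2) := by
    simp only [map_sub, map_smul, form_sub_left, form_sub_right, form_smul_left, form_smul_right,
      gram_apply, form_comm (A (bv 1)) (A (bv 0))]
    ring
  rw [h2] at h1
  exact (pos_iff_pos_of_mul_pos h1).1 h0

theorem gram_comm (A : E2 →L[ℝ] Ambient) : gram A 1 0 = gram A 0 1 := form_comm _ _

theorem gram_det {A : E2 →L[ℝ] Ambient} :
    (gram A).det = gram A 0 0 * gram A 1 1 - gram A 0 1 ^ 2 := by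
  rw [Matrix.det_fin_two, gram_comm]; ring

theorem gram_det_ne_zero {p : Ambient} (hp : p ∈ S2H2) {A : E2 →L[ℝ] Ambient}
    (hA : ∀ x, A x ∈ tangentSub p) (hinj : Function.Injective A) : (gram A).det ≠ 0 := by
  rw [gram_det]; exact (gram_pos hp hA hinj).2.ne'

/-! ### Surface patches -/

/-- The mean curvature vector of a parametrized surface. -/
def patchH (f : E2 → Ambient) (u : E2) : Ambient :=
  (1 / 2 : ℝ) • ∑ i, ∑ j, (gram (fderiv ℝ f u))⁻¹ i j •
    normalPart (f u) (fderiv ℝ f u) (fderiv ℝ (fderiv ℝ f) u (bv i) (bv j))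

/-- Every point of `V` is mapped by `f` to `S² × H²`, and `f` is a smooth immersion there. -/
structure IsPatch (V : Set E2) (f : E2 → Ambient) : Prop where
  isOpen : IsOpen V
  smooth : ContDiffOn ℝ ∞ f V
  mem : ∀ u ∈ V, f u ∈ S2H2
  injective : ∀ u ∈ V, Function.Injective (fderiv ℝ f u)

theorem IsPatch.contDiffAt {V : Set E2} {f : E2 → Ambient} (h : IsPatch V f) {u : E2}
    (hu : u ∈ V) : ContDiffAt ℝ ∞ f u :=
  h.smooth.contDiffAt (h.isOpen.mem_nhds hu)

theorem hasFDerivAt_form {E : Type*} [NormedAddCommGroup E] [NormedSpace ℝ E] {a b : E → Ambient}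
    {u : E} (ha : DifferentiableAt ℝ a u) (hb : DifferentiableAt ℝ b u) :
    DifferentiableAt ℝ (fun z => form (a z) (b z)) u ∧ ∀ X,
    fderiv ℝ (fun z => form (a z) (b z)) u X =
      form (fderiv ℝ a u X) (b u) + form (a u) (fderiv ℝ b u X) := by
  have := formB.hasFDerivAt_of_bilinear ha.hasFDerivAt hb.hasFDerivAt
  refine ⟨this.differentiableAt, fun X => ?_⟩
  have h2 : fderiv ℝ (fun z => form (a z) (b z)) u = _ := this.fderiv
  rw [h2]
  simp [add_comm]

theorem hasFDerivAt_Jsgn {E : Type*} [NormedAddCommGroup E] [NormedSpace ℝ E] (ε : ℝ)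
    {a b : E → Ambient}
    {u : E} (ha : DifferentiableAt ℝ a u) (hb : DifferentiableAt ℝ b u) :
    DifferentiableAt ℝ (fun z => Jsgn ε (a z) (b z)) u ∧ ∀ X,
    fderiv ℝ (fun z => Jsgn ε (a z) (b z)) u X =
      Jsgn ε (fderiv ℝ a u X) (b u) + Jsgn ε (a u) (fderiv ℝ b u X) := by
  have := (JB ε).hasFDerivAt_of_bilinear ha.hasFDerivAt hb.hasFDerivAt
  refine ⟨this.differentiableAt, fun X => ?_⟩
  have h2 : fderiv ℝ (fun z => Jsgn ε (a z) (b z)) u = _ := this.fderiv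
  rw [h2]
  simp [add_comm]

/-- The differential of a map into `S² × H²` takes tangent values. -/
theorem fderiv_mem_tangentSub {E : Type*} [NormedAddCommGroup E] [NormedSpace ℝ E]
    {f : E → Ambient} {u : E} (hf : DifferentiableAt ℝ f u)
    (hmem : ∀ᶠ z in nhds u, f z ∈ S2H2) (X : E) : fderiv ℝ f u X ∈ tangentSub (f u) := by
  have h1 : DifferentiableAt ℝ (fun z => (((f z).1, 0) : Ambient)) u :=
    hf.fst.prodMk (differentiableAt_const _)
  have h2 : DifferentiableAt ℝ (fun z => ((0, (f z).2) : Ambient)) u :=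
    (differentiableAt_const _).prodMk hf.snd
  have d1 : fderiv ℝ (fun z => (((f z).1, 0) : Ambient)) u X = ((fderiv ℝ f u X).1, 0) := by
    have := (hf.hasFDerivAt.fst.prodMk (hasFDerivAt_const (0 : R3) u)).fderiv
    rw [this]; rfl
  have d2 : fderiv ℝ (fun z => ((0, (f z).2) : Ambient)) u X = (0, (fderiv ℝ f u X).2) := by
    have := ((hasFDerivAt_const (0 : R3) u).prodMk hf.hasFDerivAt.snd).fderiv
    rw [this]; rfl
  rw [mem_tangentSub_iff_form]
  constructor
  · have e : (fun z => form ((f z).1, 0) ((f z).1, 0)) =ᶠ[nhds u] fun _ => (1 : ℝ) := by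
      filter_upwards [hmem] with z hz
      rw [form_fst]; exact hz.1
    have := (hasFDerivAt_form h1 h1).2 X
    rw [e.fderiv_eq, d1] at this
    simp only [fderiv_fun_const, Pi.zero_apply, zero_apply] at this
    rw [form_comm ((fderiv ℝ f u X).1, 0)] at this
    have e3 : form ((f u).1, 0) ((fderiv ℝ f u X).1, 0) = form ((f u).1, 0) (fderiv ℝ f u X) := by
      simp [form, lorentz]
    linarith
  · have e : (fun z => form (0, (f z).2) (0, (f z).2)) =ᶠ[nhds u] fun _ => (-1 : ℝ) := by
      filter_upwards [hmem] with z hz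
      rw [form_snd]; exact hz.2.1
    have := (hasFDerivAt_form h2 h2).2 X
    rw [e.fderiv_eq, d2] at this
    simp only [fderiv_fun_const, Pi.zero_apply, zero_apply] at this
    rw [form_comm (0, (fderiv ℝ f u X).2)] at this
    have e3 : form (0, (f u).2) (0, (fderiv ℝ f u X).2) = form (0, (f u).2) (fderiv ℝ f u X) := by
      simp [form]
    linarith

theorem IsPatch.fderiv_mem {V : Set E2} {f : E2 → Ambient} (h : IsPatch V f) {u : E2}
    (hu : u ∈ V) (X : E2) : fderiv ℝ f u X ∈ tangentSub (f u) :=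
  fderiv_mem_tangentSub ((h.contDiffAt hu).differentiableAt (by simp))
    (Filter.mem_of_superset (h.isOpen.mem_nhds hu) h.mem) X

theorem IsPatch.gram_det_ne_zero {V : Set E2} {f : E2 → Ambient} (h : IsPatch V f) {u : E2}
    (hu : u ∈ V) : (gram (fderiv ℝ f u)).det ≠ 0 :=
  SphereHyp.gram_det_ne_zero (h.mem u hu) (h.fderiv_mem hu) (h.injective u hu)

/-! ### Change of parameters -/

theorem fderiv_fderiv_comp {f : E2 → Ambient} {τ : E2 → E2} {u : E2}
    (hτ : ContDiffAt ℝ ∞ τ u) (hf : ContDiffAt ℝ ∞ f (τ u)) (X Y : E2) :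
    fderiv ℝ (fderiv ℝ (f ∘ τ)) u X Y =
      fderiv ℝ (fderiv ℝ f) (τ u) (fderiv ℝ τ u X) (fderiv ℝ τ u Y) +
        fderiv ℝ f (τ u) (fderiv ℝ (fderiv ℝ τ) u X Y) := by
  have h1 : fderiv ℝ (f ∘ τ) =ᶠ[nhds u] fun z => (fderiv ℝ f (τ z)).comp (fderiv ℝ τ z) := by
    filter_upwards [(hτ.of_le (by simp : (1 : WithTop ℕ∞) ≤ ∞)).eventually (by simp),
      hτ.continuousAt.eventually
        ((hf.of_le (by simp : (1 : WithTop ℕ∞) ≤ ∞)).eventually (by simp))] with z hz1 hz2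
    exact fderiv_comp z (hz2.differentiableAt (by simp)) (hz1.differentiableAt (by simp))
  rw [h1.fderiv_eq]
  have hf1 : DifferentiableAt ℝ (fderiv ℝ f) (τ u) :=
    (hf.fderiv_right (m := ∞) (by simp)).differentiableAt (by simp)
  have hτ1 : DifferentiableAt ℝ (fderiv ℝ τ) u :=
    (hτ.fderiv_right (m := ∞) (by simp)).differentiableAt (by simp)
  have hc : HasFDerivAt (fun z => fderiv ℝ f (τ z)) ((fderiv ℝ (fderiv ℝ f) (τ u)).comp
      (fderiv ℝ τ u)) u :=
    hf1.hasFDerivAt.comp u (hτ.differentiableAt (by simp)).hasFDerivAt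
  rw [(hc.clm_comp hτ1.hasFDerivAt).fderiv]
  simp [add_comm]

/-- The second order chain rule adds to the transformed Hessian of `f` only a term in the range of
`fderiv ℝ f`, which the normal projection kills. What remains is a metric trace, invariant by
`sum_gram_inv_comp`. -/
theorem patchH_comp {f : E2 → Ambient} {τ : E2 → E2} {u : E2}
    (hτ : ContDiffAt ℝ ∞ τ u) (hf : ContDiffAt ℝ ∞ f (τ u))
    (hinj : Function.Injective (fderiv ℝ τ u))
    (hA : ∀ x, fderiv ℝ f (τ u) x ∈ tangentSub (f (τ u)))
    (hdet : (gram (fderiv ℝ f (τ u))).det ≠ 0) :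
    patchH (f ∘ τ) u = patchH f (τ u) := by
  have hd : fderiv ℝ (f ∘ τ) u = fderiv ℝ f (τ u) ∘L fderiv ℝ τ u :=
    fderiv_comp u (hf.differentiableAt (by simp)) (hτ.differentiableAt (by simp))
  let B : E2 →ₗ[ℝ] E2 →ₗ[ℝ] Ambient := LinearMap.mk₂ ℝ
    (fun x y => normalPartL (f (τ u)) (fderiv ℝ f (τ u)) (fderiv ℝ (fderiv ℝ f) (τ u) x y))
    (fun a b c => by simp only [map_add, add_apply])
    (fun a b c => by simp only [map_smul, smul_apply])
    (fun a b c => by simp only [map_add])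
    (fun a b c => by simp only [map_smul])
  have key := sum_gram_inv_comp (fderiv ℝ f (τ u)) (fderiv ℝ τ u) hinj B
  simp only [B, LinearMap.mk₂_apply, normalPartL_apply] at key
  rw [patchH, patchH, ← key, hd]
  simp only [normalPart_comp _ _ _ hinj, fderiv_fderiv_comp hτ hf, Function.comp_apply]
  simp only [← normalPartL_apply, map_add]
  simp only [normalPartL_apply, normalPart_map hA hdet, add_zero]

/-! ### Surfaces read in an arbitrary chart -/

section Surface

variable {S : Type*} [TopologicalSpace S] [ChartedSpace E2 S]
  {Φ : S → Ambient} {e : OpenPartialHomeomorph S E2}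

theorem contDiffOn_comp_symm {W : Type*} [NormedAddCommGroup W] [NormedSpace ℝ W] {g : S → W}
    (hg : ContMDiff (𝓡 2) 𝓘(ℝ, W) ∞ g) (he : e ∈ IsManifold.maximalAtlas (𝓡 2) ∞ S) :
    ContDiffOn ℝ ∞ (g ∘ e.symm) e.target := by
  rw [← contMDiffOn_iff_contDiffOn]
  exact hg.comp_contMDiffOn (contMDiffOn_symm_of_mem_maximalAtlas he)

theorem contDiffOn_transition {e e' : OpenPartialHomeomorph S E2}
    (he : e ∈ IsManifold.maximalAtlas (𝓡 2) ∞ S) (he' : e' ∈ IsManifold.maximalAtlas (𝓡 2) ∞ S) :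
    ContDiffOn ℝ ∞ (e ∘ e'.symm) (e'.symm.trans e).source := by
  rw [← contMDiffOn_iff_contDiffOn]
  refine (contMDiffOn_of_mem_maximalAtlas he).comp
    ((contMDiffOn_symm_of_mem_maximalAtlas he').mono ?_) ?_
  · intro x hx; simp at hx; exact hx.1
  · intro x hx; simp at hx; exact hx.2

/-- The change of charts from the preferred chart at `q` to `e`. -/
def transitionAt (e : OpenPartialHomeomorph S E2) (q : S) : E2 → E2 := e ∘ (chartAt E2 q).symm

theorem transitionAt_apply (q : S) : transitionAt e q (chartAt E2 q q) = e q := by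
  simp [transitionAt]

theorem comp_symm_eventuallyEq {W : Type*} (g : S → W) {q : S} (hq : q ∈ e.source) :
    g ∘ (chartAt E2 q).symm =ᶠ[nhds (chartAt E2 q q)] (g ∘ e.symm) ∘ transitionAt e q := by
  filter_upwards [((chartAt E2 q).symm.trans e).open_source.mem_nhds
    (by simp [hq] : chartAt E2 q q ∈ _)] with z hz
  simp only [OpenPartialHomeomorph.trans_source, OpenPartialHomeomorph.symm_source,
    Set.mem_inter_iff, Set.mem_preimage] at hz
  simp [transitionAt, e.left_inv hz.2]

theorem differential_eq_fderiv {g : S → Ambient} {q : S}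
    (hg : MDifferentiableAt (𝓡 2) 𝓘(ℝ, Ambient) g q) :
    differential g q = fderiv ℝ (g ∘ (chartAt E2 q).symm) (chartAt E2 q q) := by
  have h : differential g q = fderivWithin ℝ (writtenInExtChartAt (𝓡 2) 𝓘(ℝ, Ambient) q g)
    (Set.range (𝓡 2)) (extChartAt (𝓡 2) q q) := hg.mfderiv
  rw [h]
  simp only [writtenInExtChartAt, extChartAt, modelWithCornersSelf_coe, Set.range_id,
    fderivWithin_univ]
  rfl

theorem mdifferentiableAt_of_comp_symm (he : e ∈ IsManifold.maximalAtlas (𝓡 2) ∞ S) {q : S}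
    (hq : q ∈ e.source) {g : S → Ambient} (hg : DifferentiableAt ℝ (g ∘ e.symm) (e q)) :
    MDifferentiableAt (𝓡 2) 𝓘(ℝ, Ambient) g q := by
  have h1 : MDifferentiableAt (𝓡 2) 𝓘(ℝ, Ambient) ((g ∘ e.symm) ∘ e) q := by
    refine MDifferentiableAt.comp (I' := 𝓡 2) q
      (mdifferentiableAt_iff_differentiableAt.2 hg) ?_
    exact ((contMDiffAt_of_mem_maximalAtlas he hq)).mdifferentiableAt (by simp)
  refine h1.congr_of_eventuallyEq ?_
  filter_upwards [e.open_source.mem_nhds hq] with z hz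
  simp [e.left_inv hz]

variable [IsManifold (𝓡 2) ∞ S]

theorem contDiffAt_transitionAt (he : e ∈ IsManifold.maximalAtlas (𝓡 2) ∞ S) {q : S}
    (hq : q ∈ e.source) : ContDiffAt ℝ ∞ (transitionAt e q) (chartAt E2 q q) :=
  (contDiffOn_transition he (IsManifold.chart_mem_maximalAtlas q)).contDiffAt
    (((chartAt E2 q).symm.trans e).open_source.mem_nhds (by simp [hq]))

theorem injective_fderiv_transitionAt (he : e ∈ IsManifold.maximalAtlas (𝓡 2) ∞ S) {q : S}
    (hq : q ∈ e.source) :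
    Function.Injective (fderiv ℝ (transitionAt e q) (chartAt E2 q q)) := by
  have h1 : ContDiffAt ℝ ∞ ((chartAt E2 q) ∘ e.symm) (transitionAt e q (chartAt E2 q q)) :=
    (contDiffOn_transition (IsManifold.chart_mem_maximalAtlas q) he).contDiffAt
      ((e.symm.trans (chartAt E2 q)).open_source.mem_nhds (by simp [transitionAt, hq]))
  have h2 : ((chartAt E2 q) ∘ e.symm) ∘ transitionAt e q =ᶠ[nhds (chartAt E2 q q)] id := by
    filter_upwards [((chartAt E2 q).symm.trans e).open_source.mem_nhds
      (by simp [hq] : chartAt E2 q q ∈ _)] with z hz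
    simp only [OpenPartialHomeomorph.trans_source, OpenPartialHomeomorph.symm_source,
      Set.mem_inter_iff, Set.mem_preimage] at hz
    simp [transitionAt, e.left_inv hz.2, (chartAt E2 q).right_inv hz.1]
  have h3 := fderiv_comp (chartAt E2 q q) (h1.differentiableAt (by simp))
    ((contDiffAt_transitionAt he hq).differentiableAt (by simp))
  rw [h2.fderiv_eq, fderiv_id] at h3
  intro x y hxy
  have hx := congrArg (fun A : E2 →L[ℝ] E2 => A x) h3
  have hy := congrArg (fun A : E2 →L[ℝ] E2 => A y) h3
  simp only [ContinuousLinearMap.comp_apply, ContinuousLinearMap.id_apply] at hx hy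
  rw [hx, hy, hxy]

/-- `differential` refers to the preferred chart at `q`, which varies with `q`. To differentiate
along the surface everything is moved to one fixed chart `e`, at the price of the derivative of the
transition map. -/
theorem differential_eq (he : e ∈ IsManifold.maximalAtlas (𝓡 2) ∞ S) {q : S}
    (hq : q ∈ e.source) {g : S → Ambient} (hg : MDifferentiableAt (𝓡 2) 𝓘(ℝ, Ambient) g q) :
    DifferentiableAt ℝ (g ∘ e.symm) (e q) ∧ differential g q =
      fderiv ℝ (g ∘ e.symm) (e q) ∘L fderiv ℝ (transitionAt e q) (chartAt E2 q q) := by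
  have h1 : DifferentiableAt ℝ (g ∘ e.symm) (e q) := by
    rw [← mdifferentiableAt_iff_differentiableAt]
    have hs := ((contMDiffOn_symm_of_mem_maximalAtlas he).contMDiffAt
      (e.open_target.mem_nhds (e.map_source hq))).mdifferentiableAt (by simp)
    refine MDifferentiableAt.comp (I' := 𝓡 2) (e q) ?_ hs
    rwa [e.left_inv hq]
  refine ⟨h1, ?_⟩
  rw [differential_eq_fderiv hg, (comp_symm_eventuallyEq g hq).fderiv_eq, fderiv_comp,
    transitionAt_apply]
  · rwa [transitionAt_apply]
  · exact (contDiffAt_transitionAt he hq).differentiableAt (by simp)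

theorem IsImmersionIntoS2H2.isPatch (hΦ : IsImmersionIntoS2H2 Φ)
    (he : e ∈ IsManifold.maximalAtlas (𝓡 2) ∞ S) : IsPatch e.target (Φ ∘ e.symm) where
  isOpen := e.open_target
  smooth := contDiffOn_comp_symm hΦ.smooth he
  mem u _ := hΦ.mem _
  injective u hu := by
    have hq := e.map_target hu
    have h1 := hΦ.injective (e.symm u)
    rw [(differential_eq he hq (hΦ.smooth.mdifferentiableAt (by simp))).2,
      e.right_inv hu] at h1
    have h2 : Function.Surjective
        (fderiv ℝ (transitionAt e (e.symm u)) (chartAt E2 (e.symm u) (e.symm u))) :=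
      LinearMap.injective_iff_surjective.1 (injective_fderiv_transitionAt he hq)
    intro x y hxy
    obtain ⟨x, rfl⟩ := h2 x
    obtain ⟨y, rfl⟩ := h2 y
    exact congrArg _ (h1 hxy)

/-- At each point H is computed in that point's own chart; independence of parameters makes it,
throughout the source of `e`, the mean curvature of the single patch `Φ ∘ e.symm`, which can then be
differentiated. -/
theorem meanCurvature_eq (hΦ : IsImmersionIntoS2H2 Φ)
    (he : e ∈ IsManifold.maximalAtlas (𝓡 2) ∞ S) {q : S} (hq : q ∈ e.source) :
    meanCurvature Φ q = patchH (Φ ∘ e.symm) (e q) := by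
  have hp := hΦ.isPatch he
  have hu := e.map_source hq
  have h0 : meanCurvature Φ q = patchH (Φ ∘ (chartAt E2 q).symm) (chartAt E2 q q) := by
    have hd := differential_eq_fderiv (hΦ.smooth.mdifferentiableAt (by simp : (∞ : WithTop ℕ∞) ≠ 0)
      (x := q))
    simp only [meanCurvature, patchH, secondFundamentalForm, hd, secondDerivative]
    simp [extChartAt, bv]
  have h1 : patchH (Φ ∘ (chartAt E2 q).symm) (chartAt E2 q q) =
      patchH ((Φ ∘ e.symm) ∘ transitionAt e q) (chartAt E2 q q) := by
    have h2 := comp_symm_eventuallyEq Φ hq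
    simp only [patchH, h2.fderiv_eq, h2.fderiv.fderiv_eq, h2.eq_of_nhds]
  rw [h0, h1, patchH_comp (contDiffAt_transitionAt he hq) _ (injective_fderiv_transitionAt he hq),
    transitionAt_apply]
  all_goals rw [transitionAt_apply]
  · exact hp.fderiv_mem hu
  · exact hp.gram_det_ne_zero hu
  · exact hp.contDiffAt hu

theorem normalDerivative_eq (hΦ : IsImmersionIntoS2H2 Φ)
    (he : e ∈ IsManifold.maximalAtlas (𝓡 2) ∞ S) {q : S} (hq : q ∈ e.source) {ξ : S → Ambient}
    (hξ : MDifferentiableAt (𝓡 2) 𝓘(ℝ, Ambient) ξ q) (X : E2) :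
    normalDerivative Φ ξ q X = normalPart (Φ q) (fderiv ℝ (Φ ∘ e.symm) (e q))
      (fderiv ℝ (ξ ∘ e.symm) (e q) (fderiv ℝ (transitionAt e q) (chartAt E2 q q) X)) := by
  rw [normalDerivative, (differential_eq he hq (hΦ.smooth.mdifferentiableAt (by simp))).2,
    normalPart_comp _ _ _ (injective_fderiv_transitionAt he hq), (differential_eq he hq hξ).2]
  rfl

theorem exists_transition_eq (he : e ∈ IsManifold.maximalAtlas (𝓡 2) ∞ S) {q : S}
    (hq : q ∈ e.source) (X : E2) :
    ∃ Y, fderiv ℝ (transitionAt e q) (chartAt E2 q q) Y = X :=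
  (LinearMap.injective_iff_surjective
    (f := (fderiv ℝ (transitionAt e q) (chartAt E2 q q)).toLinearMap)).1
      (injective_fderiv_transitionAt he hq) X

/-- Nowhere vanishing parallel mean curvature for a parametrized surface. -/
structure IsPMCPatch (V : Set E2) (f : E2 → Ambient) : Prop where
  ne_zero : ∀ u ∈ V, patchH f u ≠ 0
  differentiable : ∀ u ∈ V, DifferentiableAt ℝ (patchH f) u
  parallel : ∀ u ∈ V, ∀ X, normalPart (f u) (fderiv ℝ f u) (fderiv ℝ (patchH f) u X) = 0

theorem meanCurvature_comp_symm (hΦ : IsImmersionIntoS2H2 Φ)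
    (he : e ∈ IsManifold.maximalAtlas (𝓡 2) ∞ S) {u : E2} (hu : u ∈ e.target) :
    (meanCurvature Φ ∘ e.symm) =ᶠ[nhds u] patchH (Φ ∘ e.symm) := by
  filter_upwards [e.open_target.mem_nhds hu] with z hz
  rw [Function.comp_apply, meanCurvature_eq hΦ he (e.map_target hz), e.right_inv hz]

theorem IsPMC.isPMCPatch (hΦ : IsImmersionIntoS2H2 Φ) (h : IsPMC Φ)
    (he : e ∈ IsManifold.maximalAtlas (𝓡 2) ∞ S) : IsPMCPatch e.target (Φ ∘ e.symm) where
  ne_zero u hu := by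
    rw [← (meanCurvature_comp_symm hΦ he hu).eq_of_nhds]; exact h.ne_zero _
  differentiable u hu := by
    rw [← (meanCurvature_comp_symm hΦ he hu).differentiableAt_iff]
    have := (differential_eq he (e.map_target hu) (h.differentiable (e.symm u))).1
    rwa [e.right_inv hu] at this
  parallel u hu X := by
    obtain ⟨Y, rfl⟩ := exists_transition_eq he (e.map_target hu) X
    have := h.parallel (e.symm u) Y
    rw [normalDerivative_eq hΦ he (e.map_target hu) (h.differentiable _), e.right_inv hu,
      (meanCurvature_comp_symm hΦ he hu).fderiv_eq] at this
    exact this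

theorem isPMC_of_isPMCPatch (hΦ : IsImmersionIntoS2H2 Φ)
    (h : ∀ q, ∃ e ∈ IsManifold.maximalAtlas (𝓡 2) ∞ S, q ∈ e.source ∧
      IsPMCPatch e.target (Φ ∘ e.symm)) : IsPMC Φ := by
  have hd : MDifferentiable (𝓡 2) 𝓘(ℝ, Ambient) (meanCurvature Φ) := by
    intro q
    obtain ⟨e, he, hq, hp⟩ := h q
    refine mdifferentiableAt_of_comp_symm he hq ?_
    rw [(meanCurvature_comp_symm hΦ he (e.map_source hq)).differentiableAt_iff]
    exact hp.differentiable _ (e.map_source hq)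
  refine ⟨fun q => ?_, hd, fun q X => ?_⟩
  · obtain ⟨e, he, hq, hp⟩ := h q
    rw [meanCurvature_eq hΦ he hq]
    exact hp.ne_zero _ (e.map_source hq)
  · obtain ⟨e, he, hq, hp⟩ := h q
    rw [normalDerivative_eq hΦ he hq (hd q),
      (meanCurvature_comp_symm hΦ he (e.map_source hq)).fderiv_eq]
    have := hp.parallel (e q) (e.map_source hq)
    rw [Function.comp_apply, e.left_inv hq] at this
    exact this _

/-- The pullback of the Kähler form of `Jsgn ε` by `f`, evaluated on the coordinate fields. -/
def kaehler (ε : ℝ) (f : E2 → Ambient) (u : E2) : ℝ :=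
  form (Jsgn ε (f u) (fderiv ℝ f u (bv 0))) (fderiv ℝ f u (bv 1))

/-- A 2-form on a plane is determined by one coefficient, so the Lagrangian condition becomes the
vanishing of the function `kaehler`. -/
theorem form_Jsgn_fderiv (ε : ℝ) (f : E2 → Ambient) (u X Y : E2) :
    form (Jsgn ε (f u) (fderiv ℝ f u X)) (fderiv ℝ f u Y) =
      (X 0 * Y 1 - X 1 * Y 0) * kaehler ε f u := by
  have h := form_Jsgn_comm ε (f u) (fderiv ℝ f u (bv 1)) (fderiv ℝ f u (bv 0))
  rw [form_comm] at h
  conv_lhs => rw [eq_sum_bv X, eq_sum_bv Y]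
  simp only [map_add, map_smul, Jsgn_add, Jsgn_smul, form_add_left, form_add_right, form_smul_left,
    form_smul_right, form_Jsgn_self, kaehler]
  rw [form_comm (Jsgn ε (f u) (fderiv ℝ f u (bv 1))), h, form_comm (fderiv ℝ f u (bv 1))]
  ring

theorem form_Jsgn_differential (hΦ : IsImmersionIntoS2H2 Φ)
    (he : e ∈ IsManifold.maximalAtlas (𝓡 2) ∞ S) {q : S} (hq : q ∈ e.source) (ε : ℝ) (X Y : E2) :
    form (Jsgn ε (Φ q) (differential Φ q X)) (differential Φ q Y) =
      form (Jsgn ε ((Φ ∘ e.symm) (e q)) (fderiv ℝ (Φ ∘ e.symm) (e q)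
        (fderiv ℝ (transitionAt e q) (chartAt E2 q q) X))) (fderiv ℝ (Φ ∘ e.symm) (e q)
        (fderiv ℝ (transitionAt e q) (chartAt E2 q q) Y)) := by
  rw [(differential_eq he hq (hΦ.smooth.mdifferentiableAt (by simp))).2, Function.comp_apply,
    e.left_inv hq]
  rfl

theorem IsLagrangian.kaehler_eq_zero (hΦ : IsImmersionIntoS2H2 Φ) {ε : ℝ}
    (h : IsLagrangian (Jsgn ε) Φ) (he : e ∈ IsManifold.maximalAtlas (𝓡 2) ∞ S) {u : E2}
    (hu : u ∈ e.target) : kaehler ε (Φ ∘ e.symm) u = 0 := by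
  have hq := e.map_target hu
  obtain ⟨X, hX⟩ := exists_transition_eq he hq (bv 0)
  obtain ⟨Y, hY⟩ := exists_transition_eq he hq (bv 1)
  have := form_Jsgn_differential hΦ he hq ε X Y
  rw [h, hX, hY, e.right_inv hu] at this
  exact this.symm

theorem isLagrangian_of_kaehler_eq_zero (hΦ : IsImmersionIntoS2H2 Φ) {ε : ℝ}
    (h : ∀ q, ∃ e ∈ IsManifold.maximalAtlas (𝓡 2) ∞ S, q ∈ e.source ∧
      kaehler ε (Φ ∘ e.symm) (e q) = 0) : IsLagrangian (Jsgn ε) Φ := by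
  intro q X Y
  obtain ⟨e, he, hq, hp⟩ := h q
  rw [form_Jsgn_differential hΦ he hq, form_Jsgn_fderiv, hp, mul_zero]

end Surface

/-! ### The Ricci form of a Lagrangian surface -/

/-- Here `Jsgn ε u v` appears as the derivative of `Jsgn ε` in the direction `u`. It is normal to
the product, so only the normal components of `a` matter. The opposite signs of the two terms
reflect the opposite curvatures of the factors. -/
theorem form_triple {ε : ℝ} {p a u v : Ambient} (hp : p ∈ S2H2) (hu : u ∈ tangentSub p)
    (hv : v ∈ tangentSub p) :
    form a (Jsgn ε u v) = -(form (p.1, 0) a * form (u.1, 0) (Jsgn ε p v)) +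
      form (0, p.2) a * form (0, u.2) (Jsgn ε p v) := by
  have h1 := cross_tangent hp.1 hu.1 hv.1 a.1
  have h2 := lorentz_cross_tangent hp.2.1 hu.2 hv.2 a.2
  have h3 : ∀ c d : R3, lorentz c (ε • d) = ε * lorentz c d := fun c d => by
    simp only [lorentz, Pi.smul_apply, smul_eq_mul]; ring
  have h4 : ∀ c : R3, lorentz 0 c = 0 := fun c => by simp [lorentz]
  simp only [form, Jsgn, h3, h1, h2, h4, zero_dotProduct]
  ring

/-- The tangential part of the derivative of J vanishes: J is parallel for the Levi-Civita
connection, that is, the ambient space is Kähler. -/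
theorem form_triple_eq_zero {ε : ℝ} {p a u v : Ambient} (hp : p ∈ S2H2) (ha : a ∈ tangentSub p)
    (hu : u ∈ tangentSub p) (hv : v ∈ tangentSub p) : form a (Jsgn ε u v) = 0 := by
  obtain ⟨h1, h2⟩ := mem_tangentSub_iff_form.1 ha
  rw [form_triple hp hu hv, h1, h2]; ring

/-- The first order conditions on the derivatives `a`, `b` of a unitary frame `e₁`, `e₂` along a
path in `S² × H²` with velocity `F`. -/
structure IsFrameVelocity (ε : ℝ) (p e₁ e₂ F a b : Ambient) : Prop where
  form_fst : form a e₁ = 0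
  form_snd : form b e₂ = 0
  form_fst_snd : form a e₂ + form b e₁ = 0
  form_J : form a (Jsgn ε p e₂) = form b (Jsgn ε p e₁)
  normal₁ : form (p.1, 0) a = -form (F.1, 0) e₁
  normal₂ : form (0, p.2) a = -form (0, F.2) e₁
  normal₃ : form (p.1, 0) b = -form (F.1, 0) e₂
  normal₄ : form (0, p.2) b = -form (0, F.2) e₂

/-- The Ricci identity in algebraic form. The vectors `aᵢ` and `bᵢ` stand for the derivatives of
`eᵢ` along `F` and `G`, and the left side is the curl of the connection form without its second
derivatives. The tangential components of the derivatives form two skew-Hermitian matrices, whose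
commutator has trace zero. The normal components are prescribed by the velocities and yield the
curvature of the product, with opposite signs on the two factors; hence `-ε` on the right. -/
theorem frame_curvature {ε : ℝ} (hε : ε * ε = 1) {p e₁ e₂ F G a₁ a₂ b₁ b₂ : Ambient}
    (hp : p ∈ S2H2) (he : IsUnitaryFrame ε p e₁ e₂) (hF : F ∈ tangentSub p)
    (hG : G ∈ tangentSub p) (ha : IsFrameVelocity ε p e₁ e₂ F a₁ a₂)
    (hb : IsFrameVelocity ε p e₁ e₂ G b₁ b₂) :
    (form a₁ (Jsgn ε G e₁ + Jsgn ε p b₁) + form a₂ (Jsgn ε G e₂ + Jsgn ε p b₂)) -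
      (form b₁ (Jsgn ε F e₁ + Jsgn ε p a₁) + form b₂ (Jsgn ε F e₂ + Jsgn ε p a₂)) =
    form (Jsgn (-ε) p F) G := by
  -- `Jsgn ε p v` is tangent for every `v`, so Parseval applies even when `v` and `w` are
  -- derivatives with normal components.
  have key : ∀ v w : Ambient, form (Jsgn ε p v) w =
      -(form v (Jsgn ε p e₁) * form w e₁) - form v (Jsgn ε p e₂) * form w e₂ +
      form v e₁ * form w (Jsgn ε p e₁) + form v e₂ * form w (Jsgn ε p e₂) := by
    intro v w
    have q₁ : form (Jsgn ε p v) (Jsgn ε p e₁) = form v e₁ := by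
      rw [form_comm, form_Jsgn_Jsgn hε hp he.mem_fst, form_comm]
    have q₂ : form (Jsgn ε p v) (Jsgn ε p e₂) = form v e₂ := by
      rw [form_comm, form_Jsgn_Jsgn hε hp he.mem_snd, form_comm]
    rw [he.parseval hε hp (Jsgn_mem ε p v) w, form_Jsgn_comm ε p v e₁, form_Jsgn_comm ε p v e₂,
      q₁, q₂]
    ring
  -- Reversing `ε` changes the sign of the H²-part of the Kähler form, so the right side is a
  -- difference of two terms to which `key` applies.
  have hS : ∀ v w : Ambient, form (Jsgn (-ε) p v) w =
      form (Jsgn ε p (v.1, 0)) (w.1, 0) - form (Jsgn ε p (0, v.2)) (0, w.2) := by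
    intro v w
    simp only [form_apply, Jsgn, JS_zero, JS_one, JS_two, JH_zero, JH_one, JH_two, Pi.smul_apply,
      smul_eq_mul, Pi.zero_apply]
    ring
  rw [hS, key, key]
  simp only [form_add_right, form_triple hp hG he.mem_fst, form_triple hp hG he.mem_snd,
    form_triple hp hF he.mem_fst, form_triple hp hF he.mem_snd, ha.normal₁, ha.normal₂, ha.normal₃,
    ha.normal₄, hb.normal₁, hb.normal₂, hb.normal₃, hb.normal₄, form_comm _ (Jsgn ε p b₁),
    form_comm _ (Jsgn ε p b₂), form_comm _ (Jsgn ε p a₁), form_comm _ (Jsgn ε p a₂), key,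
    ha.form_fst, ha.form_snd, hb.form_fst, hb.form_snd, ha.form_J, hb.form_J]
  -- The normal terms already match; the rest is the trace of the commutator, which vanishes by
  -- skew-symmetry of the real part.
  have h1 := ha.form_fst_snd
  have h2 := hb.form_fst_snd
  linear_combination 2 * form a₂ (Jsgn ε p e₁) * h2 - 2 * form b₂ (Jsgn ε p e₁) * h1

theorem fderiv_fderiv_apply {E W : Type*} [NormedAddCommGroup E] [NormedSpace ℝ E]
    [NormedAddCommGroup W] [NormedSpace ℝ W] {e : E → W}
    {u : E} (he : ContDiffAt ℝ ∞ e u) (X : E) :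
    DifferentiableAt ℝ (fun z => fderiv ℝ e z X) u ∧
    ∀ Y, fderiv ℝ (fun z => fderiv ℝ e z X) u Y = fderiv ℝ (fderiv ℝ e) u Y X := by
  have h1 : DifferentiableAt ℝ (fderiv ℝ e) u :=
    (he.fderiv_right (m := ∞) (by simp)).differentiableAt (by simp)
  have h2 := h1.hasFDerivAt.clm_apply (hasFDerivAt_const X u)
  exact ⟨h2.differentiableAt, fun Y => by rw [h2.fderiv]; simp⟩

theorem two_le_infty : (2 : WithTop ℕ∞) ≤ ∞ :=
  WithTop.coe_le_coe.2 (le_top : (2 : ℕ∞) ≤ ⊤)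

theorem fderiv_fderiv_symm {W : Type*} [NormedAddCommGroup W] [NormedSpace ℝ W] {e : E2 → W}
    {u : E2} (he : ContDiffAt ℝ ∞ e u) (X Y : E2) :
    fderiv ℝ (fderiv ℝ e) u X Y = fderiv ℝ (fderiv ℝ e) u Y X :=
  (he.isSymmSndFDerivAt (by simpa using two_le_infty)).eq X Y

theorem fderiv_form_Jsgn {f e : E2 → Ambient} {u : E2} (hf : ContDiffAt ℝ ∞ f u)
    (he : ContDiffAt ℝ ∞ e u) (ε : ℝ) (X Y : E2) :
    DifferentiableAt ℝ (fun z => form (fderiv ℝ e z X) (Jsgn ε (f z) (e z))) u ∧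
    fderiv ℝ (fun z => form (fderiv ℝ e z X) (Jsgn ε (f z) (e z))) u Y =
      form (fderiv ℝ (fderiv ℝ e) u Y X) (Jsgn ε (f u) (e u)) +
      form (fderiv ℝ e u X) (Jsgn ε (fderiv ℝ f u Y) (e u) + Jsgn ε (f u) (fderiv ℝ e u Y)) := by
  have h1 := fderiv_fderiv_apply he X
  have h2 := hasFDerivAt_Jsgn ε (hf.differentiableAt (by simp)) (he.differentiableAt (by simp))
  have h3 := hasFDerivAt_form h1.1 h2.1
  exact ⟨h3.1, by rw [h3.2, h1.2, h2.2]⟩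

theorem fderiv_form_eq_zero {E : Type*} [NormedAddCommGroup E] [NormedSpace ℝ E]
    {a b : E → Ambient} {u : E} {c : ℝ} (ha : DifferentiableAt ℝ a u)
    (hb : DifferentiableAt ℝ b u) (h : ∀ᶠ z in nhds u, form (a z) (b z) = c) (X : E) :
    form (fderiv ℝ a u X) (b u) + form (a u) (fderiv ℝ b u X) = 0 := by
  rw [← (hasFDerivAt_form ha hb).2]
  have : (fun z => form (a z) (b z)) =ᶠ[nhds u] fun _ => c := h
  rw [this.fderiv_eq]
  simp

/-- Differentiating the orthogonality of a tangent field to the two radial vectors gives the normal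
part of its derivative: the second fundamental form of the product inside `ℝ³ × ℝ³₁`. -/
theorem fderiv_normal {E : Type*} [NormedAddCommGroup E] [NormedSpace ℝ E]
    {f e : E → Ambient} {u : E} (hf : DifferentiableAt ℝ f u) (he : DifferentiableAt ℝ e u)
    (h : ∀ᶠ z in nhds u, e z ∈ tangentSub (f z)) (X : E) :
    form ((f u).1, 0) (fderiv ℝ e u X) = -form ((fderiv ℝ f u X).1, 0) (e u) ∧
    form (0, (f u).2) (fderiv ℝ e u X) = -form (0, (fderiv ℝ f u X).2) (e u) := by
  have h1 := hf.hasFDerivAt.fst.prodMk (hasFDerivAt_const (0 : R3) u)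
  have h2 := (hasFDerivAt_const (0 : R3) u).prodMk hf.hasFDerivAt.snd
  constructor
  · have := fderiv_form_eq_zero h1.differentiableAt he
      (h.mono fun z hz => (mem_tangentSub_iff_form.1 hz).1) X
    rw [h1.fderiv] at this
    exact eq_neg_of_add_eq_zero_right this
  · have := fderiv_form_eq_zero h2.differentiableAt he
      (h.mono fun z hz => (mem_tangentSub_iff_form.1 hz).2) X
    rw [h2.fderiv] at this
    exact eq_neg_of_add_eq_zero_right this

theorem isFrameVelocity_fderiv {ε : ℝ} {f e₁ e₂ : E2 → Ambient} {u : E2}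
    (hf : DifferentiableAt ℝ f u)
    (h₁ : DifferentiableAt ℝ e₁ u) (h₂ : DifferentiableAt ℝ e₂ u)
    (hmem : ∀ᶠ z in nhds u, f z ∈ S2H2)
    (hfr : ∀ᶠ z in nhds u, IsUnitaryFrame ε (f z) (e₁ z) (e₂ z)) (X : E2) :
    IsFrameVelocity ε (f u) (e₁ u) (e₂ u) (fderiv ℝ f u X) (fderiv ℝ e₁ u X)
      (fderiv ℝ e₂ u X) where
  form_fst := by
    have := fderiv_form_eq_zero h₁ h₁ (hfr.mono fun z hz => hz.form_fst) X
    rw [form_comm (e₁ u)] at this; linarith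
  form_snd := by
    have := fderiv_form_eq_zero h₂ h₂ (hfr.mono fun z hz => hz.form_snd) X
    rw [form_comm (e₂ u)] at this; linarith
  form_fst_snd := by
    have := fderiv_form_eq_zero h₁ h₂ (hfr.mono fun z hz => hz.form_fst_snd) X
    rw [form_comm (e₁ u)] at this; linarith
  form_J := by
    have hJ := hasFDerivAt_Jsgn ε hf h₁
    have := fderiv_form_eq_zero hJ.1 h₂ (hfr.mono fun z hz => hz.form_J) X
    have hu := hfr.self_of_nhds
    rw [hJ.2, form_add_left, form_comm _ (e₂ u), form_triple_eq_zero hmem.self_of_nhds hu.mem_snd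
      (fderiv_mem_tangentSub hf hmem X) hu.mem_fst, form_Jsgn_comm ε (f u) (fderiv ℝ e₁ u X),
      form_comm (Jsgn ε (f u) (e₁ u))] at this
    linarith
  normal₁ := (fderiv_normal hf h₁ (hfr.mono fun z hz => hz.mem_fst) X).1
  normal₂ := (fderiv_normal hf h₁ (hfr.mono fun z hz => hz.mem_fst) X).2
  normal₃ := (fderiv_normal hf h₂ (hfr.mono fun z hz => hz.mem_snd) X).1
  normal₄ := (fderiv_normal hf h₂ (hfr.mono fun z hz => hz.mem_snd) X).2

/-- The connection form of the canonical bundle in the unitary frame `e₁`, `e₂`. -/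
def connectionForm (ε : ℝ) (f e₁ e₂ : E2 → Ambient) (X z : E2) : ℝ :=
  form (fderiv ℝ e₁ z X) (Jsgn ε (f z) (e₁ z)) + form (fderiv ℝ e₂ z X) (Jsgn ε (f z) (e₂ z))

/-- The second derivatives of the frame cancel by symmetry, and the products of first derivatives
are evaluated by `frame_curvature`. -/
theorem connectionForm_curl {ε : ℝ} (hε : ε * ε = 1) {f e₁ e₂ : E2 → Ambient} {u : E2}
    (hf : ContDiffAt ℝ ∞ f u) (h₁ : ContDiffAt ℝ ∞ e₁ u) (h₂ : ContDiffAt ℝ ∞ e₂ u)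
    (hmem : ∀ᶠ z in nhds u, f z ∈ S2H2)
    (hfr : ∀ᶠ z in nhds u, IsUnitaryFrame ε (f z) (e₁ z) (e₂ z)) :
    fderiv ℝ (connectionForm ε f e₁ e₂ (bv 0)) u (bv 1) -
      fderiv ℝ (connectionForm ε f e₁ e₂ (bv 1)) u (bv 0) = kaehler (-ε) f u := by
  have df := hf.differentiableAt (n := ∞) (by simp)
  have d₁ := h₁.differentiableAt (n := ∞) (by simp)
  have d₂ := h₂.differentiableAt (n := ∞) (by simp)
  have hsum : ∀ X Y, fderiv ℝ (connectionForm ε f e₁ e₂ X) u Y =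
      (form (fderiv ℝ (fderiv ℝ e₁) u Y X) (Jsgn ε (f u) (e₁ u)) +
      form (fderiv ℝ e₁ u X) (Jsgn ε (fderiv ℝ f u Y) (e₁ u) + Jsgn ε (f u) (fderiv ℝ e₁ u Y))) +
      (form (fderiv ℝ (fderiv ℝ e₂) u Y X) (Jsgn ε (f u) (e₂ u)) +
      form (fderiv ℝ e₂ u X)
        (Jsgn ε (fderiv ℝ f u Y) (e₂ u) + Jsgn ε (f u) (fderiv ℝ e₂ u Y))) := by
    intro X Y
    have k₁ := fderiv_form_Jsgn hf h₁ ε X Y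
    have k₂ := fderiv_form_Jsgn hf h₂ ε X Y
    rw [← k₁.2, ← k₂.2]
    exact congrArg (fun A : E2 →L[ℝ] ℝ => A Y) (fderiv_fun_add k₁.1 k₂.1)
  have key := frame_curvature hε hmem.self_of_nhds hfr.self_of_nhds
    (fderiv_mem_tangentSub df hmem (bv 0)) (fderiv_mem_tangentSub df hmem (bv 1))
    (isFrameVelocity_fderiv df d₁ d₂ hmem hfr (bv 0))
    (isFrameVelocity_fderiv df d₁ d₂ hmem hfr (bv 1))
  rw [hsum, hsum, kaehler, ← key, fderiv_fderiv_symm h₁ (bv 1), fderiv_fderiv_symm h₂ (bv 1)]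
  ring

/-! ### Lagrangian patches -/

/-- The cubic form `⟨h(∂ₖ, ∂ᵢ), J ∂ⱼ⟩` of a surface. -/
def cubic (ε : ℝ) (f : E2 → Ambient) (u : E2) (k i j : Fin 2) : ℝ :=
  form (fderiv ℝ (fderiv ℝ f) u (bv k) (bv i)) (Jsgn ε (f u) (fderiv ℝ f u (bv j)))

section Lagrangian

variable {ε : ℝ} {V : Set E2} {f : E2 → Ambient}

theorem form_Jsgn_fderiv_eq_zero (hL : ∀ u ∈ V, kaehler ε f u = 0) {u : E2} (hu : u ∈ V)
    (X Y : E2) : form (fderiv ℝ f u X) (Jsgn ε (f u) (fderiv ℝ f u Y)) = 0 := by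
  rw [form_comm, form_Jsgn_fderiv, hL u hu, mul_zero]

theorem cubic_comm₁₂ (hp : IsPatch V f) {u : E2} (hu : u ∈ V) (k i j : Fin 2) :
    cubic ε f u k i j = cubic ε f u i k j := by
  rw [cubic, cubic, fderiv_fderiv_symm (hp.contDiffAt hu)]

/-- Differentiate ⟨∂ᵢ, J ∂ⱼ⟩ = 0 along ∂ₖ and use that J is parallel and skew. With the symmetry of
second derivatives this makes the cubic form totally symmetric. -/
theorem cubic_comm₂₃ (hp : IsPatch V f) (hL : ∀ u ∈ V, kaehler ε f u = 0) {u : E2} (hu : u ∈ V)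
    (k i j : Fin 2) : cubic ε f u k i j = cubic ε f u k j i := by
  have hf := hp.contDiffAt hu
  have hi := fderiv_fderiv_apply hf (bv i)
  have hj := fderiv_fderiv_apply hf (bv j)
  have hJ := hasFDerivAt_Jsgn ε (hf.differentiableAt (by simp)) hj.1
  have := fderiv_form_eq_zero (c := 0) hi.1 hJ.1 (Filter.mem_of_superset (hp.isOpen.mem_nhds hu)
    fun z hz => form_Jsgn_fderiv_eq_zero hL hz _ _) (bv k)
  rw [hi.2, hJ.2, hj.2, form_add_right, form_triple_eq_zero (hp.mem u hu) (hp.fderiv_mem hu _)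
    (hp.fderiv_mem hu _) (hp.fderiv_mem hu _), form_comm (fderiv ℝ f u (bv i)),
    form_Jsgn_comm] at this
  rw [cubic, cubic]
  linarith

theorem patchH_mem (hp : IsPatch V f) {u : E2} (hu : u ∈ V) : patchH f u ∈ tangentSub (f u) :=
  Submodule.smul_mem _ _ <| Submodule.sum_mem _ fun _ _ => Submodule.sum_mem _ fun _ _ =>
    Submodule.smul_mem _ _ <| normalPart_mem (hp.mem u hu) (hp.fderiv_mem hu) _

theorem form_patchH {u : E2} {w : Ambient} (hw : w ∈ tangentSub (f u))
    (hA : ∀ i, form (fderiv ℝ f u (bv i)) w = 0) :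
    form (patchH f u) w = (1 / 2) * ∑ i, ∑ j, (gram (fderiv ℝ f u))⁻¹ i j *
      form (fderiv ℝ (fderiv ℝ f) u (bv i) (bv j)) w := by
  simp only [patchH, form_smul_left, form_sum_left, form_normalPart hw hA]

/-- Since J ∂ₖ is normal to a Lagrangian surface and H is parallel, the derivative of H contributes
nothing; neither does that of J. The outcome is symmetric in `k` and `l`, so the 1-form ⟨H, J ·⟩ is
closed. -/
theorem fderiv_form_patchH (hp : IsPatch V f) (hL : ∀ u ∈ V, kaehler ε f u = 0)
    (hH : IsPMCPatch V f) {u : E2} (hu : u ∈ V) (k l : Fin 2) :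
    fderiv ℝ (fun z => form (patchH f z) (Jsgn ε (f z) (fderiv ℝ f z (bv k)))) u (bv l) =
      form (patchH f u) (Jsgn ε (f u) (fderiv ℝ (fderiv ℝ f) u (bv l) (bv k))) := by
  have hf := hp.contDiffAt hu
  have hk := fderiv_fderiv_apply hf (bv k)
  have hJ := hasFDerivAt_Jsgn ε (hf.differentiableAt (by simp)) hk.1
  rw [(hasFDerivAt_form (hH.differentiable u hu) hJ.1).2, hJ.2, hk.2, form_add_right,
    form_triple_eq_zero (hp.mem u hu) (patchH_mem hp hu) (hp.fderiv_mem hu _)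
    (hp.fderiv_mem hu _), ← form_normalPart (Jsgn_mem ..) (fun i =>
      form_Jsgn_fderiv_eq_zero hL hu _ _), hH.parallel u hu, form_zero_left]
  ring

/-- Derivatives of the coefficients produce tangent vectors, which are orthogonal to J of the
tangent plane. So the connection form is algebraic in the cubic form. -/
theorem form_fderiv_frame {u : E2} {a b : E2 → ℝ} (hp : IsPatch V f)
    (hL : ∀ u ∈ V, kaehler ε f u = 0) (hu : u ∈ V)
    (ha : DifferentiableAt ℝ a u) (hb : DifferentiableAt ℝ b u) (k : Fin 2) :
    form (fderiv ℝ (fun z => a z • fderiv ℝ f z (bv 0) + b z • fderiv ℝ f z (bv 1)) u (bv k))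
      (Jsgn ε (f u) (a u • fderiv ℝ f u (bv 0) + b u • fderiv ℝ f u (bv 1))) =
    a u ^ 2 * cubic ε f u k 0 0 + 2 * (a u * b u) * cubic ε f u k 0 1 +
      b u ^ 2 * cubic ε f u k 1 1 := by
  have hf := hp.contDiffAt hu
  have h0 := fderiv_fderiv_apply hf (bv 0)
  have h1 := fderiv_fderiv_apply hf (bv 1)
  have hd : fderiv ℝ (fun z => a z • fderiv ℝ f z (bv 0) + b z • fderiv ℝ f z (bv 1)) u (bv k) =
      (a u • fderiv ℝ (fderiv ℝ f) u (bv k) (bv 0) +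
        fderiv ℝ a u (bv k) • fderiv ℝ f u (bv 0)) +
      (b u • fderiv ℝ (fderiv ℝ f) u (bv k) (bv 1) +
        fderiv ℝ b u (bv k) • fderiv ℝ f u (bv 1)) := by
    rw [((ha.hasFDerivAt.fun_smul h0.1.hasFDerivAt).fun_add
      (hb.hasFDerivAt.fun_smul h1.1.hasFDerivAt)).fderiv]
    simp [h0.2, h1.2]
  have hc := cubic_comm₂₃ hp hL hu k 1 0
  simp only [hd, Jsgn_add, Jsgn_smul, form_add_left, form_add_right, form_smul_left,
    form_smul_right, form_Jsgn_fderiv_eq_zero hL hu]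
  simp only [cubic] at hc ⊢
  linear_combination a u * b u * hc

end Lagrangian

theorem IsPatch.contDiffAt_gram {V : Set E2} {f : E2 → Ambient} (hp : IsPatch V f) {u : E2}
    (hu : u ∈ V) (i j : Fin 2) : ContDiffAt ℝ ∞ (fun z => gram (fderiv ℝ f z) i j) u := by
  have h : ∀ i, ContDiffAt ℝ ∞ (fun z => fderiv ℝ f z (bv i)) u := fun i =>
    ((hp.contDiffAt hu).fderiv_right (m := ∞) (by simp)).clm_apply contDiffAt_const
  have h2 : ContDiffAt ℝ ∞ (fun z => formB (fderiv ℝ f z (bv i)) (fderiv ℝ f z (bv j))) u :=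
    (formB.contDiff.contDiffAt.comp u (h i)).clm_apply (h j)
  exact h2

/-- A Lagrangian surface with parallel mean curvature vector for one of the two complex structures
is Lagrangian for the other one. -/
theorem kaehler_neg_eq_zero {ε : ℝ} (hε : ε * ε = 1) {V : Set E2} {f : E2 → Ambient}
    (hp : IsPatch V f) (hL : ∀ u ∈ V, kaehler ε f u = 0) (hH : IsPMCPatch V f) {u : E2}
    (hu : u ∈ V) : kaehler (-ε) f u = 0 := by
  let g : E2 → Matrix (Fin 2) (Fin 2) ℝ := fun z => gram (fderiv ℝ f z)
  let Δ : E2 → ℝ := fun z => g z 0 0 * g z 1 1 - g z 0 1 ^ 2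
  have hg := fun z (hz : z ∈ V) => gram_pos (hp.mem z hz) (hp.fderiv_mem hz) (hp.injective z hz)
  -- Gram–Schmidt coefficients: e₁ = ∂₀ / √g₀₀ and e₂ = (g₀₀ ∂₁ - g₀₁ ∂₀) / √(g₀₀ Δ). The explicit
  -- coefficient 0 in `e₁` gives both vectors the shape required by `form_fderiv_frame`.
  let a₁ : E2 → ℝ := fun z => (√(g z 0 0))⁻¹
  let a₂ : E2 → ℝ := fun z => -g z 0 1 * (√(g z 0 0 * Δ z))⁻¹
  let b₂ : E2 → ℝ := fun z => g z 0 0 * (√(g z 0 0 * Δ z))⁻¹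
  have hgs : ∀ z ∈ V, ∀ i j, ContDiffAt ℝ ∞ (fun z => g z i j) z := fun z hz i j =>
    hp.contDiffAt_gram hz i j
  have hΔs : ∀ z ∈ V, ContDiffAt ℝ ∞ Δ z := fun z hz =>
    ((hgs z hz 0 0).mul (hgs z hz 1 1)).sub ((hgs z hz 0 1).pow 2)
  have hpos : ∀ z ∈ V, 0 < g z 0 0 ∧ 0 < g z 0 0 * Δ z := fun z hz =>
    ⟨(hg z hz).1, mul_pos (hg z hz).1 (hg z hz).2⟩
  have hsq : ∀ z ∈ V, ContDiffAt ℝ ∞ (fun z => (√(g z 0 0 * Δ z))⁻¹) z := fun z hz =>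
    (((hgs z hz 0 0).mul (hΔs z hz)).sqrt (hpos z hz).2.ne').inv
      (Real.sqrt_pos.2 (hpos z hz).2).ne'
  have ha₁ : ∀ z ∈ V, ContDiffAt ℝ ∞ a₁ z := fun z hz =>
    ((hgs z hz 0 0).sqrt (hpos z hz).1.ne').inv (Real.sqrt_pos.2 (hpos z hz).1).ne'
  have ha₂ : ∀ z ∈ V, ContDiffAt ℝ ∞ a₂ z := fun z hz => (hgs z hz 0 1).neg.mul (hsq z hz)
  have hb₂ : ∀ z ∈ V, ContDiffAt ℝ ∞ b₂ z := fun z hz => (hgs z hz 0 0).mul (hsq z hz)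
  have sa₁ : ∀ z ∈ V, a₁ z ^ 2 * g z 0 0 = 1 := fun z hz => by
    simp only [a₁, inv_pow, Real.sq_sqrt (hpos z hz).1.le]
    exact inv_mul_cancel₀ (hpos z hz).1.ne'
  have ss : ∀ z ∈ V, (√(g z 0 0 * Δ z))⁻¹ ^ 2 * (g z 0 0 * Δ z) = 1 := fun z hz => by
    simp only [inv_pow, Real.sq_sqrt (hpos z hz).2.le]
    exact inv_mul_cancel₀ (hpos z hz).2.ne'
  let e₁ : E2 → Ambient := fun z => a₁ z • fderiv ℝ f z (bv 0) + (0 : ℝ) • fderiv ℝ f z (bv 1)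
  let e₂ : E2 → Ambient := fun z => a₂ z • fderiv ℝ f z (bv 0) + b₂ z • fderiv ℝ f z (bv 1)
  have hfr : ∀ z ∈ V, IsUnitaryFrame ε (f z) (e₁ z) (e₂ z) := fun z hz =>
    { mem_fst := Submodule.add_mem _ (Submodule.smul_mem _ _ (hp.fderiv_mem hz _))
        (Submodule.smul_mem _ _ (hp.fderiv_mem hz _))
      mem_snd := Submodule.add_mem _ (Submodule.smul_mem _ _ (hp.fderiv_mem hz _))
        (Submodule.smul_mem _ _ (hp.fderiv_mem hz _))
      form_fst := by
        simp only [e₁, form_add_left, form_add_right, form_smul_left, form_smul_right, ← gram_apply]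
        linear_combination sa₁ z hz
      form_snd := by
        simp only [e₂, form_add_left, form_add_right, form_smul_left, form_smul_right,
          ← gram_apply, gram_comm]
        simp only [a₂, b₂]
        linear_combination ss z hz
      form_fst_snd := by
        simp only [e₁, e₂, form_add_left, form_add_right, form_smul_left, form_smul_right,
          ← gram_apply, gram_comm]
        simp only [a₂, b₂, g]
        ring
      form_J := by
        simp only [e₁, e₂, form_add_left, form_add_right, form_smul_left, form_smul_right,
          Jsgn_add, Jsgn_smul, form_comm (Jsgn _ _ _), form_Jsgn_fderiv_eq_zero hL hz]
        ring }
  have hfd : ∀ i, ContDiffAt ℝ ∞ (fun z => fderiv ℝ f z (bv i)) u := fun i =>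
    ((hp.contDiffAt hu).fderiv_right (m := ∞) (by simp)).clm_apply contDiffAt_const
  have he₁ : ContDiffAt ℝ ∞ e₁ u :=
    ((ha₁ u hu).smul (hfd 0)).add (contDiffAt_const (c := (0 : ℝ)) |>.smul (hfd 1))
  have he₂ : ContDiffAt ℝ ∞ e₂ u := ((ha₂ u hu).smul (hfd 0)).add ((hb₂ u hu).smul (hfd 1))
  have hV : ∀ᶠ z in nhds u, z ∈ V := hp.isOpen.mem_nhds hu
  -- By total symmetry ∑ ⟨h(∂ₖ, eᵢ), J eᵢ⟩ = ∑ ⟨h(eᵢ, eᵢ), J ∂ₖ⟩ = 2⟨H, J ∂ₖ⟩.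
  have hβ : ∀ k, connectionForm ε f e₁ e₂ (bv k) =ᶠ[nhds u]
      fun z => 2 * form (patchH f z) (Jsgn ε (f z) (fderiv ℝ f z (bv k))) := by
    intro k
    filter_upwards [hV] with z hz
    have k₁ := form_fderiv_frame hp hL hz ((ha₁ z hz).differentiableAt (by simp))
      (differentiableAt_const 0) k
    have k₂ := form_fderiv_frame hp hL hz ((ha₂ z hz).differentiableAt (by simp))
      ((hb₂ z hz).differentiableAt (by simp)) k
    have k₃ := form_patchH (f := f) (Jsgn_mem ε (f z) (fderiv ℝ f z (bv k)))
      (fun i => form_Jsgn_fderiv_eq_zero hL hz _ _)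
    have hdet : (gram (fderiv ℝ f z)).det = Δ z := gram_det
    have c : ∀ i j, cubic ε f z i j k = cubic ε f z k i j := fun i j => by
      rw [cubic_comm₂₃ hp hL hz, cubic_comm₁₂ hp hz]
    have c' := cubic_comm₂₃ hp hL hz k 1 0
    simp only [← cubic.eq_def ε f z, c, Fin.sum_univ_two, c', Matrix.inv_def, Matrix.smul_apply,
      Matrix.adjugate_fin_two, hdet, Ring.inverse_eq_inv', Matrix.of_apply, Matrix.cons_val',
      Matrix.cons_val_zero, Matrix.cons_val_one, smul_eq_mul, gram_comm] at k₃
    have hΔ : Δ z ≠ 0 := (hg z hz).2.ne'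
    have hg0 : g z 0 0 ≠ 0 := (hg z hz).1.ne'
    have s1 : a₁ z ^ 2 = (g z 0 0)⁻¹ := eq_inv_of_mul_eq_one_left (sa₁ z hz)
    have s2 := eq_inv_of_mul_eq_one_left (ss z hz)
    -- These three identities say that ∑ eᵢ ⊗ eᵢ is the inverse metric, so the frame trace agrees
    -- with the trace in the definition of H.
    have e1 : a₁ z ^ 2 + a₂ z ^ 2 = g z 1 1 / Δ z := by
      simp only [a₂, mul_pow, s2, s1]
      field_simp
      simp only [Δ]; ring
    have e2 : a₂ z * b₂ z = -g z 0 1 / Δ z := by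
      have : a₂ z * b₂ z = -g z 0 1 * g z 0 0 * (√(g z 0 0 * Δ z))⁻¹ ^ 2 := by
        simp only [a₂, b₂]; ring
      rw [this, s2]; field_simp
    have e3 : b₂ z ^ 2 = g z 0 0 / Δ z := by
      simp only [b₂, mul_pow, s2]; field_simp
    have hsum : connectionForm ε f e₁ e₂ (bv k) z = _ := congrArg₂ (· + ·) k₁ k₂
    rw [hsum, k₃]
    linear_combination cubic ε f z k 0 0 * e1 + 2 * cubic ε f z k 0 1 * e2 +
      cubic ε f z k 1 1 * e3
  rw [← connectionForm_curl hε (hp.contDiffAt hu) he₁ he₂ (hV.mono hp.mem) (hV.mono hfr),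
    (hβ 0).fderiv_eq, (hβ 1).fderiv_eq]
  have hdiff : ∀ k, DifferentiableAt ℝ
      (fun z => form (patchH f z) (Jsgn ε (f z) (fderiv ℝ f z (bv k)))) u := fun k =>
    (hasFDerivAt_form (hH.differentiable u hu) (hasFDerivAt_Jsgn ε
      ((hp.contDiffAt hu).differentiableAt (by simp))
      ((hfd k).differentiableAt (by simp))).1).1
  rw [fderiv_const_mul (hdiff 0), fderiv_const_mul (hdiff 1)]
  simp only [smul_apply, fderiv_form_patchH hp hL hH hu,
    fderiv_fderiv_symm (hp.contDiffAt hu) (bv 1), sub_self]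

/-! ### Products of curves -/

/-- A smooth regular curve in `S²`. -/
structure IsCurveS (I : Set ℝ) (α : ℝ → R3) : Prop where
  isOpen : IsOpen I
  smooth : ContDiffOn ℝ ∞ α I
  mem : ∀ t ∈ I, α t ∈ S2
  regular : ∀ t ∈ I, deriv α t ≠ 0

/-- A smooth regular curve in `H²`. -/
structure IsCurveH (I : Set ℝ) (β : ℝ → R3) : Prop where
  isOpen : IsOpen I
  smooth : ContDiffOn ℝ ∞ β I
  mem : ∀ t ∈ I, β t ∈ H2
  regular : ∀ t ∈ I, deriv β t ≠ 0

theorem IsConstCurvatureCurveS.isCurveS {I : Set ℝ} {α : ℝ → R3} {k : ℝ}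
    (h : IsConstCurvatureCurveS I α k) : IsCurveS I α := ⟨h.isOpen, h.smooth, h.mem, h.regular⟩

theorem IsConstCurvatureCurveH.isCurveH {I : Set ℝ} {α : ℝ → R3} {k : ℝ}
    (h : IsConstCurvatureCurveH I α k) : IsCurveH I α := ⟨h.isOpen, h.smooth, h.mem, h.regular⟩

theorem contDiffAt_deriv {W : Type*} [NormedAddCommGroup W] [NormedSpace ℝ W] {c : ℝ → W} {t : ℝ}
    (h : ContDiffAt ℝ ∞ c t) : ContDiffAt ℝ ∞ (deriv c) t := by
  have h1 : ContDiffAt ℝ ∞ (fun s => fderiv ℝ c s 1) t :=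
    (h.fderiv_right (m := ∞) (by simp)).clm_apply contDiffAt_const
  exact h1

theorem IsCurveS.contDiffAt {I : Set ℝ} {α : ℝ → R3} (h : IsCurveS I α) {t : ℝ} (ht : t ∈ I) :
    ContDiffAt ℝ ∞ α t := h.smooth.contDiffAt (h.isOpen.mem_nhds ht)

theorem IsCurveH.contDiffAt {I : Set ℝ} {α : ℝ → R3} (h : IsCurveH I α) {t : ℝ} (ht : t ∈ I) :
    ContDiffAt ℝ ∞ α t := h.smooth.contDiffAt (h.isOpen.mem_nhds ht)

theorem ContDiffAt.form {E : Type*} [NormedAddCommGroup E] [NormedSpace ℝ E] {a b : E → Ambient}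
    {u : E} (ha : ContDiffAt ℝ ∞ a u) (hb : ContDiffAt ℝ ∞ b u) :
    ContDiffAt ℝ ∞ (fun z => SphereHyp.form (a z) (b z)) u := by
  have h2 : ContDiffAt ℝ ∞ (fun z => formB (a z) (b z)) u :=
    (formB.contDiff.contDiffAt.comp u ha).clm_apply hb
  exact h2

theorem ContDiffAt.Jsgn {E : Type*} [NormedAddCommGroup E] [NormedSpace ℝ E] {a b : E → Ambient}
    {u : E} (ε : ℝ) (ha : ContDiffAt ℝ ∞ a u) (hb : ContDiffAt ℝ ∞ b u) :
    ContDiffAt ℝ ∞ (fun z => SphereHyp.Jsgn ε (a z) (b z)) u := by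
  have h2 : ContDiffAt ℝ ∞ (fun z => JB ε (a z) (b z)) u :=
    ((JB ε).contDiff.contDiffAt.comp u ha).clm_apply hb
  exact h2

/-- The unit normal of a curve in `S²`. -/
def normalS (α : ℝ → R3) (t : ℝ) : R3 := (√(deriv α t ⬝ᵥ deriv α t))⁻¹ • JS (α t) (deriv α t)

/-- The unit normal of a curve in `H²`. -/
def normalH (β : ℝ → R3) (t : ℝ) : R3 :=
  (√(lorentz (deriv β t) (deriv β t)))⁻¹ • JH (β t) (deriv β t)

theorem form_inl_inl (a b : R3) : form (a, 0) (b, 0) = a ⬝ᵥ b := by simp [form, lorentz]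
theorem form_inr_inr (a b : R3) : form (0, a) (0, b) = lorentz a b := by simp [form]
theorem form_inl_inr (a b : R3) : form (a, 0) (0, b) = 0 := by simp [form, lorentz]
theorem form_inr_inl (a b : R3) : form (0, a) (b, 0) = 0 := by simp [form, lorentz]

theorem Jsgn_inl_inl (ε : ℝ) (x v : R3) : Jsgn ε (x, 0) (v, 0) = (JS x v, 0) := by
  ext i <;> fin_cases i <;> simp [Jsgn, JH_zero, JH_one, JH_two]
theorem Jsgn_inr_inr (x v : R3) : Jsgn 1 (0, x) (0, v) = (0, JH x v) := by
  ext i <;> fin_cases i <;> simp [Jsgn, JS_zero, JS_one, JS_two]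
theorem Jsgn_inl (ε : ℝ) (p : Ambient) (v : R3) : Jsgn ε p (v, 0) = (JS p.1 v, 0) := by
  ext i <;> fin_cases i <;> simp [Jsgn, JH_zero, JH_one, JH_two]
theorem Jsgn_inr (p : Ambient) (v : R3) : Jsgn 1 p (0, v) = (0, JH p.2 v) := by
  ext i <;> fin_cases i <;> simp [Jsgn, JS_zero, JS_one, JS_two]

/-- The projection may be dropped because `JS (α t) _` is orthogonal to `α t`. -/
theorem curvatureS_eq (α : ℝ → R3) (t : ℝ) : curvatureS α t =
    (deriv (deriv α) t ⬝ᵥ JS (α t) (deriv α t)) / √(deriv α t ⬝ᵥ deriv α t) ^ 3 := by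
  rw [curvatureS]
  congr 1
  simp only [projS, dot_apply, JS_zero, JS_one, JS_two, Pi.sub_apply, Pi.smul_apply, smul_eq_mul]
  ring

theorem curvatureH_eq (α : ℝ → R3) (t : ℝ) : curvatureH α t =
    lorentz (deriv (deriv α) t) (JH (α t) (deriv α t)) /
      √(lorentz (deriv α t) (deriv α t)) ^ 3 := by
  rw [curvatureH]
  congr 1
  simp only [projH, lorentz, JH_zero, JH_one, JH_two, Pi.add_apply, Pi.smul_apply, smul_eq_mul]
  ring

/-! ### Speed, unit normal and curvature of a single curve -/

section Curves

variable {I : Set ℝ} {α : ℝ → R3}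

theorem dot_self_deriv {I : Set ℝ} {α : ℝ → R3} (hI : IsOpen I) {t : ℝ} (ht : t ∈ I)
    (hα : ContDiffAt ℝ ∞ α t) (hm : ∀ t ∈ I, α t ∈ S2) : α t ⬝ᵥ deriv α t = 0 := by
  have hd : HasDerivAt α (deriv α t) t := (hα.differentiableAt (by simp)).hasDerivAt
  have hd' : DifferentiableAt ℝ (fun s => ((α s, 0) : Ambient)) t :=
    hd.differentiableAt.prodMk (differentiableAt_const _)
  have hf : fderiv ℝ (fun s => ((α s, 0) : Ambient)) t 1 = (deriv α t, 0) := by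
    have := (hd.prodMk (hasDerivAt_const t (0 : R3))).deriv
    exact this
  have := fderiv_form_eq_zero (c := 1) hd' hd' (Filter.mem_of_superset (hI.mem_nhds ht)
    fun s hs => (form_inl_inl _ _).trans (hm s hs)) 1
  rw [hf, form_inl_inl, form_inl_inl, dotProduct_comm] at this
  linarith

theorem lorentz_self_deriv {I : Set ℝ} {α : ℝ → R3} (hI : IsOpen I) {t : ℝ} (ht : t ∈ I)
    (hα : ContDiffAt ℝ ∞ α t) (hm : ∀ t ∈ I, α t ∈ H2) : lorentz (α t) (deriv α t) = 0 := by
  have hd : HasDerivAt α (deriv α t) t := (hα.differentiableAt (by simp)).hasDerivAt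
  have hd' : DifferentiableAt ℝ (fun s => ((0, α s) : Ambient)) t :=
    (differentiableAt_const _).prodMk hd.differentiableAt
  have hf : fderiv ℝ (fun s => ((0, α s) : Ambient)) t 1 = (0, deriv α t) := by
    have := ((hasDerivAt_const t (0 : R3)).prodMk hd).deriv
    exact this
  have := fderiv_form_eq_zero (c := -1) hd' hd' (Filter.mem_of_superset (hI.mem_nhds ht)
    fun s hs => (form_inr_inr _ _).trans (hm s hs).1) 1
  rw [hf, form_inr_inr, form_inr_inr] at this
  simp only [lorentz] at *
  linarith

theorem IsCurveS.speed_pos (h : IsCurveS I α) {t : ℝ} (ht : t ∈ I) :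
    0 < deriv α t ⬝ᵥ deriv α t := dot_self_pos (h.regular t ht)

theorem IsCurveS.dot_deriv (h : IsCurveS I α) {t : ℝ} (ht : t ∈ I) :
    α t ⬝ᵥ deriv α t = 0 := dot_self_deriv h.isOpen ht (h.contDiffAt ht) h.mem

theorem IsCurveH.lorentz_deriv (h : IsCurveH I α) {t : ℝ} (ht : t ∈ I) :
    lorentz (α t) (deriv α t) = 0 := lorentz_self_deriv h.isOpen ht (h.contDiffAt ht) h.mem

theorem IsCurveH.speed_pos (h : IsCurveH I α) {t : ℝ} (ht : t ∈ I) :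
    0 < lorentz (deriv α t) (deriv α t) :=
  lorentz_self_pos (h.mem t ht).1 (h.lorentz_deriv ht) (h.regular t ht)

theorem IsCurveS.contDiffAt_normalS (h : IsCurveS I α) {t : ℝ} (ht : t ∈ I) :
    ContDiffAt ℝ ∞ (normalS α) t := by
  have h0 : ContDiffAt ℝ ∞ (fun t => ((α t, 0) : Ambient)) t :=
    (h.contDiffAt ht).prodMk contDiffAt_const
  have h1 : ContDiffAt ℝ ∞ (fun t => ((deriv α t, 0) : Ambient)) t :=
    (contDiffAt_deriv (h.contDiffAt ht)).prodMk contDiffAt_const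
  have h2 := ContDiffAt.form h1 h1
  have h3 := ContDiffAt.Jsgn 1 h0 h1
  simp only [form_inl_inl, Jsgn_inl_inl] at h2 h3
  exact ((h2.sqrt (h.speed_pos ht).ne').inv (Real.sqrt_pos.2 (h.speed_pos ht)).ne').smul h3.fst

theorem IsCurveH.contDiffAt_normalH (h : IsCurveH I α) {t : ℝ} (ht : t ∈ I) :
    ContDiffAt ℝ ∞ (normalH α) t := by
  have h0 : ContDiffAt ℝ ∞ (fun t => ((0, α t) : Ambient)) t :=
    contDiffAt_const.prodMk (h.contDiffAt ht)
  have h1 : ContDiffAt ℝ ∞ (fun t => ((0, deriv α t) : Ambient)) t :=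
    contDiffAt_const.prodMk (contDiffAt_deriv (h.contDiffAt ht))
  have h2 := ContDiffAt.form h1 h1
  have h3 := ContDiffAt.Jsgn 1 h0 h1
  simp only [form_inr_inr, Jsgn_inr_inr] at h2 h3
  exact ((h2.sqrt (h.speed_pos ht).ne').inv (Real.sqrt_pos.2 (h.speed_pos ht)).ne').smul h3.snd

theorem IsCurveS.contDiffAt_curvatureS (h : IsCurveS I α) {t : ℝ} (ht : t ∈ I) :
    ContDiffAt ℝ ∞ (curvatureS α) t := by
  have h0 : ContDiffAt ℝ ∞ (fun t => ((α t, 0) : Ambient)) t :=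
    (h.contDiffAt ht).prodMk contDiffAt_const
  have h1 : ContDiffAt ℝ ∞ (fun t => ((deriv α t, 0) : Ambient)) t :=
    (contDiffAt_deriv (h.contDiffAt ht)).prodMk contDiffAt_const
  have h2 : ContDiffAt ℝ ∞ (fun t => ((deriv (deriv α) t, 0) : Ambient)) t :=
    (contDiffAt_deriv (contDiffAt_deriv (h.contDiffAt ht))).prodMk contDiffAt_const
  have h3 := ContDiffAt.form h2 (ContDiffAt.Jsgn 1 h0 h1)
  have h4 := ContDiffAt.form h1 h1
  simp only [form_inl_inl, Jsgn_inl_inl] at h3 h4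
  have := h3.div ((h4.sqrt (h.speed_pos ht).ne').pow 3)
    (pow_pos (Real.sqrt_pos.2 (h.speed_pos ht)) 3).ne'
  rw [show curvatureS α = _ from funext (curvatureS_eq α)]
  exact this

theorem IsCurveH.contDiffAt_curvatureH (h : IsCurveH I α) {t : ℝ} (ht : t ∈ I) :
    ContDiffAt ℝ ∞ (curvatureH α) t := by
  have h0 : ContDiffAt ℝ ∞ (fun t => ((0, α t) : Ambient)) t :=
    contDiffAt_const.prodMk (h.contDiffAt ht)
  have h1 : ContDiffAt ℝ ∞ (fun t => ((0, deriv α t) : Ambient)) t :=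
    contDiffAt_const.prodMk (contDiffAt_deriv (h.contDiffAt ht))
  have h2 : ContDiffAt ℝ ∞ (fun t => ((0, deriv (deriv α) t) : Ambient)) t :=
    contDiffAt_const.prodMk (contDiffAt_deriv (contDiffAt_deriv (h.contDiffAt ht)))
  have h3 := ContDiffAt.form h2 (ContDiffAt.Jsgn 1 h0 h1)
  have h4 := ContDiffAt.form h1 h1
  simp only [form_inr_inr, Jsgn_inr_inr] at h3 h4
  have := h3.div ((h4.sqrt (h.speed_pos ht).ne').pow 3)
    (pow_pos (Real.sqrt_pos.2 (h.speed_pos ht)) 3).ne'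
  rw [show curvatureH α = _ from funext (curvatureH_eq α)]
  exact this

theorem IsCurveS.normalS_dot_self (h : IsCurveS I α) {t : ℝ} (ht : t ∈ I) :
    normalS α t ⬝ᵥ normalS α t = 1 := by
  have hs := h.speed_pos ht
  rw [normalS, smul_dotProduct, dotProduct_smul, dot_JS_JS (h.mem t ht) (h.dot_deriv ht),
    smul_eq_mul, smul_eq_mul]
  have := Real.mul_self_sqrt hs.le
  have h0 := (Real.sqrt_pos.2 hs).ne'
  field_simp
  linarith

theorem IsCurveH.lorentz_normalH_self (h : IsCurveH I α) {t : ℝ} (ht : t ∈ I) :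
    lorentz (normalH α t) (normalH α t) = 1 := by
  have hs := h.speed_pos ht
  rw [normalH, lorentz_smul_smul, lorentz_JH_JH (h.mem t ht).1 (h.lorentz_deriv ht)]
  have := Real.mul_self_sqrt hs.le
  have h0 := (Real.sqrt_pos.2 hs).ne'
  field_simp
  linarith

theorem IsCurveS.normalS_dot_deriv (h : IsCurveS I α) {t : ℝ} (ht : t ∈ I) :
    deriv (normalS α) t ⬝ᵥ normalS α t = 0 := by
  -- The unit normal is itself a curve in S², so the relation ⟨α, α'⟩ = 0 applies to it. In the
  -- hyperbolic case the normal is spacelike and leaves H², and the relation is derived anew.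
  have := dot_self_deriv h.isOpen ht (h.contDiffAt_normalS ht) fun s hs => h.normalS_dot_self hs
  rwa [dotProduct_comm]

theorem IsCurveH.lorentz_normalH_deriv (h : IsCurveH I α) {t : ℝ} (ht : t ∈ I) :
    lorentz (deriv (normalH α) t) (normalH α t) = 0 := by
  have hd : HasDerivAt (normalH α) (deriv (normalH α) t) t :=
    ((h.contDiffAt_normalH ht).differentiableAt (by simp)).hasDerivAt
  have hd' : DifferentiableAt ℝ (fun s => ((0, normalH α s) : Ambient)) t :=
    (differentiableAt_const _).prodMk hd.differentiableAt
  have hf : fderiv ℝ (fun s => ((0, normalH α s) : Ambient)) t 1 = (0, deriv (normalH α) t) :=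
    ((hasDerivAt_const t (0 : R3)).prodMk hd).deriv
  have := fderiv_form_eq_zero (c := 1) hd' hd' (Filter.mem_of_superset (h.isOpen.mem_nhds ht)
    fun s hs => (form_inr_inr _ _).trans (h.lorentz_normalH_self hs)) 1
  rw [hf, form_comm ((0, normalH α t) : Ambient), form_inr_inr] at this
  linarith

end Curves

/-- The parametrization of a product of curves. -/
def prodCurve (α β : ℝ → R3) (u : E2) : Ambient := (α (u 0), β (u 1))

theorem hasFDerivAt_coord {W : Type*} [NormedAddCommGroup W] [NormedSpace ℝ W] {c : ℝ → W}
    {u : E2} (i : Fin 2) (hc : DifferentiableAt ℝ c (u i)) :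
    HasFDerivAt (fun z : E2 => c (z i))
      ((EuclideanSpace.proj i : E2 →L[ℝ] ℝ).smulRight (deriv c (u i))) u := by
  have h1 : HasFDerivAt (fun z : E2 => z i) (EuclideanSpace.proj i : E2 →L[ℝ] ℝ) u :=
    (EuclideanSpace.proj i : E2 →L[ℝ] ℝ).hasFDerivAt
  have h2 := hc.hasDerivAt.hasFDerivAt.comp u h1
  convert! h2 using 1

theorem hasFDerivAt_prodCurve {α β : ℝ → R3} {u : E2} (hα : DifferentiableAt ℝ α (u 0))
    (hβ : DifferentiableAt ℝ β (u 1)) : DifferentiableAt ℝ (prodCurve α β) u ∧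
    ∀ X, fderiv ℝ (prodCurve α β) u X = (X 0 • deriv α (u 0), X 1 • deriv β (u 1)) := by
  have h := (hasFDerivAt_coord 0 hα).prodMk (hasFDerivAt_coord 1 hβ)
  have h' : HasFDerivAt (prodCurve α β) _ u := h
  exact ⟨h'.differentiableAt, fun X => by rw [h'.fderiv]; rfl⟩

/-! ### Tangent plane, normals and mean curvature of a product of curves -/

section Product

variable {I I' : Set ℝ} {α β : ℝ → R3}

theorem isOpen_box {I I' : Set ℝ} (hI : IsOpen I) (hI' : IsOpen I') :
    IsOpen {u : E2 | u 0 ∈ I ∧ u 1 ∈ I'} :=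
  (hI.preimage (by fun_prop : Continuous fun u : E2 => u 0)).inter
    (hI'.preimage (by fun_prop : Continuous fun u : E2 => u 1))

theorem prodCurve_fderiv_fderiv (hα : IsCurveS I α) (hβ : IsCurveH I' β) {u : E2}
    (hu : u 0 ∈ I ∧ u 1 ∈ I') (X Y : E2) :
    fderiv ℝ (fderiv ℝ (prodCurve α β)) u X Y =
      ((X 0 * Y 0) • deriv (deriv α) (u 0), (X 1 * Y 1) • deriv (deriv β) (u 1)) := by
  have hs : ContDiffAt ℝ ∞ (prodCurve α β) u := by
    have h0 : ContDiffAt ℝ ∞ (fun z : E2 => z 0) u := by fun_prop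
    have h1 : ContDiffAt ℝ ∞ (fun z : E2 => z 1) u := by fun_prop
    exact ((hα.contDiffAt hu.1).comp u h0).prodMk ((hβ.contDiffAt hu.2).comp u h1)
  rw [← (fderiv_fderiv_apply hs Y).2]
  have h1 : (fun z => fderiv ℝ (prodCurve α β) z Y) =ᶠ[nhds u]
      prodCurve (fun t => Y 0 • deriv α t) (fun t => Y 1 • deriv β t) := by
    filter_upwards [(isOpen_box hα.isOpen hβ.isOpen).mem_nhds hu] with z hz
    rw [(hasFDerivAt_prodCurve ((hα.contDiffAt hz.1).differentiableAt (by simp))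
      ((hβ.contDiffAt hz.2).differentiableAt (by simp))).2]
    rfl
  have dα := (contDiffAt_deriv (hα.contDiffAt hu.1)).differentiableAt (n := ∞) (by simp)
  have dβ := (contDiffAt_deriv (hβ.contDiffAt hu.2)).differentiableAt (n := ∞) (by simp)
  rw [h1.fderiv_eq, (hasFDerivAt_prodCurve (dα.fun_const_smul _) (dβ.fun_const_smul _)).2,
    deriv_fun_const_smul _ dα, deriv_fun_const_smul _ dβ, smul_smul, smul_smul]

theorem isPatch_prodCurve (hα : IsCurveS I α) (hβ : IsCurveH I' β) :
    IsPatch {u : E2 | u 0 ∈ I ∧ u 1 ∈ I'} (prodCurve α β) where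
  isOpen := isOpen_box hα.isOpen hβ.isOpen
  smooth u hu := by
    have h0 : ContDiffAt ℝ ∞ (fun z : E2 => z 0) u := by fun_prop
    have h1 : ContDiffAt ℝ ∞ (fun z : E2 => z 1) u := by fun_prop
    exact (((hα.contDiffAt hu.1).comp u h0).prodMk
      ((hβ.contDiffAt hu.2).comp u h1)).contDiffWithinAt
  mem u hu := ⟨hα.mem _ hu.1, hβ.mem _ hu.2⟩
  injective u hu := by
    intro X Y h
    rw [(hasFDerivAt_prodCurve ((hα.contDiffAt hu.1).differentiableAt (by simp))
      ((hβ.contDiffAt hu.2).differentiableAt (by simp))).2,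
      (hasFDerivAt_prodCurve ((hα.contDiffAt hu.1).differentiableAt (by simp))
      ((hβ.contDiffAt hu.2).differentiableAt (by simp))).2, Prod.mk.injEq] at h
    ext i
    fin_cases i
    · exact smul_left_injective ℝ (hα.regular _ hu.1) h.1
    · exact smul_left_injective ℝ (hβ.regular _ hu.2) h.2

theorem prodCurve_fderiv (hα : IsCurveS I α) (hβ : IsCurveH I' β) {u : E2}
    (hu : u 0 ∈ I ∧ u 1 ∈ I') :
    fderiv ℝ (prodCurve α β) u (bv 0) = (deriv α (u 0), 0) ∧
    fderiv ℝ (prodCurve α β) u (bv 1) = (0, deriv β (u 1)) := by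
  have h := (hasFDerivAt_prodCurve ((hα.contDiffAt hu.1).differentiableAt (by simp))
    ((hβ.contDiffAt hu.2).differentiableAt (by simp))).2
  simp [h]

/-- A tangent vector orthogonal to a product of curves and its unit normals vanishes. -/
theorem prodCurve_eq_zero (hα : IsCurveS I α) (hβ : IsCurveH I' β) {u : E2}
    (hu : u 0 ∈ I ∧ u 1 ∈ I') {v : Ambient} (hv : v ∈ tangentSub (prodCurve α β u))
    (h0 : ∀ k, form v (fderiv ℝ (prodCurve α β) u (bv k)) = 0)
    (h1 : form v (normalS α (u 0), 0) = 0) (h2 : form v (0, normalH β (u 1)) = 0) : v = 0 := by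
  have hp := isPatch_prodCurve hα hβ
  have hd := prodCurve_fderiv hα hβ hu
  have hs := hα.speed_pos hu.1
  have hs' := hβ.speed_pos hu.2
  have q := Real.mul_self_sqrt hs.le
  have q' := Real.mul_self_sqrt hs'.le
  have q0 := (Real.sqrt_pos.2 hs).ne'
  have q0' := (Real.sqrt_pos.2 hs').ne'
  have m0 := hp.fderiv_mem hu (bv 0)
  have m1 := hp.fderiv_mem hu (bv 1)
  have k0 := h0 0
  have k1 := h0 1
  rw [hd.1] at m0 k0
  rw [hd.2] at m1 k1
  -- The unit tangents of the two curves form a unitary frame for J₁, and J₁ carries them to the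
  -- unit normals.
  have fr : IsUnitaryFrame 1 (prodCurve α β u)
      ((√(deriv α (u 0) ⬝ᵥ deriv α (u 0)))⁻¹ • ((deriv α (u 0), 0) : Ambient))
      ((√(lorentz (deriv β (u 1)) (deriv β (u 1))))⁻¹ • ((0, deriv β (u 1)) : Ambient)) :=
    { mem_fst := Submodule.smul_mem _ _ m0
      mem_snd := Submodule.smul_mem _ _ m1
      form_fst := by
        rw [form_smul_left, form_smul_right, form_inl_inl]
        field_simp; linarith
      form_snd := by
        rw [form_smul_left, form_smul_right, form_inr_inr]
        field_simp; linarith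
      form_fst_snd := by rw [form_smul_left, form_smul_right, form_inl_inr]; ring
      form_J := by
        rw [Jsgn_smul, form_smul_left, form_smul_right, Jsgn_inl, form_inl_inr]; ring }
  refine fr.eq_zero (by norm_num) (hp.mem u hu) hv ?_ ?_ ?_ ?_
  · rw [form_smul_right, k0, mul_zero]
  · rw [form_smul_right, k1, mul_zero]
  · rw [Jsgn_smul, Jsgn_inl, Prod.smul_mk, smul_zero]; exact h1
  · rw [Jsgn_smul, Jsgn_inr, Prod.smul_mk, smul_zero]; exact h2

theorem inl_normalS_mem {u : E2} :
    (normalS α (u 0), 0) ∈ tangentSub (prodCurve α β u) := by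
  have := Jsgn_mem 1 (prodCurve α β u)
    ((√(deriv α (u 0) ⬝ᵥ deriv α (u 0)))⁻¹ • ((deriv α (u 0), 0) : Ambient))
  rwa [Jsgn_smul, Jsgn_inl, Prod.smul_mk, smul_zero] at this

theorem inr_normalH_mem {u : E2} :
    (0, normalH β (u 1)) ∈ tangentSub (prodCurve α β u) := by
  have := Jsgn_mem 1 (prodCurve α β u)
    ((√(lorentz (deriv β (u 1)) (deriv β (u 1))))⁻¹ • ((0, deriv β (u 1)) : Ambient))
  rwa [Jsgn_smul, Jsgn_inr, Prod.smul_mk, smul_zero] at this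

theorem form_prodCurve_normalS (hα : IsCurveS I α) (hβ : IsCurveH I' β) {u : E2}
    (hu : u 0 ∈ I ∧ u 1 ∈ I') (i : Fin 2) :
    form (fderiv ℝ (prodCurve α β) u (bv i)) (normalS α (u 0), 0) = 0 := by
  have hd := prodCurve_fderiv hα hβ hu
  fin_cases i
  · change form (fderiv ℝ (prodCurve α β) u (bv 0)) _ = 0
    rw [hd.1, form_inl_inl, normalS, dotProduct_smul]
    simp only [dot_apply, JS_zero, JS_one, JS_two, smul_eq_mul]
    ring
  · change form (fderiv ℝ (prodCurve α β) u (bv 1)) _ = 0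
    rw [hd.2, form_inr_inl]

theorem form_prodCurve_normalH (hα : IsCurveS I α) (hβ : IsCurveH I' β) {u : E2}
    (hu : u 0 ∈ I ∧ u 1 ∈ I') (i : Fin 2) :
    form (fderiv ℝ (prodCurve α β) u (bv i)) (0, normalH β (u 1)) = 0 := by
  have hd := prodCurve_fderiv hα hβ hu
  fin_cases i
  · change form (fderiv ℝ (prodCurve α β) u (bv 0)) _ = 0
    rw [hd.1, form_inl_inr]
  · change form (fderiv ℝ (prodCurve α β) u (bv 1)) _ = 0
    rw [hd.2, form_inr_inr, normalH]
    simp only [lorentz, JH_zero, JH_one, JH_two, Pi.smul_apply, smul_eq_mul]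
    ring

/-- Both sides are tangent to the ambient space and orthogonal to the surface, so it suffices to
pair them with the two unit normals. There the Gram matrix is diagonal and the Hessian has no mixed
terms, and the trace splits into the two geodesic curvatures. -/
theorem patchH_prodCurve (hα : IsCurveS I α) (hβ : IsCurveH I' β) {u : E2}
    (hu : u 0 ∈ I ∧ u 1 ∈ I') : patchH (prodCurve α β) u =
      prodCurve (fun t => (curvatureS α t / 2) • normalS α t)
        (fun t => (curvatureH β t / 2) • normalH β t) u := by
  have hp := isPatch_prodCurve hα hβ
  have hd := prodCurve_fderiv hα hβ hu
  have hs := hα.speed_pos hu.1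
  have hs' := hβ.speed_pos hu.2
  have q := Real.sq_sqrt hs.le
  have q' := Real.sq_sqrt hs'.le
  have q0 := (Real.sqrt_pos.2 hs).ne'
  have q0' := (Real.sqrt_pos.2 hs').ne'
  have hF : prodCurve (fun t => (curvatureS α t / 2) • normalS α t)
        (fun t => (curvatureH β t / 2) • normalH β t) u =
      (curvatureS α (u 0) / 2) • (normalS α (u 0), (0 : R3)) +
        (curvatureH β (u 1) / 2) • ((0 : R3), normalH β (u 1)) := by
    simp [prodCurve]
  have hg : (gram (fderiv ℝ (prodCurve α β) u))⁻¹ =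
      !![(deriv α (u 0) ⬝ᵥ deriv α (u 0))⁻¹, 0;
        0, (lorentz (deriv β (u 1)) (deriv β (u 1)))⁻¹] := by
    refine Matrix.inv_eq_right_inv ?_
    ext i j
    fin_cases i <;> fin_cases j <;>
      simp [Matrix.mul_apply, gram_apply, hd.1, hd.2, form_inl_inl, form_inr_inl, form_inl_inr,
        form_inr_inr, hs.ne', hs'.ne']
  rw [hF, ← sub_eq_zero]
  refine prodCurve_eq_zero hα hβ hu ?_ ?_ ?_ ?_
  · exact Submodule.sub_mem _ (patchH_mem hp hu) (Submodule.add_mem _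
      (Submodule.smul_mem _ _ (inl_normalS_mem)) (Submodule.smul_mem _ _ (inr_normalH_mem)))
  · intro k
    have h0 : form (patchH (prodCurve α β) u) (fderiv ℝ (prodCurve α β) u (bv k)) = 0 := by
      simp only [patchH, form_smul_left, form_sum_left,
        form_normalPart_map (hp.gram_det_ne_zero hu)]
      simp
    rw [form_sub_left, form_add_left, form_smul_left, form_smul_left, h0,
      form_comm _ (fderiv ℝ (prodCurve α β) u (bv k)), form_prodCurve_normalS hα hβ hu,
      form_comm _ (fderiv ℝ (prodCurve α β) u (bv k)), form_prodCurve_normalH hα hβ hu]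
    ring
  · rw [form_sub_left, form_add_left, form_smul_left, form_smul_left, form_inr_inl, form_inl_inl,
      hα.normalS_dot_self hu.1, form_patchH (inl_normalS_mem)
        (form_prodCurve_normalS hα hβ hu), hg]
    simp only [Fin.sum_univ_two, prodCurve_fderiv_fderiv hα hβ hu, form_mk]
    simp [curvatureS_eq, normalS, lorentz]
    -- The squared speed comes from the Gram matrix, its root from the normal and the curvature; all
    -- is rewritten in terms of the root.
    rw [← q]
    simp only [Real.sqrt_sq (Real.sqrt_nonneg _)]
    field_simp
    ring
  · rw [form_sub_left, form_add_left, form_smul_left, form_smul_left, form_inl_inr, form_inr_inr,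
      hβ.lorentz_normalH_self hu.2, form_patchH (inr_normalH_mem)
        (form_prodCurve_normalH hα hβ hu), hg]
    have e1 := lorentz_smul_smul 1 (√(lorentz (deriv β (u 1)) (deriv β (u 1))))⁻¹
      (deriv (deriv β) (u 1)) (JH (β (u 1)) (deriv β (u 1)))
    rw [one_smul, one_mul] at e1
    simp only [Fin.sum_univ_two, prodCurve_fderiv_fderiv hα hβ hu, form_mk]
    simp [curvatureH_eq, normalH, e1]
    have e2 : ∀ v, lorentz 0 v = 0 := fun v => by simp [lorentz]
    simp only [e2]
    rw [← q']
    simp only [Real.sqrt_sq (Real.sqrt_nonneg _)]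
    field_simp
    ring

end Product

theorem patchH_congr {f g : E2 → Ambient} {u : E2} (h : f =ᶠ[nhds u] g) :
    patchH f u = patchH g u := by
  simp only [patchH, h.fderiv_eq, h.fderiv.fderiv_eq, h.eq_of_nhds]

theorem eventuallyEq_of_eqOn {V : Set E2} {f g : E2 → Ambient} (hV : IsOpen V)
    (h : ∀ u ∈ V, f u = g u) {u : E2} (hu : u ∈ V) : f =ᶠ[nhds u] g :=
  Filter.mem_of_superset (hV.mem_nhds hu) h

theorem kaehler_congr {f g : E2 → Ambient} {u : E2} (h : f =ᶠ[nhds u] g) (ε : ℝ) :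
    kaehler ε f u = kaehler ε g u := by
  simp only [kaehler, h.fderiv_eq, h.eq_of_nhds]

theorem IsPMCPatch.congr {V : Set E2} {f g : E2 → Ambient} (hf : IsPMCPatch V f) (hV : IsOpen V)
    (h : ∀ u ∈ V, f u = g u) : IsPMCPatch V g := by
  have hH : ∀ u ∈ V, patchH f =ᶠ[nhds u] patchH g := fun u hu =>
    Filter.mem_of_superset (hV.mem_nhds hu) fun z hz =>
      patchH_congr (eventuallyEq_of_eqOn hV h hz)
  refine ⟨fun u hu => ?_, fun u hu => ?_, fun u hu X => ?_⟩
  · rw [← (hH u hu).eq_of_nhds]; exact hf.ne_zero u hu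
  · exact (hH u hu).differentiableAt_iff.1 (hf.differentiable u hu)
  · rw [← (hH u hu).fderiv_eq, ← h u hu, ← (eventuallyEq_of_eqOn hV h hu).fderiv_eq]
    exact hf.parallel u hu X

/-! ### Linear isometries -/

/-- A linear map of `ℝ³ × ℝ³₁` preserving the two factors and their inner products. -/
structure IsLinearIsometry (A B : R3 →L[ℝ] R3) : Prop where
  dot : ∀ v w, A v ⬝ᵥ A w = v ⬝ᵥ w
  lor : ∀ v w, lorentz (B v) (B w) = lorentz v w

namespace IsLinearIsometry

variable {A B : R3 →L[ℝ] R3}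

theorem form_map (h : IsLinearIsometry A B) (v w : Ambient) :
    form (A.prodMap B v) (A.prodMap B w) = form v w :=
  congrArg₂ (· + ·) (h.dot v.1 w.1) (h.lor v.2 w.2)

theorem projAmbient_map (h : IsLinearIsometry A B) (p v : Ambient) :
    projAmbient (A.prodMap B p) (A.prodMap B v) = A.prodMap B (projAmbient p v) := by
  have h1 : A p.1 ⬝ᵥ A v.1 = p.1 ⬝ᵥ v.1 := h.dot _ _
  have h2 : lorentz (B p.2) (B v.2) = lorentz p.2 v.2 := h.lor _ _
  refine Prod.ext ?_ ?_
  · simp [projAmbient, projS, h1]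
  · simp [projAmbient, projH, h2]

theorem gram_map (h : IsLinearIsometry A B) (D : E2 →L[ℝ] Ambient) :
    gram (A.prodMap B ∘L D) = gram D := by
  ext i j
  exact h.form_map _ _

theorem normalPart_map (h : IsLinearIsometry A B) (p v : Ambient) (D : E2 →L[ℝ] Ambient) :
    normalPart (A.prodMap B p) (A.prodMap B ∘L D) (A.prodMap B v) =
      A.prodMap B (normalPart p D v) := by
  rw [normalPart_eq, normalPart_eq, map_sub, map_sum, h.gram_map, h.projAmbient_map]
  simp only [map_sum, map_smul, ContinuousLinearMap.comp_apply, h.form_map]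

theorem patchH_map (h : IsLinearIsometry A B) {V : Set E2} {f : E2 → Ambient} (hf : IsPatch V f)
    {u : E2} (hu : u ∈ V) :
    patchH (A.prodMap B ∘ f) u = A.prodMap B (patchH f u) := by
  have hd : ∀ z ∈ V, fderiv ℝ (A.prodMap B ∘ f) z = A.prodMap B ∘L fderiv ℝ f z := fun z hz =>
    ((A.prodMap B).hasFDerivAt.comp z
      ((hf.contDiffAt hz).differentiableAt (by simp)).hasFDerivAt).fderiv
  have hdd : ∀ X Y, fderiv ℝ (fderiv ℝ (A.prodMap B ∘ f)) u X Y =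
      A.prodMap B (fderiv ℝ (fderiv ℝ f) u X Y) := by
    intro X Y
    have hs : ContDiffAt ℝ ∞ (A.prodMap B ∘ f) u :=
      (A.prodMap B).contDiff.contDiffAt.comp u (hf.contDiffAt hu)
    have h1 := fderiv_fderiv_apply (hf.contDiffAt hu) Y
    rw [← (fderiv_fderiv_apply hs Y).2, ← h1.2]
    have h2 : (fun z => fderiv ℝ (A.prodMap B ∘ f) z Y) =ᶠ[nhds u]
        fun z => A.prodMap B (fderiv ℝ f z Y) := by
      filter_upwards [hf.isOpen.mem_nhds hu] with z hz
      rw [hd z hz]; rfl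
    rw [h2.fderiv_eq]
    exact congrArg (fun D : E2 →L[ℝ] Ambient => D X)
      ((A.prodMap B).hasFDerivAt.comp u h1.1.hasFDerivAt).fderiv
  simp only [patchH, hd u hu, hdd, h.gram_map, map_smul, map_sum, Function.comp_apply,
    h.normalPart_map]

theorem isPMCPatch_map (h : IsLinearIsometry A B) {V : Set E2} {f : E2 → Ambient}
    (hf : IsPatch V f) (hH : IsPMCPatch V f) : IsPMCPatch V (A.prodMap B ∘ f) := by
  have hd : ∀ z ∈ V, fderiv ℝ (A.prodMap B ∘ f) z = A.prodMap B ∘L fderiv ℝ f z := fun z hz =>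
    ((A.prodMap B).hasFDerivAt.comp z
      ((hf.contDiffAt hz).differentiableAt (by simp)).hasFDerivAt).fderiv
  have he : ∀ u ∈ V, patchH (A.prodMap B ∘ f) =ᶠ[nhds u] A.prodMap B ∘ patchH f := fun u hu =>
    Filter.mem_of_superset (hf.isOpen.mem_nhds hu) fun z hz => h.patchH_map hf hz
  have hdH : ∀ u ∈ V, HasFDerivAt (A.prodMap B ∘ patchH f)
      (A.prodMap B ∘L fderiv ℝ (patchH f) u) u := fun u hu =>
    (A.prodMap B).hasFDerivAt.comp u (hH.differentiable u hu).hasFDerivAt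
  refine ⟨fun u hu h0 => ?_, fun u hu => ?_, fun u hu X => ?_⟩
  · rw [h.patchH_map hf hu] at h0
    -- The form on `ℝ³ × ℝ³₁` is indefinite, but positive on ambient tangent vectors; so H has
    -- positive square length, which the map preserves.
    have h1 := form_self_pos (hf.mem u hu) (patchH_mem hf hu) (hH.ne_zero u hu)
    rw [← h.form_map, h0, form_zero_left] at h1
    exact h1.false
  · rw [(he u hu).differentiableAt_iff]
    exact (hdH u hu).differentiableAt
  · rw [(he u hu).fderiv_eq, (hdH u hu).fderiv, hd u hu, Function.comp_apply]
    change normalPart _ _ (A.prodMap B (fderiv ℝ (patchH f) u X)) = 0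
    rw [h.normalPart_map, hH.parallel u hu, map_zero]

end IsLinearIsometry

/-! ### Products of curves with parallel mean curvature -/

section Product

variable {I I' : Set ℝ} {α β : ℝ → R3}

theorem patchH_prodCurve_fderiv (hα : IsCurveS I α) (hβ : IsCurveH I' β) {u : E2}
    (hu : u 0 ∈ I ∧ u 1 ∈ I') : DifferentiableAt ℝ (patchH (prodCurve α β)) u ∧
    ∀ X, fderiv ℝ (patchH (prodCurve α β)) u X =
      (X 0 • ((curvatureS α (u 0) / 2) • deriv (normalS α) (u 0) +
        (deriv (curvatureS α) (u 0) / 2) • normalS α (u 0)),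
       X 1 • ((curvatureH β (u 1) / 2) • deriv (normalH β) (u 1) +
        (deriv (curvatureH β) (u 1) / 2) • normalH β (u 1))) := by
  have he : patchH (prodCurve α β) =ᶠ[nhds u] prodCurve
      (fun t => (curvatureS α t / 2) • normalS α t)
      (fun t => (curvatureH β t / 2) • normalH β t) :=
    Filter.mem_of_superset ((isOpen_box hα.isOpen hβ.isOpen).mem_nhds hu) fun z hz =>
      patchH_prodCurve hα hβ hz
  have h1 : HasDerivAt (fun t => (curvatureS α t / 2) • normalS α t) _ (u 0) :=
    HasDerivAt.smul
      (((hα.contDiffAt_curvatureS hu.1).differentiableAt (by simp)).hasDerivAt.div_const 2)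
      ((hα.contDiffAt_normalS hu.1).differentiableAt (by simp)).hasDerivAt
  have h2 : HasDerivAt (fun t => (curvatureH β t / 2) • normalH β t) _ (u 1) :=
    HasDerivAt.smul
      (((hβ.contDiffAt_curvatureH hu.2).differentiableAt (by simp)).hasDerivAt.div_const 2)
      ((hβ.contDiffAt_normalH hu.2).differentiableAt (by simp)).hasDerivAt
  have h3 := hasFDerivAt_prodCurve h1.differentiableAt h2.differentiableAt
  refine ⟨he.differentiableAt_iff.2 h3.1, fun X => ?_⟩
  rw [he.fderiv_eq, h3.2, h1.deriv, h2.deriv]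

/-- The derivative of a unit normal is orthogonal to that normal, so pairing ∇^⊥ H = 0 with the two
normals leaves half the derivatives of the curvatures. -/
theorem deriv_curvature_eq_zero (hα : IsCurveS I α) (hβ : IsCurveH I' β)
    (hH : IsPMCPatch {u : E2 | u 0 ∈ I ∧ u 1 ∈ I'} (prodCurve α β)) {u : E2}
    (hu : u 0 ∈ I ∧ u 1 ∈ I') :
    deriv (curvatureS α) (u 0) = 0 ∧ deriv (curvatureH β) (u 1) = 0 := by
  have hd := (patchH_prodCurve_fderiv hα hβ hu).2
  constructor
  · have h1 := form_normalPart (p := prodCurve α β u) inl_normalS_mem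
      (form_prodCurve_normalS hα hβ hu)
      (fderiv ℝ (patchH (prodCurve α β)) u (bv 0))
    rw [hH.parallel u hu, form_zero_left, hd, form_mk] at h1
    simp [add_dotProduct, hα.normalS_dot_deriv hu.1, hα.normalS_dot_self hu.1, lorentz] at h1
    linarith
  · have h1 := form_normalPart (p := prodCurve α β u) inr_normalH_mem
      (form_prodCurve_normalH hα hβ hu)
      (fderiv ℝ (patchH (prodCurve α β)) u (bv 1))
    have e : ∀ (a b : ℝ) (v w z : R3), lorentz (a • v + b • w) z =
        a * lorentz v z + b * lorentz w z := fun a b v w z => by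
      simp only [lorentz, Pi.add_apply, Pi.smul_apply, smul_eq_mul]; ring
    rw [hH.parallel u hu, form_zero_left, hd, form_mk] at h1
    simp [e, hβ.lorentz_normalH_deriv hu.2, hβ.lorentz_normalH_self hu.2] at h1
    linarith

/-- With constant curvatures the derivative of H involves only the derivatives of the unit normals,
which are orthogonal to the normals. -/
theorem isPMCPatch_prodCurve {kα kβ : ℝ} (hα : IsConstCurvatureCurveS I α kα)
    (hβ : IsConstCurvatureCurveH I' β kβ) (hk : kα ≠ 0 ∨ kβ ≠ 0) :
    IsPMCPatch {u : E2 | u 0 ∈ I ∧ u 1 ∈ I'} (prodCurve α β) := by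
  have cα := hα.isCurveS
  have cβ := hβ.isCurveH
  have hp := isPatch_prodCurve cα cβ
  have hc : ∀ t ∈ I, deriv (curvatureS α) t = 0 := fun t ht => by
    have : curvatureS α =ᶠ[nhds t] fun _ => kα :=
      Filter.mem_of_superset (hα.isOpen.mem_nhds ht) hα.curvature
    rw [this.deriv_eq, deriv_const]
  have hc' : ∀ t ∈ I', deriv (curvatureH β) t = 0 := fun t ht => by
    have : curvatureH β =ᶠ[nhds t] fun _ => kβ :=
      Filter.mem_of_superset (hβ.isOpen.mem_nhds ht) hβ.curvature
    rw [this.deriv_eq, deriv_const]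
  refine ⟨fun u hu h0 => ?_, fun u hu => (patchH_prodCurve_fderiv cα cβ hu).1, fun u hu X => ?_⟩
  · rw [patchH_prodCurve cα cβ hu, prodCurve, Prod.mk_eq_zero, hα.curvature _ hu.1,
      hβ.curvature _ hu.2] at h0
    have n1 : normalS α (u 0) ≠ 0 := fun h => by
      have := cα.normalS_dot_self hu.1
      rw [h] at this; simp at this
    have n2 : normalH β (u 1) ≠ 0 := fun h => by
      have := cβ.lorentz_normalH_self hu.2
      rw [h] at this; simp [lorentz] at this
    simp only [smul_eq_zero, n1, n2, or_false, div_eq_zero_iff, OfNat.ofNat_ne_zero] at h0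
    tauto
  · have hd := (patchH_prodCurve_fderiv cα cβ hu).2 X
    rw [hc _ hu.1, hc' _ hu.2] at hd
    refine prodCurve_eq_zero cα cβ hu (normalPart_mem (hp.mem u hu) (hp.fderiv_mem hu) _)
      (fun k => form_normalPart_map (hp.gram_det_ne_zero hu) _ k) ?_ ?_
    · rw [form_normalPart inl_normalS_mem (form_prodCurve_normalS cα cβ hu), hd, form_mk]
      simp [cα.normalS_dot_deriv hu.1, lorentz]
    · have e : ∀ (a : ℝ) (v z : R3), lorentz (a • v) z = a * lorentz v z := fun a v z => by
        simp only [lorentz, Pi.smul_apply, smul_eq_mul]; ring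
      rw [form_normalPart inr_normalH_mem (form_prodCurve_normalH cα cβ hu), hd, form_mk]
      simp [e, cβ.lorentz_normalH_deriv hu.2]

end Product

/-! ### Splitting of surfaces that are Lagrangian for both complex structures -/

/-- Both components of the differential have rank at most one. -/
theorem minors_eq_zero {V : Set E2} {f : E2 → Ambient} (hp : IsPatch V f) {u : E2} (hu : u ∈ V)
    (h1 : kaehler 1 f u = 0) (h2 : kaehler (-1) f u = 0) :
    (∀ i j, (fderiv ℝ f u (bv 0)).1 i * (fderiv ℝ f u (bv 1)).1 j =
      (fderiv ℝ f u (bv 0)).1 j * (fderiv ℝ f u (bv 1)).1 i) ∧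
    (∀ i j, (fderiv ℝ f u (bv 0)).2 i * (fderiv ℝ f u (bv 1)).2 j =
      (fderiv ℝ f u (bv 0)).2 j * (fderiv ℝ f u (bv 1)).2 i) := by
  have hm := hp.mem u hu
  have m0 := hp.fderiv_mem hu (bv 0)
  have m1 := hp.fderiv_mem hu (bv 1)
  rw [kaehler, form_Jsgn_comm] at h1 h2
  generalize fderiv ℝ f u (bv 0) = a at *
  generalize fderiv ℝ f u (bv 1) = b at *
  generalize f u = p at *
  have e : ∀ (c : ℝ) (v z : R3), lorentz v (c • z) = c * lorentz v z := fun a v z => by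
    simp only [lorentz, Pi.smul_apply, smul_eq_mul]; ring
  simp only [form, Jsgn, e] at h1 h2
  -- Half the sum and half the difference of the two Kähler forms are the area forms of the factors.
  -- Their vanishing makes the cross products of the components zero; the minors are the entries of
  -- these products.
  have hS : a.1 ⬝ᵥ JS p.1 b.1 = 0 := by linarith
  have hH : lorentz a.2 (JH p.2 b.2) = 0 := by linarith
  have cS := cross_tangent hm.1 m0.1 m1.1
  have cH := lorentz_cross_tangent hm.2.1 m0.2 m1.2
  rw [hS] at cS
  rw [hH] at cH
  have s0 := cS (Pi.single 0 1)
  have s1 := cS (Pi.single 1 1)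
  have s2 := cS (Pi.single 2 1)
  have t0 := cH (Pi.single 0 1)
  have t1 := cH (Pi.single 1 1)
  have t2 := cH (Pi.single 2 1)
  simp [JS_zero, JS_one, JS_two] at s0 s1 s2
  simp [lorentz, JH_zero, JH_one, JH_two] at t0 t1 t2
  constructor <;> intro i j <;> fin_cases i <;> fin_cases j <;> simp <;> linarith

theorem fderiv_component {V : Set E2} {f : E2 → Ambient} (hp : IsPatch V f) {u : E2} (hu : u ∈ V)
    (i : Fin 3) : HasFDerivAt (fun z => (f z).1 i) ((ContinuousLinearMap.proj i ∘L
      ContinuousLinearMap.fst ℝ R3 R3) ∘L fderiv ℝ f u) u ∧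
    HasFDerivAt (fun z => (f z).2 i) ((ContinuousLinearMap.proj i ∘L
      ContinuousLinearMap.snd ℝ R3 R3) ∘L fderiv ℝ f u) u := by
  have h := ((hp.contDiffAt hu).differentiableAt (by simp)).hasFDerivAt
  exact ⟨(ContinuousLinearMap.proj i ∘L ContinuousLinearMap.fst ℝ R3 R3).hasFDerivAt.comp u h,
    (ContinuousLinearMap.proj i ∘L ContinuousLinearMap.snd ℝ R3 R3).hasFDerivAt.comp u h⟩

/-- If two vectors `a`, `b` have vanishing minors and are not both zero in the coordinate `i`, then
a linear combination that vanishes in the coordinate `i` vanishes. -/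
theorem combination_eq_zero {a b : R3} (h : ∀ i j, a i * b j = a j * b i) {i : Fin 3}
    (hi : a i ≠ 0 ∨ b i ≠ 0) {x y : ℝ} (hx : x * a i + y * b i = 0) : x • a + y • b = 0 := by
  ext j
  simp only [Pi.add_apply, Pi.smul_apply, smul_eq_mul, Pi.zero_apply]
  have h' := h i j
  rcases hi with hi | hi
  · apply mul_left_cancel₀ hi
    linear_combination a j * hx + y * h'
  · apply mul_left_cancel₀ hi
    linear_combination b j * hx - x * h'

/-- If one component of `D` vanished, the other would be injective on a plane, which its rank-one
condition forbids. -/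
theorem exists_component_ne_zero {D : E2 →L[ℝ] Ambient} (hD : Function.Injective D)
    (h1 : ∀ i j, (D (bv 0)).1 i * (D (bv 1)).1 j = (D (bv 0)).1 j * (D (bv 1)).1 i)
    (h2 : ∀ i j, (D (bv 0)).2 i * (D (bv 1)).2 j = (D (bv 0)).2 j * (D (bv 1)).2 i) :
    (∃ i, (D (bv 0)).1 i ≠ 0 ∨ (D (bv 1)).1 i ≠ 0) ∧
    ∃ j, (D (bv 0)).2 j ≠ 0 ∨ (D (bv 1)).2 j ≠ 0 := by
  have hne : ∀ i, D (bv i) ≠ 0 := fun i h => by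
    have := congrArg (fun z : E2 => z i) (hD (h.trans (map_zero D).symm))
    simp at this
  have key : ∀ x y : ℝ, x • D (bv 0) + y • D (bv 1) = 0 → x = 0 ∧ y = 0 := fun x y h => by
    have h0 : D (x • bv 0 + y • bv 1) = 0 := by simpa using h
    have := hD (h0.trans (map_zero D).symm)
    have e0 := congrArg (fun z : E2 => z 0) this
    have e1 := congrArg (fun z : E2 => z 1) this
    simp at e0 e1
    exact ⟨e0, e1⟩
  constructor
  · by_contra! hc
    have z0 : (D (bv 0)).1 = 0 := funext fun i => (hc i).1
    have z1 : (D (bv 1)).1 = 0 := funext fun i => (hc i).2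
    have : ∃ j, (D (bv 0)).2 j ≠ 0 := by
      by_contra! hc'
      exact hne 0 (Prod.ext z0 (funext hc'))
    obtain ⟨j, hj⟩ := this
    have := combination_eq_zero h2 (Or.inl hj)
      (x := -(D (bv 1)).2 j) (y := (D (bv 0)).2 j) (by ring)
    exact hj (key _ _ (Prod.ext (by simp [z0, z1]) this)).2
  · by_contra! hc
    have z0 : (D (bv 0)).2 = 0 := funext fun i => (hc i).1
    have z1 : (D (bv 1)).2 = 0 := funext fun i => (hc i).2
    have : ∃ j, (D (bv 0)).1 j ≠ 0 := by
      by_contra! hc'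
      exact hne 0 (Prod.ext (funext hc') z0)
    obtain ⟨j, hj⟩ := this
    have := combination_eq_zero h1 (Or.inl hj)
      (x := -(D (bv 1)).1 j) (y := (D (bv 0)).1 j) (by ring)
    exact hj (key _ _ (Prod.ext this (by simp [z0, z1]))).2

theorem eq_smul_add (D : E2 →L[ℝ] Ambient) (X : E2) :
    D X = X 0 • D (bv 0) + X 1 • D (bv 1) := by
  conv_lhs => rw [eq_sum_bv X, map_add, map_smul, map_smul]

section Chart

variable {S : Type*} [TopologicalSpace S] [ChartedSpace E2 S] [IsManifold (𝓡 2) ∞ S]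
  {Φ : S → Ambient}

/-- Around each point there is a chart onto a box whose coordinates are a component of the
`S²`-part and a component of the `H²`-part. -/
theorem exists_component_chart (hΦ : IsImmersionIntoS2H2 Φ)
    (h1 : IsLagrangian (Jsgn 1) Φ) (h2 : IsLagrangian (Jsgn (-1)) Φ) (p : S) :
    ∃ e ∈ IsManifold.maximalAtlas (𝓡 2) ∞ S, p ∈ e.source ∧ ∃ (a b a' b' : ℝ) (i j : Fin 3),
      e.target = {u : E2 | u 0 ∈ Set.Ioo a b ∧ u 1 ∈ Set.Ioo a' b'} ∧
      ∀ u ∈ e.target, (Φ (e.symm u)).1 i = u 0 ∧ (Φ (e.symm u)).2 j = u 1 := by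
  set e₀ := chartAt E2 p with he₀
  have hm₀ : e₀ ∈ IsManifold.maximalAtlas (𝓡 2) ∞ S := IsManifold.chart_mem_maximalAtlas p
  set f := Φ ∘ e₀.symm with hf
  have hp := hΦ.isPatch hm₀
  have hmin := fun u (hu : u ∈ e₀.target) => minors_eq_zero hp hu
    (h1.kaehler_eq_zero hΦ hm₀ hu) (h2.kaehler_eq_zero hΦ hm₀ hu)
  have hu₀ : e₀ p ∈ e₀.target := mem_chart_target E2 p
  obtain ⟨⟨i, hi⟩, ⟨j, hj⟩⟩ := exists_component_ne_zero (hp.injective _ hu₀) (hmin _ hu₀).1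
    (hmin _ hu₀).2
  -- The candidate coordinates: one entry of the S²-part and one of the H²-part, each with nonzero
  -- differential at the base point.
  let g : E2 → E2 := fun z => WithLp.toLp 2 ![(f z).1 i, (f z).2 j]
  have hgs : ∀ u ∈ e₀.target, ContDiffAt ℝ ∞ g u := fun u hu => by
    have hs := hp.contDiffAt hu
    refine contDiffAt_piLp _ |>.2 fun k => ?_
    fin_cases k
    · exact contDiffAt_pi.1 hs.fst i
    · exact contDiffAt_pi.1 hs.snd j
  have hg0 : ∀ u ∈ e₀.target, ∀ X, (fderiv ℝ g u X) 0 = (fderiv ℝ f u X).1 i := fun u hu X => by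
    have := (EuclideanSpace.proj (0 : Fin 2) : E2 →L[ℝ] ℝ).hasFDerivAt.comp u
      ((hgs u hu).differentiableAt (by simp)).hasFDerivAt
    have := this.unique ((fderiv_component hp hu i).1)
    exact congrArg (fun D : E2 →L[ℝ] ℝ => D X) this
  have hg1 : ∀ u ∈ e₀.target, ∀ X, (fderiv ℝ g u X) 1 = (fderiv ℝ f u X).2 j := fun u hu X => by
    have := (EuclideanSpace.proj (1 : Fin 2) : E2 →L[ℝ] ℝ).hasFDerivAt.comp u
      ((hgs u hu).differentiableAt (by simp)).hasFDerivAt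
    have := this.unique ((fderiv_component hp hu j).2)
    exact congrArg (fun D : E2 →L[ℝ] ℝ => D X) this
  let W : Set E2 := {u | u ∈ e₀.target ∧ Function.Injective (fderiv ℝ g u)}
  -- In each factor the differential has rank at most one, so a vector killed by an entry with
  -- nonzero differential is killed by the whole component. Both together contradict immersivity
  -- unless the vector is zero.
  have hinj : ∀ u ∈ e₀.target, ((fderiv ℝ f u (bv 0)).1 i ≠ 0 ∨ (fderiv ℝ f u (bv 1)).1 i ≠ 0) →
      ((fderiv ℝ f u (bv 0)).2 j ≠ 0 ∨ (fderiv ℝ f u (bv 1)).2 j ≠ 0) →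
      Function.Injective (fderiv ℝ g u) := fun u hu k1 k2 => by
    rw [injective_iff_map_eq_zero]
    intro X hX
    have z0 := hg0 u hu X
    have z1 := hg1 u hu X
    rw [hX] at z0 z1
    rw [eq_smul_add] at z0 z1
    refine hp.injective u hu (Eq.trans ?_ (map_zero _).symm)
    rw [eq_smul_add]
    exact Prod.ext (combination_eq_zero (hmin u hu).1 k1 z0.symm)
      (combination_eq_zero (hmin u hu).2 k2 z1.symm)
  obtain ⟨O, hO, hOu, hOW⟩ : ∃ O : Set E2, IsOpen O ∧ e₀ p ∈ O ∧ O ⊆ W := by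
    have hcont : ContinuousOn (fderiv ℝ f) e₀.target := fun u hu =>
      (((hp.contDiffAt hu).fderiv_right (m := ∞) (by simp)).continuousAt).continuousWithinAt
    have hc1 : ∀ k, ContinuousOn (fun u => (fderiv ℝ f u (bv k)).1 i) e₀.target := fun k =>
      (continuous_apply i).comp_continuousOn
        (continuous_fst.comp_continuousOn (hcont.clm_apply continuousOn_const))
    have hc2 : ∀ k, ContinuousOn (fun u => (fderiv ℝ f u (bv k)).2 j) e₀.target := fun k =>
      (continuous_apply j).comp_continuousOn
        (continuous_snd.comp_continuousOn (hcont.clm_apply continuousOn_const))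
    have hop : ∀ {φ : E2 → ℝ}, ContinuousOn φ e₀.target → IsOpen (e₀.target ∩ φ ⁻¹' {0}ᶜ) :=
      fun hφ => hφ.isOpen_inter_preimage e₀.open_target isOpen_compl_singleton
    refine ⟨(e₀.target ∩ (fun u => (fderiv ℝ f u (bv 0)).1 i) ⁻¹' {0}ᶜ ∪
      e₀.target ∩ (fun u => (fderiv ℝ f u (bv 1)).1 i) ⁻¹' {0}ᶜ) ∩
      (e₀.target ∩ (fun u => (fderiv ℝ f u (bv 0)).2 j) ⁻¹' {0}ᶜ ∪
      e₀.target ∩ (fun u => (fderiv ℝ f u (bv 1)).2 j) ⁻¹' {0}ᶜ),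
      ((hop (hc1 0)).union (hop (hc1 1))).inter ((hop (hc2 0)).union (hop (hc2 1))), ?_, ?_⟩
    · exact ⟨hi.imp (fun h => ⟨hu₀, h⟩) (fun h => ⟨hu₀, h⟩),
        hj.imp (fun h => ⟨hu₀, h⟩) (fun h => ⟨hu₀, h⟩)⟩
    · rintro u ⟨k1, k2⟩
      have hu : u ∈ e₀.target := k1.elim (·.1) (·.1)
      exact ⟨hu, hinj u hu (k1.imp (·.2) (·.2)) (k2.imp (·.2) (·.2))⟩
  have hequiv : ∀ u ∈ W, ∃ T : E2 ≃L[ℝ] E2, HasFDerivAt g (T : E2 →L[ℝ] E2) u := fun u hu => by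
    refine ⟨(LinearEquiv.ofInjectiveEndo (fderiv ℝ g u).toLinearMap
      hu.2).toContinuousLinearEquiv, ?_⟩
    have := ((hgs u hu.1).differentiableAt (by simp)).hasFDerivAt
    convert! this using 1
  obtain ⟨T, hT⟩ := hequiv _ (hOW hOu)
  let G := (hgs _ hu₀).toOpenPartialHomeomorph g hT (by simp)
  have hGu : e₀ p ∈ G.source := (hgs _ hu₀).mem_toOpenPartialHomeomorph_source hT (by simp)
  -- The inverse function theorem gives smoothness of the inverse near one point only; on `O` the
  -- differential of `g` stays invertible, so the inverse is smooth on the whole target.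
  let G' := G.restrOpen O hO
  have hG'u : e₀ p ∈ G'.source := ⟨hGu, hOu⟩
  have hG'W : G'.source ⊆ W := fun u hu => hOW hu.2
  have hG't : g (e₀ p) ∈ G'.target := G'.map_source hG'u
  obtain ⟨r, hr, hbox⟩ : ∃ r > 0, {u : E2 | u 0 ∈ Set.Ioo (g (e₀ p) 0 - r) (g (e₀ p) 0 + r) ∧
      u 1 ∈ Set.Ioo (g (e₀ p) 1 - r) (g (e₀ p) 1 + r)} ⊆ G'.target := by
    have ho : IsOpen ((fun v : Fin 2 → ℝ => WithLp.toLp 2 v) ⁻¹' G'.target) :=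
      G'.open_target.preimage (by fun_prop)
    obtain ⟨r, hr, hb⟩ := Metric.isOpen_iff.1 ho (WithLp.ofLp (g (e₀ p))) hG't
    refine ⟨r, hr, fun u hu => ?_⟩
    have : WithLp.ofLp u ∈ Metric.ball (WithLp.ofLp (g (e₀ p))) r := by
      rw [Metric.mem_ball, dist_pi_lt_iff hr]
      intro k
      rw [Real.dist_eq, abs_lt]
      have a1 := hu.1.1
      have a2 := hu.1.2
      have a3 := hu.2.1
      have a4 := hu.2.2
      fin_cases k <;> constructor <;> simp at * <;> linarith
    exact hb this
  set box : Set E2 := {u : E2 | u 0 ∈ Set.Ioo (g (e₀ p) 0 - r) (g (e₀ p) 0 + r) ∧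
      u 1 ∈ Set.Ioo (g (e₀ p) 1 - r) (g (e₀ p) 1 + r)} with hboxdef
  have hbo : IsOpen box := isOpen_box isOpen_Ioo isOpen_Ioo
  -- `restrOpen` shrinks a source; passing to the inverse and back shrinks the target to the box.
  let e := ((e₀.trans G').symm.restrOpen box hbo).symm
  have htar : e.target = box := by
    apply Set.Subset.antisymm
    · exact fun u hu => hu.2
    · intro u hu
      refine ⟨⟨hbox hu, ?_⟩, hu⟩
      exact (hG'W (G'.map_target (hbox hu))).1
  have hsymm : ∀ u, e.symm u = e₀.symm (G'.symm u) := fun u => rfl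
  have hcoe : ∀ q, e q = g (e₀ q) := fun q => rfl
  have hsrc : e.source ⊆ e₀.source := fun q hq => by
    have h3 := e.map_source hq
    rw [htar] at h3
    have h4 := e.left_inv hq
    rw [← h4, hsymm]
    exact e₀.map_target (hG'W (G'.map_target (hbox h3))).1
  have hgG : ∀ u ∈ box, g (G'.symm u) = u := fun u hu => G'.right_inv (hbox hu)
  have hmem : e ∈ IsManifold.maximalAtlas (𝓡 2) ∞ S := by
    refine e.mem_maximalAtlas_of_contMDiffOn ?_ ?_
    · have c1 : ContMDiffOn (𝓡 2) (𝓡 2) ∞ g e₀.target :=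
        contMDiffOn_iff_contDiffOn.2 fun u hu => (hgs u hu).contDiffWithinAt
      exact (c1.comp (contMDiffOn_of_mem_maximalAtlas hm₀)
        (fun q hq => e₀.map_source hq)).mono hsrc
    · have c1 : ContMDiffOn (𝓡 2) (𝓡 2) ∞ G'.symm box := by
        refine contMDiffOn_iff_contDiffOn.2 fun u hu => ?_
        have hw := hG'W (G'.map_target (hbox hu))
        obtain ⟨T, hT⟩ := hequiv _ hw
        exact (G'.contDiffAt_symm (hbox hu) hT (hgs _ hw.1)).contDiffWithinAt
      rw [htar]
      exact (contMDiffOn_symm_of_mem_maximalAtlas hm₀).comp c1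
        (fun u hu => (hG'W (G'.map_target (hbox hu))).1)
  refine ⟨e, hmem, ?_, _, _, _, _, i, j, htar, fun u hu => ?_⟩
  · have h3 : g (e₀ p) ∈ e.target := by
      rw [htar]
      refine ⟨⟨?_, ?_⟩, ⟨?_, ?_⟩⟩ <;> linarith
    have h4 := e.map_target h3
    rw [hsymm] at h4
    have h5 : G'.symm (g (e₀ p)) = e₀ p := G'.left_inv hG'u
    rwa [h5, e₀.left_inv (mem_chart_source E2 p)] at h4
  · rw [htar] at hu
    have h3 := hgG u hu
    constructor
    · exact congrArg (fun z : E2 => z 0) h3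
    · exact congrArg (fun z : E2 => z 1) h3

end Chart

theorem isAmbientIsometry_id : IsAmbientIsometry id where
  bijOn := Set.bijOn_id _
  smooth := ⟨Set.univ, isOpen_univ, Set.subset_univ _, contDiff_id.contDiffOn⟩
  metric p _ v _ w _ := by simp

theorem hasDerivAt_fst {c : ℝ → Ambient} {c' : Ambient} {t : ℝ} (h : HasDerivAt c c' t) :
    HasDerivAt (fun s => (c s).1) c'.1 t :=
  (ContinuousLinearMap.fst ℝ R3 R3).hasFDerivAt.comp_hasDerivAt t h

theorem hasDerivAt_snd {c : ℝ → Ambient} {c' : Ambient} {t : ℝ} (h : HasDerivAt c c' t) :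
    HasDerivAt (fun s => (c s).2) c'.2 t :=
  (ContinuousLinearMap.snd ℝ R3 R3).hasFDerivAt.comp_hasDerivAt t h

/-- A box patch whose components are coordinate functions and with differentials of rank one is a
product of curves. -/
theorem exists_eq_prodCurve {a b a' b' : ℝ} {f : E2 → Ambient} {u₀ : E2} {i j : Fin 3}
    (hp : IsPatch {u : E2 | u 0 ∈ Set.Ioo a b ∧ u 1 ∈ Set.Ioo a' b'} f)
    (hu₀ : u₀ 0 ∈ Set.Ioo a b ∧ u₀ 1 ∈ Set.Ioo a' b')
    (h1 : ∀ u : E2, u 0 ∈ Set.Ioo a b ∧ u 1 ∈ Set.Ioo a' b' → kaehler 1 f u = 0)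
    (h2 : ∀ u : E2, u 0 ∈ Set.Ioo a b ∧ u 1 ∈ Set.Ioo a' b' → kaehler (-1) f u = 0)
    (hi : ∀ u : E2, u 0 ∈ Set.Ioo a b ∧ u 1 ∈ Set.Ioo a' b' → (f u).1 i = u 0 ∧ (f u).2 j = u 1) :
    ∃ α β : ℝ → R3, IsCurveS (Set.Ioo a b) α ∧ IsCurveH (Set.Ioo a' b') β ∧
      ∀ u : E2, u 0 ∈ Set.Ioo a b ∧ u 1 ∈ Set.Ioo a' b' → f u = prodCurve α β u := by
  set V := {u : E2 | u 0 ∈ Set.Ioo a b ∧ u 1 ∈ Set.Ioo a' b'} with hV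
  let P : ℝ → ℝ → E2 := fun t s => WithLp.toLp 2 ![t, s]
  have hP0 : ∀ t s, P t s 0 = t := fun _ _ => rfl
  have hP1 : ∀ t s, P t s 1 = s := fun _ _ => rfl
  have hPu : ∀ u : E2, P (u 0) (u 1) = u := fun u => by ext k; fin_cases k <;> rfl
  have hPeq : ∀ t s, P t s = t • bv 0 + s • bv 1 := fun t s => by
    rw [eq_sum_bv (P t s), hP0, hP1]
  have dP0 : ∀ t s, HasDerivAt (fun t => P t s) (bv 0) t := fun t s => by
    simp only [hPeq]
    simpa using ((hasDerivAt_id t).smul_const (bv 0)).add_const (s • bv 1)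
  have dP1 : ∀ t s, HasDerivAt (fun s => P t s) (bv 1) s := fun t s => by
    simp only [hPeq]
    simpa using ((hasDerivAt_id s).smul_const (bv 1)).const_add (t • bv 0)
  have df : ∀ u ∈ V, HasFDerivAt f (fderiv ℝ f u) u := fun u hu =>
    ((hp.contDiffAt hu).differentiableAt (by simp)).hasFDerivAt
  have ei : ∀ u ∈ V, ∀ X, (fderiv ℝ f u X).1 i = X 0 := fun u hu X => by
    have k1 := (fderiv_component hp hu i).1
    have k2 : HasFDerivAt (fun z : E2 => z 0) (EuclideanSpace.proj 0 : E2 →L[ℝ] ℝ) u :=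
      (EuclideanSpace.proj 0 : E2 →L[ℝ] ℝ).hasFDerivAt
    have := (k2.congr_of_eventuallyEq (Filter.mem_of_superset (hp.isOpen.mem_nhds hu)
      fun z hz => (hi z hz).1)).unique k1
    exact (congrArg (fun D : E2 →L[ℝ] ℝ => D X) this).symm
  have ej : ∀ u ∈ V, ∀ X, (fderiv ℝ f u X).2 j = X 1 := fun u hu X => by
    have k1 := (fderiv_component hp hu j).2
    have k2 : HasFDerivAt (fun z : E2 => z 1) (EuclideanSpace.proj 1 : E2 →L[ℝ] ℝ) u :=
      (EuclideanSpace.proj 1 : E2 →L[ℝ] ℝ).hasFDerivAt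
    have := (k2.congr_of_eventuallyEq (Filter.mem_of_superset (hp.isOpen.mem_nhds hu)
      fun z hz => (hi z hz).2)).unique k1
    exact (congrArg (fun D : E2 →L[ℝ] ℝ => D X) this).symm
  -- The entry `i` of the S²-part is the first coordinate, so its derivatives along ∂₀ and ∂₁ are 1
  -- and 0. A vanishing minor with this entry forces the S²-part of ∂₁ f to vanish.
  have z1 : ∀ u ∈ V, (fderiv ℝ f u (bv 1)).1 = 0 := fun u hu => by
    funext m
    have := (minors_eq_zero hp hu (h1 u hu) (h2 u hu)).1 i m
    rw [ei u hu, ei u hu] at this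
    simpa using this
  have z0 : ∀ u ∈ V, (fderiv ℝ f u (bv 0)).2 = 0 := fun u hu => by
    funext m
    have := (minors_eq_zero hp hu (h1 u hu) (h2 u hu)).2 m j
    rw [ej u hu, ej u hu] at this
    simpa using this
  let α : ℝ → R3 := fun t => (f (P t (u₀ 1))).1
  let β : ℝ → R3 := fun s => (f (P (u₀ 0) s)).2
  have c1 : ∀ u ∈ V, (f u).1 = α (u 0) := fun u hu => by
    have hd : ∀ s ∈ Set.Ioo a' b', HasDerivAt (fun s => (f (P (u 0) s)).1) 0 s := fun s hs => by
      have hm : P (u 0) s ∈ V := ⟨hu.1, hs⟩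
      have := hasDerivAt_fst ((df _ hm).comp_hasDerivAt s (dP1 (u 0) s))
      rwa [z1 _ hm] at this
    have := isOpen_Ioo.is_const_of_deriv_eq_zero isPreconnected_Ioo
      (fun s hs => (hd s hs).differentiableAt.differentiableWithinAt)
      (fun s hs => (hd s hs).deriv) hu.2 hu₀.2
    simp only [hPu] at this
    exact this
  have c2 : ∀ u ∈ V, (f u).2 = β (u 1) := fun u hu => by
    have hd : ∀ t ∈ Set.Ioo a b, HasDerivAt (fun t => (f (P t (u 1))).2) 0 t := fun t ht => by
      have hm : P t (u 1) ∈ V := ⟨ht, hu.2⟩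
      have := hasDerivAt_snd ((df _ hm).comp_hasDerivAt t (dP0 t (u 1)))
      rwa [z0 _ hm] at this
    have := isOpen_Ioo.is_const_of_deriv_eq_zero isPreconnected_Ioo
      (fun s hs => (hd s hs).differentiableAt.differentiableWithinAt)
      (fun s hs => (hd s hs).deriv) hu.1 hu₀.1
    simp only [hPu] at this
    exact this
  refine ⟨α, β, ⟨isOpen_Ioo, ?_, ?_, ?_⟩, ⟨isOpen_Ioo, ?_, ?_, ?_⟩, fun u hu =>
    Prod.ext (c1 u hu) (c2 u hu)⟩
  · intro t ht
    have hm : P t (u₀ 1) ∈ V := ⟨ht, hu₀.2⟩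
    have hPs : ContDiff ℝ ∞ fun t => P t (u₀ 1) := by simp only [hPeq]; fun_prop
    exact ((hp.contDiffAt hm).comp t hPs.contDiffAt).fst.contDiffWithinAt
  · intro t ht
    exact (hp.mem _ (⟨ht, hu₀.2⟩ : P t (u₀ 1) ∈ V)).1
  · intro t ht h0
    have hm : P t (u₀ 1) ∈ V := ⟨ht, hu₀.2⟩
    have k1 : HasDerivAt α _ t := hasDerivAt_fst ((df _ hm).comp_hasDerivAt t (dP0 t (u₀ 1)))
    rw [k1.deriv] at h0
    have := congrFun h0 i
    rw [ei _ hm] at this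
    simp at this
  · intro t ht
    have hm : P (u₀ 0) t ∈ V := ⟨hu₀.1, ht⟩
    have hPs : ContDiff ℝ ∞ fun t => P (u₀ 0) t := by simp only [hPeq]; fun_prop
    exact ((hp.contDiffAt hm).comp t hPs.contDiffAt).snd.contDiffWithinAt
  · intro t ht
    exact (hp.mem _ (⟨hu₀.1, ht⟩ : P (u₀ 0) t ∈ V)).2
  · intro t ht h0
    have hm : P (u₀ 0) t ∈ V := ⟨hu₀.1, ht⟩
    have k1 : HasDerivAt β _ t := hasDerivAt_snd ((df _ hm).comp_hasDerivAt t (dP1 (u₀ 0) t))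
    rw [k1.deriv] at h0
    have := congrFun h0 j
    rw [ej _ hm] at this
    simp at this

/-! ### Lagrangian surfaces with parallel mean curvature split locally -/

section Surface

variable {S : Type*} [TopologicalSpace S] [ChartedSpace E2 S] [IsManifold (𝓡 2) ∞ S]
  {Φ : S → Ambient}

theorem IsLagrangian.neg (hΦ : IsImmersionIntoS2H2 Φ) (hH : IsPMC Φ) {ε : ℝ} (hε : ε * ε = 1)
    (h : IsLagrangian (Jsgn ε) Φ) : IsLagrangian (Jsgn (-ε)) Φ :=
  isLagrangian_of_kaehler_eq_zero hΦ fun q =>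
    ⟨chartAt E2 q, IsManifold.chart_mem_maximalAtlas q, mem_chart_source E2 q,
      kaehler_neg_eq_zero hε (hΦ.isPatch (IsManifold.chart_mem_maximalAtlas q))
        (fun _ hu => h.kaehler_eq_zero hΦ (IsManifold.chart_mem_maximalAtlas q) hu)
        (hH.isPMCPatch hΦ (IsManifold.chart_mem_maximalAtlas q)) (mem_chart_target E2 q)⟩

theorem isLocallyProductOfCurves_of_isPMC (hΦ : IsImmersionIntoS2H2 Φ) (hH : IsPMC Φ)
    (h1 : IsLagrangian (Jsgn 1) Φ) (h2 : IsLagrangian (Jsgn (-1)) Φ) :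
    IsLocallyProductOfCurves Φ := by
  intro p
  obtain ⟨e, he, hpe, a, b, a', b', i, j, htar, hij⟩ := exists_component_chart hΦ h1 h2 p
  have hpatch := hΦ.isPatch he
  have hpmc := hH.isPMCPatch hΦ he
  have hu₀ := e.map_source hpe
  have k1 := fun u (hu : u ∈ e.target) => h1.kaehler_eq_zero hΦ he hu
  have k2 := fun u (hu : u ∈ e.target) => h2.kaehler_eq_zero hΦ he hu
  simp only [htar] at hij hpatch hpmc hu₀ k1 k2
  obtain ⟨α, β, hα, hβ, hf⟩ := exists_eq_prodCurve hpatch hu₀ k1 k2 hij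
  have hpmc' := hpmc.congr (isOpen_box isOpen_Ioo isOpen_Ioo) hf
  set u₀ := e p
  have cα : ∀ t ∈ Set.Ioo a b, curvatureS α t = curvatureS α (u₀ 0) := fun t ht =>
    isOpen_Ioo.is_const_of_deriv_eq_zero isPreconnected_Ioo
      (fun s hs => ((hα.contDiffAt_curvatureS hs).differentiableAt
        (by simp)).differentiableWithinAt)
      (fun s hs => (deriv_curvature_eq_zero hα hβ hpmc'
        (u := WithLp.toLp 2 ![s, u₀ 1]) ⟨hs, hu₀.2⟩).1) ht hu₀.1
  have cβ : ∀ t ∈ Set.Ioo a' b', curvatureH β t = curvatureH β (u₀ 1) := fun t ht =>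
    isOpen_Ioo.is_const_of_deriv_eq_zero isPreconnected_Ioo
      (fun s hs => ((hβ.contDiffAt_curvatureH hs).differentiableAt
        (by simp)).differentiableWithinAt)
      (fun s hs => (deriv_curvature_eq_zero hα hβ hpmc'
        (u := WithLp.toLp 2 ![u₀ 0, s]) ⟨hu₀.1, hs⟩).2) ht hu₀.2
  refine ⟨e, he, hpe, _, _, α, β, _, _, id,
    ⟨hα.isOpen, Set.ordConnected_Ioo, hα.smooth, hα.mem, hα.regular, cα⟩,
    ⟨hβ.isOpen, Set.ordConnected_Ioo, hβ.smooth, hβ.mem, hβ.regular, cβ⟩, ?_,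
    isAmbientIsometry_id, htar, fun u hu => ?_⟩
  -- Two vanishing curvatures would give H = 0. No isometry is needed in this direction: `F` is the
  -- identity.
  · by_contra! hc
    apply hpmc'.ne_zero _ hu₀
    rw [patchH_prodCurve hα hβ hu₀, prodCurve, hc.1, hc.2]
    simp
  · rw [htar] at hu
    exact hf u hu

end Surface

/-! ### Isometries preserve geodesics -/

/-- Koszul's formula: the first fundamental form determines the tangential part of the second
derivative. -/
theorem form_fderiv_fderiv_eq {E : Type*} [NormedAddCommGroup E] [NormedSpace ℝ E]
    {G R : E → Ambient} {u : E} (hG : ContDiffAt ℝ ∞ G u) (hR : ContDiffAt ℝ ∞ R u)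
    (h : ∀ᶠ z in nhds u, ∀ a b, form (fderiv ℝ G z a) (fderiv ℝ G z b) =
      form (fderiv ℝ R z a) (fderiv ℝ R z b)) (a b c : E) :
    form (fderiv ℝ (fderiv ℝ G) u a b) (fderiv ℝ G u c) =
      form (fderiv ℝ (fderiv ℝ R) u a b) (fderiv ℝ R u c) := by
  have key : ∀ a b c, form (fderiv ℝ (fderiv ℝ G) u c a) (fderiv ℝ G u b) +
      form (fderiv ℝ (fderiv ℝ G) u c b) (fderiv ℝ G u a) =
      form (fderiv ℝ (fderiv ℝ R) u c a) (fderiv ℝ R u b) +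
      form (fderiv ℝ (fderiv ℝ R) u c b) (fderiv ℝ R u a) := by
    intro a b c
    have gA := fderiv_fderiv_apply hG a
    have gB := fderiv_fderiv_apply hG b
    have rA := fderiv_fderiv_apply hR a
    have rB := fderiv_fderiv_apply hR b
    have k1 := (hasFDerivAt_form gA.1 gB.1).2 c
    have k2 := (hasFDerivAt_form rA.1 rB.1).2 c
    have he : (fun z => form (fderiv ℝ G z a) (fderiv ℝ G z b)) =ᶠ[nhds u]
        fun z => form (fderiv ℝ R z a) (fderiv ℝ R z b) := h.mono fun z hz => hz a b
    rw [he.fderiv_eq, k2, gA.2, gB.2, rA.2, rB.2, form_comm (fderiv ℝ G u a),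
      form_comm (fderiv ℝ R u a)] at k1
    exact k1.symm
  have sG := fun a b => (hG.isSymmSndFDerivAt (by simpa using two_le_infty)).eq a b
  -- As for Christoffel symbols: `key` gives the derivative of the metric, and two of its cyclic
  -- permutations minus the third isolate one term.
  have sR := fun a b => (hR.isSymmSndFDerivAt (by simpa using two_le_infty)).eq a b
  have k1 := key b c a
  have k2 := key a c b
  have k3 := key a b c
  rw [sG b a, sR b a] at k2
  rw [sG c a, sR c a, sG c b, sR c b] at k3
  linarith

/-- The radial retraction of a neighbourhood of `S² × H²`. -/
def retraction (z : Ambient) : Ambient :=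
  ((√(z.1 ⬝ᵥ z.1))⁻¹ • z.1, (√(-lorentz z.2 z.2))⁻¹ • z.2)

/-- The domain of `retraction`. -/
def retractionDomain : Set Ambient := {z | 0 < z.1 ⬝ᵥ z.1 ∧ lorentz z.2 z.2 < 0 ∧ 0 < z.2 2}

theorem contDiff_dot_fst : ContDiff ℝ ∞ fun z : Ambient => z.1 ⬝ᵥ z.1 := by
  simp only [dot_apply]; fun_prop

theorem contDiff_lorentz_snd : ContDiff ℝ ∞ fun z : Ambient => lorentz z.2 z.2 := by
  simp only [lorentz]; fun_prop

theorem isOpen_retractionDomain : IsOpen retractionDomain :=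
  (isOpen_lt continuous_const contDiff_dot_fst.continuous).inter
    ((isOpen_lt contDiff_lorentz_snd.continuous continuous_const).inter
      (isOpen_lt continuous_const ((continuous_apply 2).comp continuous_snd)))

theorem S2H2_subset_retractionDomain : S2H2 ⊆ retractionDomain := by
  rintro z ⟨h1, h2, h3⟩
  refine ⟨?_, ?_, h3⟩
  · rw [show z.1 ⬝ᵥ z.1 = 1 from h1]; norm_num
  · rw [h2]; norm_num

theorem retraction_mem {z : Ambient} (hz : z ∈ retractionDomain) : retraction z ∈ S2H2 := by
  obtain ⟨h1, h2, h3⟩ := hz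
  have q := Real.mul_self_sqrt h1.le
  have q0 := (Real.sqrt_pos.2 h1).ne'
  have q' := Real.mul_self_sqrt (neg_pos.2 h2).le
  have q0' := Real.sqrt_pos.2 (neg_pos.2 h2)
  refine ⟨?_, ?_, ?_⟩
  · change ((√(z.1 ⬝ᵥ z.1))⁻¹ • z.1) ⬝ᵥ ((√(z.1 ⬝ᵥ z.1))⁻¹ • z.1) = 1
    rw [smul_dotProduct, dotProduct_smul, smul_eq_mul, smul_eq_mul]
    field_simp; linarith
  · simp only [retraction, lorentz_smul_smul]
    have := q0'.ne'
    field_simp; linarith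
  · exact mul_pos (inv_pos.2 q0') h3

theorem retraction_of_mem {z : Ambient} (hz : z ∈ S2H2) : retraction z = z := by
  have h1 : z.1 ⬝ᵥ z.1 = 1 := hz.1
  simp [retraction, h1, hz.2.1]

theorem contDiffAt_retraction_factors {z : Ambient} (hz : z ∈ retractionDomain) :
    ContDiffAt ℝ ∞ (fun z : Ambient => (√(z.1 ⬝ᵥ z.1))⁻¹) z ∧
    ContDiffAt ℝ ∞ (fun z : Ambient => (√(-lorentz z.2 z.2))⁻¹) z :=
  ⟨(contDiff_dot_fst.contDiffAt.sqrt hz.1.ne').inv (Real.sqrt_pos.2 hz.1).ne',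
    (contDiff_lorentz_snd.contDiffAt.neg.sqrt (neg_pos.2 hz.2.1).ne').inv
      (Real.sqrt_pos.2 (neg_pos.2 hz.2.1)).ne'⟩

theorem contDiffAt_retraction {z : Ambient} (hz : z ∈ retractionDomain) :
    ContDiffAt ℝ ∞ retraction z :=
  ((contDiffAt_retraction_factors hz).1.smul contDiffAt_fst).prodMk
    ((contDiffAt_retraction_factors hz).2.smul contDiffAt_snd)

theorem eventually_retractionDomain {z : Ambient} (hz : z ∈ retractionDomain) :
    ∀ᶠ y in nhds z, y ∈ retractionDomain := isOpen_retractionDomain.mem_nhds hz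

theorem fderiv_retraction_mem {z : Ambient} (hz : z ∈ retractionDomain) (w : Ambient) :
    fderiv ℝ retraction z w ∈ tangentSub (retraction z) :=
  fderiv_mem_tangentSub ((contDiffAt_retraction hz).differentiableAt (by simp))
    ((eventually_retractionDomain hz).mono fun _ h => retraction_mem h) w

/-- On the product the scaling factors are 1, and their derivatives add only radial vectors to `w`.
The result is tangent, so the radial terms vanish. -/
theorem fderiv_retraction_of_mem {p w : Ambient} (hp : p ∈ S2H2) (hw : w ∈ tangentSub p) :
    fderiv ℝ retraction p w = w := by
  have hd := S2H2_subset_retractionDomain hp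
  have hm := fderiv_retraction_mem hd w
  rw [retraction_of_mem hp] at hm
  obtain ⟨s1, s2⟩ := contDiffAt_retraction_factors hd
  have h1 := (s1.differentiableAt (by simp)).hasFDerivAt.fun_smul
    (ContinuousLinearMap.fst ℝ R3 R3).hasFDerivAt
  have h2 := (s2.differentiableAt (by simp)).hasFDerivAt.fun_smul
    (ContinuousLinearMap.snd ℝ R3 R3).hasFDerivAt
  have h3 : HasFDerivAt retraction _ p := h1.prodMk h2
  have hp1 : p.1 ⬝ᵥ p.1 = 1 := hp.1
  obtain ⟨c, d, hcd⟩ : ∃ c d : ℝ, fderiv ℝ retraction p w = w + (c • p.1, d • p.2) := by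
    rw [h3.fderiv]
    refine ⟨fderiv ℝ (fun z : Ambient => (√(z.1 ⬝ᵥ z.1))⁻¹) p w,
      fderiv ℝ (fun z : Ambient => (√(-lorentz z.2 z.2))⁻¹) p w, Prod.ext ?_ ?_⟩
    · simp [hp1]
    · simp [hp.2.1]
  rw [hcd] at hm ⊢
  have hsub := Submodule.sub_mem _ hm hw
  rw [add_sub_cancel_left] at hsub
  have hc : c = 0 := by
    have := hsub.1
    simpa [hp1] using this
  have hd : d = 0 := by
    have h5 := lorentz_smul_smul 1 d p.2 p.2
    have h4 : lorentz p.2 (d • p.2) = 0 := hsub.2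
    rw [one_smul, h4, hp.2.1] at h5
    linarith
  simp [hc, hd]

/-- Unit tangent vectors of the sphere exist. -/
theorem exists_unit_tangentS (x : R3) : ∃ v, x ⬝ᵥ v = 0 ∧ v ⬝ᵥ v = 1 := by
  have key : ∀ v : R3, v ≠ 0 → x ⬝ᵥ v = 0 → ∃ v, x ⬝ᵥ v = 0 ∧ v ⬝ᵥ v = 1 := fun v hv h => by
    have hs := dot_self_pos hv
    have q := Real.mul_self_sqrt hs.le
    have q0 := (Real.sqrt_pos.2 hs).ne'
    refine ⟨(√(v ⬝ᵥ v))⁻¹ • v, by rw [dotProduct_smul, h, smul_zero], ?_⟩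
    rw [smul_dotProduct, dotProduct_smul, smul_eq_mul, smul_eq_mul]
    field_simp; linarith
  by_cases h : x 0 = 0
  · exact key ![1, 0, 0] (fun h0 => by simpa using congrFun h0 0) (by rw [dot_apply]; simp [h])
  · exact key ![-x 1, x 0, 0] (fun h0 => h (by simpa using congrFun h0 1))
      (by rw [dot_apply]; simp; ring)

/-- Unit tangent vectors of the hyperbolic plane exist. -/
theorem exists_unit_tangentH {y : R3} (hy : y ∈ H2) : ∃ v, lorentz y v = 0 ∧ lorentz v v = 1 := by
  have hv : (![y 2, 0, y 0] : R3) ≠ 0 := fun h0 => hy.2.ne' (by simpa using congrFun h0 0)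
  have h : lorentz y ![y 2, 0, y 0] = 0 := by simp [lorentz]; ring
  have hs := lorentz_self_pos hy.1 h hv
  have q := Real.mul_self_sqrt hs.le
  have q0 := (Real.sqrt_pos.2 hs).ne'
  generalize (![y 2, 0, y 0] : R3) = v at *
  refine ⟨(√(lorentz v v))⁻¹ • v, ?_, ?_⟩
  · have := lorentz_smul_smul 1 (√(lorentz v v))⁻¹ y v
    rw [one_smul, h, mul_zero] at this
    exact this
  · rw [lorentz_smul_smul]
    field_simp; linarith

theorem lorentz_zero_right (v : R3) : lorentz v 0 = 0 := by simp [lorentz]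

theorem inl_mem {p : Ambient} {v : R3} (h : p.1 ⬝ᵥ v = 0) : (v, 0) ∈ tangentSub p :=
  ⟨h, lorentz_zero_right _⟩

theorem inr_mem {p : Ambient} {v : R3} (h : lorentz p.2 v = 0) : (0, v) ∈ tangentSub p :=
  ⟨dotProduct_zero _, h⟩

theorem isUnitaryFrame_inl_inr {p : Ambient} {v w : R3} (h1 : p.1 ⬝ᵥ v = 0) (h2 : v ⬝ᵥ v = 1)
    (h3 : lorentz p.2 w = 0) (h4 : lorentz w w = 1) : IsUnitaryFrame 1 p (v, 0) (0, w) where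
  mem_fst := inl_mem h1
  mem_snd := inr_mem h3
  form_fst := by rw [form_inl_inl, h2]
  form_snd := by rw [form_inr_inr, h4]
  form_fst_snd := form_inl_inr _ _
  form_J := by rw [Jsgn_inl, form_inl_inr]

namespace IsAmbientIsometry

variable {F : Ambient → Ambient}

theorem contDiffAt (hF : IsAmbientIsometry F) {p : Ambient} (hp : p ∈ S2H2) :
    ContDiffAt ℝ ∞ F p := by
  obtain ⟨U, hU, hs, hc⟩ := hF.smooth
  exact hc.contDiffAt (hU.mem_nhds (hs hp))

theorem contDiffAt_comp (hF : IsAmbientIsometry F) {z : Ambient} (hz : z ∈ retractionDomain) :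
    ContDiffAt ℝ ∞ (F ∘ retraction) z :=
  (hF.contDiffAt (retraction_mem hz)).comp z (contDiffAt_retraction hz)

theorem fderiv_comp (hF : IsAmbientIsometry F) {z : Ambient} (hz : z ∈ retractionDomain)
    (w : Ambient) : fderiv ℝ (F ∘ retraction) z w =
      fderiv ℝ F (retraction z) (fderiv ℝ retraction z w) := by
  rw [_root_.fderiv_comp z ((hF.contDiffAt (retraction_mem hz)).differentiableAt (by simp))
    ((contDiffAt_retraction hz).differentiableAt (by simp))]
  rfl

theorem fderiv_mem (hF : IsAmbientIsometry F) {p : Ambient} (hp : p ∈ S2H2) {w : Ambient}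
    (hw : w ∈ tangentSub p) : fderiv ℝ F p w ∈ tangentSub (F p) := by
  have hd := S2H2_subset_retractionDomain hp
  have := fderiv_mem_tangentSub ((hF.contDiffAt_comp hd).differentiableAt (by simp))
    ((eventually_retractionDomain hd).mono fun _ h => hF.bijOn.mapsTo (retraction_mem h)) w
  rwa [hF.fderiv_comp hd, Function.comp_apply, retraction_of_mem hp,
    fderiv_retraction_of_mem hp hw] at this

/-- The acceleration of the image of a curve has the same tangential part. -/
theorem form_deriv_deriv (hF : IsAmbientIsometry F) {γ : ℝ → Ambient} (hγ : ContDiff ℝ ∞ γ)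
    (hm : ∀ t, γ t ∈ S2H2) (t : ℝ) {w : Ambient} (hw : w ∈ tangentSub (γ t)) :
    form (deriv (deriv (F ∘ γ)) t) (fderiv ℝ F (γ t) w) = form (deriv (deriv γ) t) w := by
  have hd := S2H2_subset_retractionDomain (hm t)
  -- F is isometric only along `S2H2`. On the open domain of the retraction, `F ∘ retraction` and
  -- `retraction` induce the same, degenerate, metric, to which Koszul's formula applies.
  have hK := form_fderiv_fderiv_eq (hF.contDiffAt_comp hd) (contDiffAt_retraction hd)
    ((eventually_retractionDomain hd).mono fun z hz a b => by
      rw [hF.fderiv_comp hz, hF.fderiv_comp hz]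
      exact hF.metric _ (retraction_mem hz) _ (fderiv_retraction_mem hz a) _
        (fderiv_retraction_mem hz b))
  have hdd : ∀ X : Ambient → Ambient, (∀ t, ContDiffAt ℝ ∞ X (γ t)) →
      deriv (deriv (X ∘ γ)) t = fderiv ℝ (fderiv ℝ X) (γ t) (deriv γ t) (deriv γ t) +
        fderiv ℝ X (γ t) (deriv (deriv γ) t) := by
    intro X hX
    have hγd : ∀ s, HasDerivAt γ (deriv γ s) s := fun s =>
      ((hγ.contDiffAt).differentiableAt (by simp)).hasDerivAt
    have h1 : deriv (X ∘ γ) = fun s => fderiv ℝ X (γ s) (deriv γ s) := by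
      funext s
      exact (((hX s).differentiableAt (by simp)).hasFDerivAt.comp_hasDerivAt s (hγd s)).deriv
    have h2 : HasDerivAt (fun s => fderiv ℝ X (γ s))
        (fderiv ℝ (fderiv ℝ X) (γ t) (deriv γ t)) t :=
      (((hX t).fderiv_right (m := ∞) (by simp)).differentiableAt
        (by simp)).hasFDerivAt.comp_hasDerivAt t (hγd t)
    have h3 : HasDerivAt (deriv γ) (deriv (deriv γ) t) t :=
      ((contDiffAt_deriv hγ.contDiffAt).differentiableAt (n := ∞) (by simp)).hasDerivAt
    rw [h1, (h2.clm_apply h3).deriv]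
  have e1 : (F ∘ retraction) ∘ γ = F ∘ γ := funext fun s => by
    simp [retraction_of_mem (hm s)]
  have e2 : retraction ∘ γ = γ := funext fun s => by simp [retraction_of_mem (hm s)]
  have k1 := hdd (F ∘ retraction) fun s => hF.contDiffAt_comp (S2H2_subset_retractionDomain (hm s))
  have k2 := hdd retraction fun s => contDiffAt_retraction (S2H2_subset_retractionDomain (hm s))
  rw [e1] at k1
  rw [e2] at k2
  have hw' := fderiv_retraction_of_mem (hm t) hw
  have hFw : fderiv ℝ F (γ t) w = fderiv ℝ (F ∘ retraction) (γ t) w := by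
    rw [hF.fderiv_comp hd, hw', retraction_of_mem (hm t)]
  have hQ : form (fderiv ℝ (F ∘ retraction) (γ t) (deriv (deriv γ) t))
      (fderiv ℝ (F ∘ retraction) (γ t) w) =
      form (fderiv ℝ retraction (γ t) (deriv (deriv γ) t)) (fderiv ℝ retraction (γ t) w) := by
    rw [hF.fderiv_comp hd, hF.fderiv_comp hd]
    exact hF.metric _ (retraction_mem hd) _ (fderiv_retraction_mem hd _) _
        (fderiv_retraction_mem hd _)
  have h3 := hK (deriv γ t) (deriv γ t) w
  have h4 := congrArg (fun z => form z w) k2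
  simp only [form_add_left] at h4
  rw [k1, hFw, form_add_left, h3, hQ, hw', ← h4]

/-- Isometries map geodesics to geodesics. -/
theorem projAmbient_deriv_deriv (hF : IsAmbientIsometry F) {γ : ℝ → Ambient}
    (hγ : ContDiff ℝ ∞ γ) (hm : ∀ t, γ t ∈ S2H2) (t : ℝ)
    (hgeo : ∀ w ∈ tangentSub (γ t), form (deriv (deriv γ) t) w = 0) :
    projAmbient (F (γ t)) (deriv (deriv (F ∘ γ)) t) = 0 := by
  obtain ⟨v, hv1, hv2⟩ := exists_unit_tangentS (γ t).1
  obtain ⟨w, hw1, hw2⟩ := exists_unit_tangentH (hm t).2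
  have fr := isUnitaryFrame_inl_inr hv1 hv2 hw1 hw2
  have hFm := hF.bijOn.mapsTo (hm t)
  -- The image of an orthonormal basis under the differential of F is again one, so tangential
  -- acceleration can be tested on it.
  let E : Fin 4 → Ambient := ![(v, 0), (0, w), Jsgn 1 (γ t) (v, 0), Jsgn 1 (γ t) (0, w)]
  have hE : ∀ i, E i ∈ tangentSub (γ t) := fun i => by
    fin_cases i
    exacts [fr.mem_fst, fr.mem_snd, Jsgn_mem .., Jsgn_mem ..]
  have hort := fr.orthonormal (by norm_num) (hm t)
  refine eq_zero_of_orthonormal hFm (fun i => fderiv ℝ F (γ t) (E i))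
    (fun i => hF.fderiv_mem (hm t) (hE i)) (fun i j => ?_) (projAmbient_mem hFm _) fun i => ?_
  · rw [hF.metric _ (hm t) _ (hE i) _ (hE j)]
    exact hort i j
  · rw [form_projAmbient (hF.fderiv_mem (hm t) (hE i)), hF.form_deriv_deriv hγ hm t (hE i)]
    exact hgeo _ (hE i)

end IsAmbientIsometry

/-! ### Geodesics of `S² × H²` -/

/-- The dot product as a continuous bilinear map. -/
def dotB : R3 →L[ℝ] R3 →L[ℝ] ℝ :=
  formB.bilinearComp (ContinuousLinearMap.inl ℝ R3 R3) (ContinuousLinearMap.inl ℝ R3 R3)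

/-- The Lorentzian inner product as a continuous bilinear map. -/
def lorentzB : R3 →L[ℝ] R3 →L[ℝ] ℝ :=
  formB.bilinearComp (ContinuousLinearMap.inr ℝ R3 R3) (ContinuousLinearMap.inr ℝ R3 R3)

theorem dotB_apply (v w : R3) : dotB v w = v ⬝ᵥ w := form_inl_inl v w

theorem lorentzB_apply (v w : R3) : lorentzB v w = lorentz v w := form_inr_inr v w

theorem lorentz_comm (v w : R3) : lorentz v w = lorentz w v := by
  simp only [lorentz]; ring

/-- A curve in a quadric whose acceleration is radial has constant speed and satisfies a linear
equation with constant coefficients. -/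
theorem radial_acceleration {β : R3 →L[ℝ] R3 →L[ℝ] ℝ} (hβ : ∀ v w, β v w = β w v) {κ : ℝ}
    (hκ : κ * κ = 1) {y y' y'' : ℝ → R3} (h1 : ∀ t, HasDerivAt y (y' t) t)
    (h2 : ∀ t, HasDerivAt y' (y'' t) t) (hB : ∀ t, β (y t) (y t) = κ) {l : ℝ → ℝ}
    (hl : ∀ t, y'' t = l t • y t) (t : ℝ) : y'' t = (-κ * β (y' 0) (y' 0)) • y t := by
  have hd : ∀ {a b : ℝ → R3} {a' b' : R3} {t : ℝ}, HasDerivAt a a' t → HasDerivAt b b' t →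
      HasDerivAt (fun s => β (a s) (b s)) (β a' (b t) + β (a t) b') t := fun ha hb =>
    (β.hasFDerivAt.comp_hasDerivAt _ ha).clm_apply hb
  have e1 : ∀ t, β (y t) (y' t) = 0 := fun t => by
    have h := hd (h1 t) (h1 t)
    simp only [hB] at h
    have h0 := h.unique (hasDerivAt_const t κ)
    rw [hβ (y' t)] at h0
    linarith
  -- Differentiating β(y, y') = 0 gives l κ = -β(y', y'), and κ is its own inverse.
  have e2 : ∀ t, l t = -κ * β (y' t) (y' t) := fun t => by
    have h := hd (h1 t) (h2 t)
    simp only [e1] at h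
    have h0 := h.unique (hasDerivAt_const t 0)
    rw [hl, map_smul, hB, smul_eq_mul] at h0
    linear_combination κ * h0 - l t * hκ
  have e3 : ∀ t, HasDerivAt (fun s => β (y' s) (y' s)) 0 t := fun t => by
    have h := hd (h2 t) (h2 t)
    rw [hβ (y'' t), hl, map_smul, hβ, e1, smul_zero, add_zero] at h
    exact h
  rw [hl, e2, is_const_of_deriv_eq_zero (fun s => (e3 s).differentiableAt)
    (fun s => (e3 s).deriv) t 0]

/-- Uniqueness for the equation `y'' = c y`. -/
theorem eq_of_second_order {c : ℝ} {y y' z z' : ℝ → R3} (h1 : ∀ t, HasDerivAt y (y' t) t)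
    (h2 : ∀ t, HasDerivAt y' (c • y t) t) (k1 : ∀ t, HasDerivAt z (z' t) t)
    (k2 : ∀ t, HasDerivAt z' (c • z t) t) (h0 : y 0 = z 0) (h0' : y' 0 = z' 0) : y = z := by
  let L : R3 × R3 →L[ℝ] R3 × R3 :=
    (ContinuousLinearMap.snd ℝ R3 R3).prod (c • ContinuousLinearMap.fst ℝ R3 R3)
  have h := ODE_solution_unique_univ (v := fun _ => L) (s := fun _ => Set.univ) (t₀ := 0)
    (f := fun t => (y t, y' t)) (g := fun t => (z t, z' t))
    (fun _ => L.lipschitz.lipschitzOnWith) (fun t => ⟨(h1 t).prodMk (h2 t), trivial⟩)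
    (fun t => ⟨(k1 t).prodMk (k2 t), trivial⟩) (by simp [h0, h0'])
  funext t
  exact congrArg Prod.fst (congrFun h t)

/-- The great circle from `x` in the direction `v` with speed `a`. -/
def circleCurve (x v : R3) (a t : ℝ) : R3 := Real.cos (a * t) • x + Real.sin (a * t) • v

/-- The hyperbola from `y` in the direction `w` with speed `b`. -/
def hyperbolaCurve (y w : R3) (b t : ℝ) : R3 := Real.cosh (b * t) • y + Real.sinh (b * t) • w

/-- The derivative stays in the same family, with `(x, v)` replaced by `(v, -x)`, so a second use
gives the acceleration. -/
theorem hasDerivAt_circleCurve (x v : R3) (a t : ℝ) :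
    HasDerivAt (circleCurve x v a) (a • circleCurve v (-x) a t) t := by
  have h : HasDerivAt (fun s : ℝ => a * s) a t := by simpa using (hasDerivAt_id t).const_mul a
  have h' := (h.cos.smul_const x).add (h.sin.smul_const v)
  have he : a • circleCurve v (-x) a t =
      (-Real.sin (a * t) * a) • x + (Real.cos (a * t) * a) • v := by
    simp only [circleCurve]; module
  rw [he]; exact h'

theorem hasDerivAt_hyperbolaCurve (y w : R3) (b t : ℝ) :
    HasDerivAt (hyperbolaCurve y w b) (b • hyperbolaCurve w y b t) t := by
  have h : HasDerivAt (fun s : ℝ => b * s) b t := by simpa using (hasDerivAt_id t).const_mul b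
  have h' := (h.cosh.smul_const y).add (h.sinh.smul_const w)
  have he : b • hyperbolaCurve w y b t =
      (Real.sinh (b * t) * b) • y + (Real.cosh (b * t) * b) • w := by
    simp only [hyperbolaCurve]; module
  rw [he]; exact h'

theorem hasDerivAt_smul_circleCurve (x v : R3) (a t : ℝ) :
    HasDerivAt (fun s => a • circleCurve v (-x) a s) ((-(a * a)) • circleCurve x v a t) t := by
  have h := (hasDerivAt_circleCurve v (-x) a t).const_smul a
  have he : (-(a * a)) • circleCurve x v a t = a • a • circleCurve (-x) (-v) a t := by
    simp only [circleCurve]; module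
  rw [he]; exact h

theorem hasDerivAt_smul_hyperbolaCurve (y w : R3) (b t : ℝ) :
    HasDerivAt (fun s => b • hyperbolaCurve w y b s) ((b * b) • hyperbolaCurve y w b t) t := by
  rw [mul_smul]
  exact (hasDerivAt_hyperbolaCurve w y b t).const_smul b

theorem contDiff_circleCurve (x v : R3) (a : ℝ) : ContDiff ℝ ∞ (circleCurve x v a) := by
  unfold circleCurve; fun_prop

theorem contDiff_hyperbolaCurve (y w : R3) (b : ℝ) : ContDiff ℝ ∞ (hyperbolaCurve y w b) := by
  unfold hyperbolaCurve; fun_prop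

theorem circleCurve_zero (x v : R3) (a : ℝ) : circleCurve x v a 0 = x := by simp [circleCurve]

theorem hyperbolaCurve_zero (y w : R3) (b : ℝ) : hyperbolaCurve y w b 0 = y := by
  simp [hyperbolaCurve]

theorem circleCurve_mem {x v : R3} (hx : x ∈ S2) (hxv : x ⬝ᵥ v = 0) (hv : v ⬝ᵥ v = 1) (a t : ℝ) :
    circleCurve x v a t ∈ S2 := by
  have hx : x ⬝ᵥ x = 1 := hx
  change circleCurve x v a t ⬝ᵥ circleCurve x v a t = 1
  simp only [circleCurve, dot_apply, Pi.add_apply, Pi.smul_apply, smul_eq_mul] at *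
  linear_combination Real.cos (a * t) ^ 2 * hx + Real.sin (a * t) ^ 2 * hv +
    2 * Real.cos (a * t) * Real.sin (a * t) * hxv + Real.sin_sq_add_cos_sq (a * t)

theorem hyperbolaCurve_mem {y w : R3} (hy : y ∈ H2) (hyw : lorentz y w = 0) (hw : lorentz w w = 1)
    (b t : ℝ) : hyperbolaCurve y w b t ∈ H2 := by
  obtain ⟨hy1, hy2⟩ := hy
  have hcs := Real.cosh_sq (b * t)
  have hc := Real.cosh_pos (b * t)
  constructor
  · simp only [hyperbolaCurve, lorentz, Pi.add_apply, Pi.smul_apply, smul_eq_mul] at *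
    linear_combination Real.cosh (b * t) ^ 2 * hy1 + Real.sinh (b * t) ^ 2 * hw +
      2 * Real.cosh (b * t) * Real.sinh (b * t) * hyw - hcs
  -- To stay on the upper sheet, |w 2| must be less than `y 2`. Lagrange's identity for the first
  -- two coordinates provides this.
  · have h1 : w 2 ^ 2 ≤ y 2 ^ 2 - 1 := by
      simp only [lorentz] at hy1 hyw hw
      have e : w 2 * y 2 = y 0 * w 0 + y 1 * w 1 := by linarith
      have e2 : (w 2 * y 2) ^ 2 + (y 0 * w 1 - y 1 * w 0) ^ 2 =
          (y 2 ^ 2 - 1) * (1 + w 2 ^ 2) := by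
        rw [e, show y 2 ^ 2 - 1 = y 0 ^ 2 + y 1 ^ 2 by linarith,
          show 1 + w 2 ^ 2 = w 0 ^ 2 + w 1 ^ 2 by linarith]
        ring
      nlinarith [sq_nonneg (y 0 * w 1 - y 1 * w 0)]
    have h2 : (Real.sinh (b * t) * w 2) ^ 2 < (Real.cosh (b * t) * y 2) ^ 2 := by
      rw [mul_pow, mul_pow, hcs]
      nlinarith [sq_nonneg (Real.sinh (b * t)), pow_pos hy2 2]
    have h3 := (abs_lt.1 (abs_lt_of_sq_lt_sq h2 (mul_pos hc hy2).le)).1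
    simp only [hyperbolaCurve, Pi.add_apply, Pi.smul_apply, smul_eq_mul]
    linarith

/-- Polar decomposition of tangent vectors of the sphere. -/
theorem exists_smul_unitS {x u : R3} (h : x ⬝ᵥ u = 0) :
    ∃ (a : ℝ) (v : R3), u = a • v ∧ x ⬝ᵥ v = 0 ∧ v ⬝ᵥ v = 1 := by
  by_cases hu : u = 0
  · obtain ⟨v, hv⟩ := exists_unit_tangentS x
    exact ⟨0, v, by simp [hu], hv⟩
  · have hs := dot_self_pos hu
    have q := Real.mul_self_sqrt hs.le
    have q0 := (Real.sqrt_pos.2 hs).ne'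
    refine ⟨√(u ⬝ᵥ u), (√(u ⬝ᵥ u))⁻¹ • u, by rw [smul_inv_smul₀ q0],
      by rw [dotProduct_smul, h, smul_zero], ?_⟩
    rw [smul_dotProduct, dotProduct_smul, smul_eq_mul, smul_eq_mul]
    field_simp; linarith

/-- Polar decomposition of tangent vectors of the hyperbolic plane. -/
theorem exists_smul_unitH {y u : R3} (hy : y ∈ H2) (h : lorentz y u = 0) :
    ∃ (a : ℝ) (v : R3), u = a • v ∧ lorentz y v = 0 ∧ lorentz v v = 1 := by
  by_cases hu : u = 0
  · obtain ⟨v, hv⟩ := exists_unit_tangentH hy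
    exact ⟨0, v, by simp [hu], hv⟩
  · have hs := lorentz_self_pos hy.1 h hu
    have q := Real.mul_self_sqrt hs.le
    have q0 := (Real.sqrt_pos.2 hs).ne'
    refine ⟨√(lorentz u u), (√(lorentz u u))⁻¹ • u, by rw [smul_inv_smul₀ q0], ?_, ?_⟩
    · rw [← lorentzB_apply, map_smul, lorentzB_apply, h, smul_zero]
    · rw [lorentz_smul_smul]
      field_simp; linarith

/-- Any two points of the sphere are joined by a great circle. -/
theorem exists_circleCurve_eq {x z : R3} (hx : x ∈ S2) (hz : z ∈ S2) :
    ∃ (a : ℝ) (v : R3), x ⬝ᵥ v = 0 ∧ v ⬝ᵥ v = 1 ∧ z = circleCurve x v a 1 := by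
  have hx : x ⬝ᵥ x = 1 := hx
  have hz : z ⬝ᵥ z = 1 := hz
  have h : x ⬝ᵥ projS x z = 0 := by simp [projS, hx]
  obtain ⟨s, v, hu, hxv, hv⟩ := exists_smul_unitS h
  have hzv : z = (x ⬝ᵥ z) • x + s • v := by rw [← hu, projS]; abel
  have hcs : (x ⬝ᵥ z) ^ 2 + s ^ 2 = 1 := by
    have hvx : v ⬝ᵥ x = 0 := by rw [dotProduct_comm, hxv]
    rw [hzv] at hz
    simp only [add_dotProduct, dotProduct_add, smul_dotProduct, dotProduct_smul, hx, hv, hxv, hvx,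
      smul_eq_mul] at hz
    linarith
  -- The angle from `x` to `z` is the argument of the unit complex number with real part ⟨x, z⟩ and
  -- imaginary part `s`.
  have hn : ‖(⟨x ⬝ᵥ z, s⟩ : ℂ)‖ = 1 := by
    rw [Complex.norm_eq_sqrt_sq_add_sq, hcs, Real.sqrt_one]
  have h0 : (⟨x ⬝ᵥ z, s⟩ : ℂ) ≠ 0 := fun h0 => by rw [h0] at hn; simp at hn
  refine ⟨Complex.arg ⟨x ⬝ᵥ z, s⟩, v, hxv, hv, ?_⟩
  rw [circleCurve, mul_one, Complex.cos_arg h0, Complex.sin_arg, hn, div_one, div_one]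
  exact hzv

/-- Any two points of the hyperbolic plane are joined by a hyperbola. -/
theorem exists_hyperbolaCurve_eq {y z : R3} (hy : y ∈ H2) (hz : z ∈ H2) :
    ∃ (b : ℝ) (w : R3), lorentz y w = 0 ∧ lorentz w w = 1 ∧ z = hyperbolaCurve y w b 1 := by
  have h : lorentz y (projH y z) = 0 := by
    rw [← lorentzB_apply, projH, map_add, map_smul, lorentzB_apply, lorentzB_apply, hy.1]
    simp
  obtain ⟨s, w, hu, hyw, hw⟩ := exists_smul_unitH hy h
  have hzw : z = (-lorentz y z) • y + s • w := by rw [← hu, projH]; module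
  have hcs : (lorentz y z) ^ 2 = 1 + s ^ 2 := by
    have hwy : lorentz w y = 0 := by rw [lorentz_comm, hyw]
    have hz1 := hz.1
    have hy1 := hy.1
    rw [hzw] at hz1
    simp only [← lorentzB_apply, map_add, map_smul, add_apply,
      smul_apply, smul_eq_mul] at *
    rw [hy1, hyw, hwy, hw] at hz1
    linarith
  -- Both points lie on the upper sheet, so -⟨y, z⟩ is positive; hence it equals √(1 + s²), the
  -- hyperbolic cosine of `arsinh s`.
  have hpos : 0 < -lorentz y z := by
    have h1 := hy.1
    have h2 := hz.1
    have hy2 := hy.2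
    have hz2 := hz.2
    simp only [lorentz] at h1 h2 ⊢
    have h3 : (y 0 * z 0 + y 1 * z 1) ^ 2 < (y 2 * z 2) ^ 2 := by
      have : (y 0 * z 0 + y 1 * z 1) ^ 2 + (y 0 * z 1 - y 1 * z 0) ^ 2 =
          (y 2 ^ 2 - 1) * (z 2 ^ 2 - 1) := by
        rw [show y 2 ^ 2 - 1 = y 0 ^ 2 + y 1 ^ 2 by linarith,
          show z 2 ^ 2 - 1 = z 0 ^ 2 + z 1 ^ 2 by linarith]
        ring
      nlinarith [sq_nonneg (y 0 * z 1 - y 1 * z 0), sq_nonneg (y 0), sq_nonneg (y 1),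
        sq_nonneg (z 0), sq_nonneg (z 1)]
    have h4 := (abs_lt.1 (abs_lt_of_sq_lt_sq h3 (mul_pos hy2 hz2).le)).2
    linarith
  refine ⟨Real.arsinh s, w, hyw, hw, ?_⟩
  rw [hyperbolaCurve, mul_one, Real.cosh_arsinh, Real.sinh_arsinh, ← hcs, ← neg_sq,
    Real.sqrt_sq hpos.le]
  exact hzw

theorem eq_zero_of_orthonormal_dot {x a b u : R3} (hx : x ⬝ᵥ x = 1) (ha : a ⬝ᵥ a = 1)
    (hb : b ⬝ᵥ b = 1) (hxa : x ⬝ᵥ a = 0) (hxb : x ⬝ᵥ b = 0) (hab : a ⬝ᵥ b = 0) (h1 : x ⬝ᵥ u = 0)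
    (h2 : a ⬝ᵥ u = 0) (h3 : b ⬝ᵥ u = 0) : u = 0 := by
  let M : Matrix (Fin 3) (Fin 3) ℝ := Matrix.of ![x, a, b]
  have hax : a ⬝ᵥ x = 0 := by rw [dotProduct_comm, hxa]
  have hbx : b ⬝ᵥ x = 0 := by rw [dotProduct_comm, hxb]
  have hba : b ⬝ᵥ a = 0 := by rw [dotProduct_comm, hab]
  have hM : M * Mᵀ = 1 := by
    ext i j
    change (![x, a, b] : Fin 3 → R3) i ⬝ᵥ (![x, a, b] : Fin 3 → R3) j = _
    fin_cases i <;> fin_cases j <;> simp [hx, ha, hb, hxa, hxb, hab, hax, hbx, hba]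
  have hu : M *ᵥ u = 0 := by
    ext i
    change (![x, a, b] : Fin 3 → R3) i ⬝ᵥ u = 0
    fin_cases i
    exacts [h1, h2, h3]
  rw [← Matrix.one_mulVec u, ← mul_eq_one_comm.1 hM, ← Matrix.mulVec_mulVec, hu,
    Matrix.mulVec_zero]

/-! ### Isometries of `S² × H²` are linear -/

namespace IsAmbientIsometry

variable {F : Ambient → Ambient} {p : Ambient} {v w : R3}

/-- The image of a geodesic is the geodesic with the image initial conditions. -/
theorem map_geodesic (hF : IsAmbientIsometry F) (hp : p ∈ S2H2) (hv : p.1 ⬝ᵥ v = 0)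
    (hv1 : v ⬝ᵥ v = 1) (hw : lorentz p.2 w = 0) (hw1 : lorentz w w = 1) {a b c d : ℝ} {V W : R3}
    (hV : (fderiv ℝ F p (a • v, b • w)).1 = c • V) (hV1 : V ⬝ᵥ V = 1)
    (hW : (fderiv ℝ F p (a • v, b • w)).2 = d • W) (hW1 : lorentz W W = 1) (t : ℝ) :
    F (circleCurve p.1 v a t, hyperbolaCurve p.2 w b t) =
      (circleCurve (F p).1 V c t, hyperbolaCurve (F p).2 W d t) := by
  set γ : ℝ → Ambient := fun t => (circleCurve p.1 v a t, hyperbolaCurve p.2 w b t) with hγ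
  have hm : ∀ t, γ t ∈ S2H2 := fun t =>
    ⟨circleCurve_mem hp.1 hv hv1 a t, hyperbolaCurve_mem hp.2 hw hw1 b t⟩
  have hs : ContDiff ℝ ∞ γ := (contDiff_circleCurve _ _ _).prodMk (contDiff_hyperbolaCurve _ _ _)
  have hd1 : ∀ t, HasDerivAt γ
      (a • circleCurve v (-p.1) a t, b • hyperbolaCurve w p.2 b t) t := fun t =>
    (hasDerivAt_circleCurve _ _ _ _).prodMk (hasDerivAt_hyperbolaCurve _ _ _ _)
  have hd2 : ∀ t, HasDerivAt (deriv γ)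
      ((-(a * a)) • (γ t).1, (b * b) • (γ t).2) t := fun t => by
    rw [show deriv γ = _ from funext fun t => (hd1 t).deriv]
    exact (hasDerivAt_smul_circleCurve _ _ _ _).prodMk (hasDerivAt_smul_hyperbolaCurve _ _ _ _)
  have hgeo : ∀ t, ∀ u ∈ tangentSub (γ t), form (deriv (deriv γ) t) u = 0 := fun t u hu => by
    have h1 : (γ t).1 ⬝ᵥ u.1 = 0 := hu.1
    have h2 := lorentz_smul_smul (b * b) 1 (γ t).2 u.2
    rw [one_smul, hu.2, mul_zero] at h2
    rw [(hd2 t).deriv, form_mk, smul_dotProduct, h1, h2, smul_zero, add_zero]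
  set σ := F ∘ γ with hσ
  have hσs : ∀ t, ContDiffAt ℝ ∞ σ t := fun t => (hF.contDiffAt (hm t)).comp t hs.contDiffAt
  have k1 : ∀ t, HasDerivAt σ (deriv σ t) t := fun t =>
    ((hσs t).differentiableAt (by simp)).hasDerivAt
  have k2 : ∀ t, HasDerivAt (deriv σ) (deriv (deriv σ) t) t := fun t =>
    ((contDiffAt_deriv (hσs t)).differentiableAt (n := ∞) (by simp)).hasDerivAt
  have hσm : ∀ t, σ t ∈ S2H2 := fun t => hF.bijOn.mapsTo (hm t)
  have hproj : ∀ t, projAmbient (σ t) (deriv (deriv σ) t) = 0 := fun t =>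
    hF.projAmbient_deriv_deriv hs hm t (hgeo t)
  have hγ0 : γ 0 = p := Prod.ext (circleCurve_zero ..) (hyperbolaCurve_zero ..)
  have hσ0 : σ 0 = F p := congrArg F hγ0
  have hσ1 : deriv σ 0 = fderiv ℝ F p (a • v, b • w) := by
    have h := (((hF.contDiffAt (hm 0)).differentiableAt
      (by simp)).hasFDerivAt.comp_hasDerivAt 0 (hd1 0)).deriv
    rw [circleCurve_zero, hyperbolaCurve_zero, hγ0] at h
    exact h
  -- The image curve has no tangential acceleration, so each component accelerates along its own
  -- position vector. Constancy of the component speeds turns this into linear equations with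
  -- coefficients `-(c * c)` and `d * d`.
  have r1 := radial_acceleration (β := dotB) (fun v w => by
    rw [dotB_apply, dotB_apply, dotProduct_comm]) (κ := 1) (by norm_num)
    (fun t => hasDerivAt_fst (k1 t)) (fun t => hasDerivAt_fst (k2 t))
    (fun t => by rw [dotB_apply]; exact (hσm t).1)
    (l := fun t => (σ t).1 ⬝ᵥ (deriv (deriv σ) t).1)
    fun t => sub_eq_zero.1 (congrArg Prod.fst (hproj t))
  have r2 := radial_acceleration (β := lorentzB) (fun v w => by
    rw [lorentzB_apply, lorentzB_apply, lorentz_comm]) (κ := -1) (by norm_num)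
    (fun t => hasDerivAt_snd (k1 t)) (fun t => hasDerivAt_snd (k2 t))
    (fun t => by rw [lorentzB_apply]; exact (hσm t).2.1)
    (l := fun t => -lorentz (σ t).2 (deriv (deriv σ) t).2)
    fun t => by
      rw [neg_smul]
      exact eq_neg_of_add_eq_zero_left (congrArg Prod.snd (hproj t))
  rw [hσ1] at r1 r2
  rw [hV, dotB_apply, smul_dotProduct, dotProduct_smul, hV1] at r1
  rw [hW, lorentzB_apply, lorentz_smul_smul, hW1] at r2
  refine Prod.ext ?_ ?_
  · refine congrFun (eq_of_second_order (c := -(c * c)) (fun t => hasDerivAt_fst (k1 t))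
      (fun t => ?_) (hasDerivAt_circleCurve _ _ _) (hasDerivAt_smul_circleCurve _ _ _) ?_ ?_) t
    · have := hasDerivAt_fst (k2 t)
      rw [r1] at this
      simpa using this
    · rw [hσ0, circleCurve_zero]
    · rw [hσ1, hV, circleCurve_zero]
  · refine congrFun (eq_of_second_order (c := d * d) (fun t => hasDerivAt_snd (k1 t))
      (fun t => ?_) (hasDerivAt_hyperbolaCurve _ _ _) (hasDerivAt_smul_hyperbolaCurve _ _ _) ?_ ?_) t
    · have := hasDerivAt_snd (k2 t)
      rw [r2] at this
      simpa using this
    · rw [hσ0, hyperbolaCurve_zero]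
    · rw [hσ1, hW, hyperbolaCurve_zero]

/-- Closed geodesics only move in the sphere, so the differential maps the tangent planes of the
sphere to each other. -/
theorem fderiv_inl_snd (hF : IsAmbientIsometry F) (hp : p ∈ S2H2) (hv : p.1 ⬝ᵥ v = 0) :
    (fderiv ℝ F p (v, 0)).2 = 0 := by
  obtain ⟨r, e, rfl, he, he1⟩ := exists_smul_unitS hv
  obtain ⟨w, hw, hw1⟩ := exists_unit_tangentH hp.2
  have hm := hF.fderiv_mem hp (inl_mem he)
  obtain ⟨c, V, hV, -, hV1⟩ := exists_smul_unitS hm.1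
  obtain ⟨d, W, hW, hWy, hW1⟩ := exists_smul_unitH (hF.bijOn.mapsTo hp).2 hm.2
  -- The great circle in the slice through `p` is back at time 2π, so its image is too. The pairing
  -- of `W` with the H²-part of the image is sinh(2πd), which forces d = 0.
  have h := hF.map_geodesic hp he he1 hw hw1 (a := 1) (b := 0) (c := c) (d := d)
    (by rw [one_smul, zero_smul]; exact hV) hV1 (by rw [one_smul, zero_smul]; exact hW) hW1
    (2 * Real.pi)
  have h0 : (circleCurve p.1 e 1 (2 * Real.pi), hyperbolaCurve p.2 w 0 (2 * Real.pi)) = p :=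
    Prod.ext (by simp [circleCurve]) (by simp [hyperbolaCurve])
  rw [h0] at h
  have h2 := congrArg (fun z : Ambient => lorentzB W z.2) h
  have hWy' : lorentz W (F p).2 = 0 := by rw [lorentz_comm, hWy]
  simp only [hyperbolaCurve, map_add, map_smul, lorentzB_apply, hWy', hW1, smul_eq_mul, mul_zero,
    zero_add, mul_one] at h2
  have hd : d = 0 := by simpa [Real.pi_ne_zero] using h2.symm
  rw [show ((r • e, 0) : Ambient) = r • (e, 0) by simp, map_smul, Prod.smul_snd, hW, hd]
  simp

theorem dot_fderiv_inl (hF : IsAmbientIsometry F) (hp : p ∈ S2H2) (hv : p.1 ⬝ᵥ v = 0)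
    (hw : p.1 ⬝ᵥ w = 0) :
    (fderiv ℝ F p (v, 0)).1 ⬝ᵥ (fderiv ℝ F p (w, 0)).1 = v ⬝ᵥ w := by
  have h := hF.metric p hp _ (inl_mem hv) _ (inl_mem hw)
  rwa [form_inl_inl, form, hF.fderiv_inl_snd hp hv, lorentz_comm, lorentz_zero_right,
    add_zero] at h

/-- The differential maps an orthonormal basis of the sphere's tangent plane to one of the image
tangent plane. The S²-part of the image of `(0, w)` is tangent there and orthogonal to both vectors,
so it is zero. -/
theorem fderiv_inr_fst (hF : IsAmbientIsometry F) (hp : p ∈ S2H2) (hw : lorentz p.2 w = 0) :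
    (fderiv ℝ F p (0, w)).1 = 0 := by
  obtain ⟨v, hv, hv1⟩ := exists_unit_tangentS p.1
  have hJ : p.1 ⬝ᵥ JS p.1 v = 0 := (Jsgn_mem 1 p (v, 0)).1
  have ho : ∀ {u}, p.1 ⬝ᵥ u = 0 →
      (fderiv ℝ F p (u, 0)).1 ⬝ᵥ (fderiv ℝ F p (0, w)).1 = 0 := fun {u} hu => by
    have h := hF.metric p hp _ (inl_mem hu) _ (inr_mem hw)
    rwa [form_inl_inr, form, hF.fderiv_inl_snd hp hu, lorentz_comm, lorentz_zero_right,
      add_zero] at h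
  have hvJ : v ⬝ᵥ JS p.1 v = 0 := by
    simp only [dot_apply, JS_zero, JS_one, JS_two]; ring
  refine eq_zero_of_orthonormal_dot (hF.bijOn.mapsTo hp).1
    (a := (fderiv ℝ F p (v, 0)).1) (b := (fderiv ℝ F p (JS p.1 v, 0)).1)
    ?_ ?_ (hF.fderiv_mem hp (inl_mem hv)).1 (hF.fderiv_mem hp (inl_mem hJ)).1 ?_
    (hF.fderiv_mem hp (inr_mem hw)).1 (ho hv) (ho hJ)
  · rw [hF.dot_fderiv_inl hp hv hv, hv1]
  · rw [hF.dot_fderiv_inl hp hJ hJ, dot_JS_JS hp.1 hv, hv1]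
  · rw [hF.dot_fderiv_inl hp hv hJ, hvJ]

theorem lorentz_fderiv_inr (hF : IsAmbientIsometry F) (hp : p ∈ S2H2) (hv : lorentz p.2 v = 0)
    (hw : lorentz p.2 w = 0) :
    lorentz (fderiv ℝ F p (0, v)).2 (fderiv ℝ F p (0, w)).2 = lorentz v w := by
  have h := hF.metric p hp _ (inr_mem hv) _ (inr_mem hw)
  rwa [form_inr_inr, form, hF.fderiv_inr_fst hp hv, zero_dotProduct, zero_add] at h

/-- Every isometry of `S² × H²` is the restriction of a product of linear isometries. -/
theorem exists_isLinearIsometry (hF : IsAmbientIsometry F) (hp : p ∈ S2H2) :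
    ∃ A B : R3 →L[ℝ] R3, IsLinearIsometry A B ∧ ∀ z ∈ S2H2, F z = A.prodMap B z := by
  have hFp := hF.bijOn.mapsTo hp
  have hx : p.1 ⬝ᵥ p.1 = 1 := hp.1
  have hX : (F p).1 ⬝ᵥ (F p).1 = 1 := hFp.1
  have hPS : ∀ u, p.1 ⬝ᵥ projS p.1 u = 0 := fun u => by simp [projS, hx]
  have hPH : ∀ u, lorentz p.2 (projH p.2 u) = 0 := fun u => by
    rw [← lorentzB_apply, projH, map_add, map_smul, lorentzB_apply, lorentzB_apply, hp.2.1]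
    simp
  let PS : R3 →L[ℝ] R3 := ContinuousLinearMap.id ℝ R3 - (dotB p.1).smulRight p.1
  let PH : R3 →L[ℝ] R3 := ContinuousLinearMap.id ℝ R3 + (lorentzB p.2).smulRight p.2
  -- `A` and `B` send the position vectors of `p` to those of `F p` and act on the tangent planes by
  -- the differential of F. The sign in `B` compensates for ⟨y, y⟩ = -1.
  let A : R3 →L[ℝ] R3 := (dotB p.1).smulRight (F p).1 +
    ContinuousLinearMap.fst ℝ R3 R3 ∘L fderiv ℝ F p ∘L ContinuousLinearMap.inl ℝ R3 R3 ∘L PS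
  let B : R3 →L[ℝ] R3 := -(lorentzB p.2).smulRight (F p).2 +
    ContinuousLinearMap.snd ℝ R3 R3 ∘L fderiv ℝ F p ∘L ContinuousLinearMap.inr ℝ R3 R3 ∘L PH
  have hPS' : ∀ u, PS u = projS p.1 u := fun u => by
    change u - dotB p.1 u • p.1 = _
    rw [dotB_apply, projS]
  have hPH' : ∀ u, PH u = projH p.2 u := fun u => by
    change u + lorentzB p.2 u • p.2 = _
    rw [lorentzB_apply, projH]
  have hA : ∀ u, A u = (p.1 ⬝ᵥ u) • (F p).1 + (fderiv ℝ F p (projS p.1 u, 0)).1 := fun u => by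
    rw [← hPS', ← dotB_apply]; rfl
  have hB : ∀ u, B u = (-lorentz p.2 u) • (F p).2 + (fderiv ℝ F p (0, projH p.2 u)).2 := fun u => by
    rw [← hPH', ← lorentzB_apply, neg_smul]; rfl
  refine ⟨A, B, ⟨fun u u' => ?_, fun u u' => ?_⟩, fun z hz => ?_⟩
  · have h1 : (F p).1 ⬝ᵥ (fderiv ℝ F p (projS p.1 u', 0)).1 = 0 :=
      (hF.fderiv_mem hp (inl_mem (hPS u'))).1
    have h2 : (fderiv ℝ F p (projS p.1 u, 0)).1 ⬝ᵥ (F p).1 = 0 := by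
      rw [dotProduct_comm]; exact (hF.fderiv_mem hp (inl_mem (hPS u))).1
    rw [hA, hA, add_dotProduct, dotProduct_add, dotProduct_add, smul_dotProduct, smul_dotProduct,
      dotProduct_smul, dotProduct_smul, h1, h2, hX, hF.dot_fderiv_inl hp (hPS u) (hPS u'), projS,
      projS]
    simp only [sub_dotProduct, dotProduct_sub, smul_dotProduct, dotProduct_smul, hx, smul_eq_mul,
      dotProduct_comm u p.1]
    ring
  · have h1 : lorentz (F p).2 (fderiv ℝ F p (0, projH p.2 u')).2 = 0 :=
      (hF.fderiv_mem hp (inr_mem (hPH u'))).2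
    have h2 : lorentz (fderiv ℝ F p (0, projH p.2 u)).2 (F p).2 = 0 := by
      rw [lorentz_comm]; exact (hF.fderiv_mem hp (inr_mem (hPH u))).2
    have h3 := hF.lorentz_fderiv_inr hp (hPH u) (hPH u')
    have h4 := hFp.2.1
    have h5 := hp.2.1
    rw [hB, hB]
    simp only [← lorentzB_apply, projH, map_add, map_smul, add_apply,
      smul_apply, smul_eq_mul] at *
    rw [h1, h2, h3, h4, h5, lorentzB_apply u p.2, lorentz_comm, ← lorentzB_apply]
    ring
  -- Some geodesic from `p` is at `z` at time 1. F and the linear map agree on it, since both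
  -- respect its explicit formula and they share initial data.
  · obtain ⟨a, v, hv, hv1, hz1⟩ := exists_circleCurve_eq hp.1 hz.1
    obtain ⟨b, w, hw, hw1, hz2⟩ := exists_hyperbolaCurve_eq hp.2 hz.2
    have hD : fderiv ℝ F p (a • v, b • w) =
        a • fderiv ℝ F p (v, 0) + b • fderiv ℝ F p (0, w) := by
      rw [← map_smul, ← map_smul, ← map_add]; simp
    have h := hF.map_geodesic hp hv hv1 hw hw1 (a := a) (b := b) (c := a) (d := b)
      (V := (fderiv ℝ F p (v, 0)).1) (W := (fderiv ℝ F p (0, w)).2)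
      (by rw [hD, Prod.fst_add, Prod.smul_fst, Prod.smul_fst, hF.fderiv_inr_fst hp hw, smul_zero,
        add_zero])
      (by rw [hF.dot_fderiv_inl hp hv hv, hv1])
      (by rw [hD, Prod.snd_add, Prod.smul_snd, Prod.smul_snd, hF.fderiv_inl_snd hp hv, smul_zero,
        zero_add])
      (by rw [hF.lorentz_fderiv_inr hp hw hw, hw1]) 1
    have h00 : fderiv ℝ F p (0, 0) = 0 := map_zero _
    have hAx : A p.1 = (F p).1 := by rw [hA, projS, hx]; simp [h00]
    have hAv : A v = (fderiv ℝ F p (v, 0)).1 := by rw [hA, projS, hv]; simp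
    have hBy : B p.2 = (F p).2 := by rw [hB, projH, hp.2.1]; simp [h00]
    have hBw : B w = (fderiv ℝ F p (0, w)).2 := by rw [hB, projH, hw]; simp
    rw [← hz1, ← hz2] at h
    rw [show F z = _ from h]
    refine Prod.ext ?_ ?_
    · change _ = A z.1
      rw [hz1, circleCurve, circleCurve, map_add, map_smul, map_smul, hAx, hAv]
    · change _ = B z.2
      rw [hz2, hyperbolaCurve, hyperbolaCurve, map_add, map_smul, map_smul, hBy, hBw]

end IsAmbientIsometry

/-! ### Products of curves of constant curvature -/

/-- The two coordinate fields lie in different factors, and every `Jsgn ε` preserves the factors,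
which are orthogonal. -/
theorem kaehler_map_prodCurve {A B : R3 →L[ℝ] R3} {I I' : Set ℝ}
    {α β : ℝ → R3} (hα : IsCurveS I α) (hβ : IsCurveH I' β) {u : E2} (hu : u 0 ∈ I ∧ u 1 ∈ I')
    (ε : ℝ) : kaehler ε (A.prodMap B ∘ prodCurve α β) u = 0 := by
  have hd : fderiv ℝ (A.prodMap B ∘ prodCurve α β) u = A.prodMap B ∘L fderiv ℝ (prodCurve α β) u :=
    ((A.prodMap B).hasFDerivAt.comp u
      (((isPatch_prodCurve hα hβ).contDiffAt hu).differentiableAt (by simp)).hasFDerivAt).fderiv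
  obtain ⟨h0, h1⟩ := prodCurve_fderiv hα hβ hu
  have e0 : fderiv ℝ (A.prodMap B ∘ prodCurve α β) u (bv 0) = (A (deriv α (u 0)), 0) := by
    rw [hd, ContinuousLinearMap.comp_apply, h0]
    exact Prod.ext rfl (map_zero B)
  have e1 : fderiv ℝ (A.prodMap B ∘ prodCurve α β) u (bv 1) = (0, B (deriv β (u 1))) := by
    rw [hd, ContinuousLinearMap.comp_apply, h1]
    exact Prod.ext (map_zero A) rfl
  rw [kaehler, e0, e1, Jsgn_inl, form_inl_inr]

section Surface

variable {S : Type*} [TopologicalSpace S] [ChartedSpace E2 S] {Φ : S → Ambient}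

/-- Around every point, `Φ` is a product of curves followed by a linear isometry. -/
theorem IsLocallyProductOfCurves.exists_chart (h : IsLocallyProductOfCurves Φ) (q : S) :
    ∃ e ∈ IsManifold.maximalAtlas (𝓡 2) ∞ S, q ∈ e.source ∧ ∃ (I I' : Set ℝ) (α β : ℝ → R3)
      (kα kβ : ℝ) (A B : R3 →L[ℝ] R3), IsConstCurvatureCurveS I α kα ∧
      IsConstCurvatureCurveH I' β kβ ∧ (kα ≠ 0 ∨ kβ ≠ 0) ∧ IsLinearIsometry A B ∧
      e.target = {u : E2 | u 0 ∈ I ∧ u 1 ∈ I'} ∧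
      ∀ u ∈ e.target, (A.prodMap B ∘ prodCurve α β) u = (Φ ∘ e.symm) u := by
  obtain ⟨e, he, hq, I, I', α, β, kα, kβ, F, hα, hβ, hk, hF, htar, hf⟩ := h q
  have hm : ∀ u ∈ e.target, prodCurve α β u ∈ S2H2 := fun u hu => by
    rw [htar] at hu
    exact ⟨hα.mem _ hu.1, hβ.mem _ hu.2⟩
  obtain ⟨A, B, hAB, hFAB⟩ := hF.exists_isLinearIsometry (hm _ (e.map_source hq))
  exact ⟨e, he, hq, I, I', α, β, kα, kβ, A, B, hα, hβ, hk, hAB, htar, fun u hu =>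
    ((hf u hu).trans (hFAB _ (hm u hu))).symm⟩

variable [IsManifold (𝓡 2) ∞ S]

theorem IsLocallyProductOfCurves.isPMC (hΦ : IsImmersionIntoS2H2 Φ)
    (h : IsLocallyProductOfCurves Φ) : IsPMC Φ := by
  refine isPMC_of_isPMCPatch hΦ fun q => ?_
  obtain ⟨e, he, hq, I, I', α, β, kα, kβ, A, B, hα, hβ, hk, hAB, htar, hf⟩ := h.exists_chart q
  refine ⟨e, he, hq, IsPMCPatch.congr ?_ e.open_target hf⟩
  rw [htar]
  exact hAB.isPMCPatch_map (isPatch_prodCurve hα.isCurveS hβ.isCurveH)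
    (isPMCPatch_prodCurve hα hβ hk)

theorem IsLocallyProductOfCurves.isLagrangian (hΦ : IsImmersionIntoS2H2 Φ)
    (h : IsLocallyProductOfCurves Φ) (ε : ℝ) : IsLagrangian (Jsgn ε) Φ := by
  refine isLagrangian_of_kaehler_eq_zero hΦ fun q => ?_
  obtain ⟨e, he, hq, I, I', α, β, kα, kβ, A, B, hα, hβ, hk, hAB, htar, hf⟩ := h.exists_chart q
  refine ⟨e, he, hq, ?_⟩
  have hu := e.map_source hq
  rw [← kaehler_congr (eventuallyEq_of_eqOn e.open_target hf hu)]
  rw [htar] at hu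
  exact kaehler_map_prodCurve hα.isCurveS hβ.isCurveH hu ε

end Surface

end SphereHyp

end

theorem proposition5p4 {S : Type*} [TopologicalSpace S]
    [ChartedSpace (EuclideanSpace ℝ (Fin 2)) S] [IsManifold (𝓡 2) ∞ S]
    (Φ : S → SphereHyp.Ambient) (hΦ : SphereHyp.IsImmersionIntoS2H2 Φ) :
    ((SphereHyp.IsPMC Φ ∧
        (SphereHyp.IsLagrangian SphereHyp.J₁ Φ ∨ SphereHyp.IsLagrangian SphereHyp.J₂ Φ)) ↔
      SphereHyp.IsLocallyProductOfCurves Φ) ∧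
    (SphereHyp.IsPMC Φ →
      (SphereHyp.IsLagrangian SphereHyp.J₁ Φ ↔ SphereHyp.IsLagrangian SphereHyp.J₂ Φ)) := by
  rw [SphereHyp.J₁_eq, SphereHyp.J₂_eq]
  have hiff : SphereHyp.IsPMC Φ → (SphereHyp.IsLagrangian (SphereHyp.Jsgn 1) Φ ↔
      SphereHyp.IsLagrangian (SphereHyp.Jsgn (-1)) Φ) := fun hH =>
    ⟨fun h => h.neg hΦ hH (by norm_num), fun h => by
      simpa using h.neg hΦ hH (by norm_num)⟩
  refine ⟨⟨fun ⟨hH, hL⟩ => ?_, fun h => ⟨h.isPMC hΦ, Or.inl (h.isLagrangian hΦ 1)⟩⟩, hiff⟩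
  -- By part (ii), being Lagrangian for one structure means being Lagrangian for both, as the
  -- splitting requires.
  have h1 := hL.elim id (hiff hH).2
  exact SphereHyp.isLocallyProductOfCurves_of_isPMC hΦ hH h1 ((hiff hH).1 h1)
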